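/- Let $r<n$ be non-negative integers (if $r=0$, conditions on $\lambda_r$ or $\nu_r$ below are empty) and let $\Lambda=\{(\lambda_1,\dots,\lambda_r)\in\mathbb Z^r \mid n-r\ge\lambda_1\ge\dots\ge\lambda_r\ge 0\}$. For a dominant weight $\lambda\in\mathbb Z^r$ (i.e. $\lambda_1\ge\dots\ge\lambda_r$) let $\rho_\lambda$ be the irreducible algebraic representation of $GL_r(\mathbb C)$ with highest weight $\lambda$, and, if $\lambda_r\ge 0$, let $R_\lambda$ be the irreducible algebraic representation of $GL_n(\mathbb C)$ with highest weight $(\lambda_1,\dots,\lambda_r,0,\dots,0)\in\mathbb Z^n$. For dominant weights $\lambda,\mu,\nu$ of $GL_r(\mathbb C)$ let $N_{\lambda\mu}^{\nu}$ be the multiplicity of $\rho_\nu$ in $\rho_\lambda^\vee\otimes\rho_\mu$, that is $\dim\operatorname{Hom}_{GL_r(\mathbb C)}(\rho_\nu,\rho_\lambda^\vee\otimes\rho_\mu)$, if $\nu_r\ge 0$, and let $N_{\lambda\mu}^{\nu}=0$ otherwise. Let $\lambda,\mu\in\Lambda$ and put $k_i=\lambda_{r-i+1}+i$ and $l_i=\mu_{r-i+1}+i$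 for $1\le i\le r$. Then $N_{\lambda\mu}^\nu\neq 0$ for only finitely many $\nu$, and $$\det\left(\binom{n+l_i-k_j-1}{l_i-k_j}\right)_{1\le i,j\le r}=\sum_\nu N_{\lambda\mu}^{\nu}\,\dim R_\nu ,$$ where $\nu$ runs over all dominant weights of $GL_r(\mathbb C)$, the terms with $N_{\lambda\mu}^\nu=0$ are read as $0$, and a binomial coefficient with negative lower entry is $0$. -/

import Mathlib

open scoped MatrixGroups TensorProduct

namespace GLRep

/-- Weights of `GL_n(ℂ)`: `λ ∈ ℤⁿ` stands for the character `diag(t₁,…,tₙ) ↦ ∏ tᵢ ^ λᵢ`. It is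
dominant when `λ₁ ≥ ⋯ ≥ λₙ`. -/
abbrev DominantWeight (n : ℕ) : Type := {lam : Fin n → ℤ // Antitone lam}

/-- Regular functions on the algebraic group `GL_n` over `ℂ`: polynomials in the matrix entries
divided by a power of the determinant. -/
def IsRegular {n : ℕ} (f : GL (Fin n) ℂ → ℂ) : Prop :=
  ∃ (p : MvPolynomial (Fin n × Fin n) ℂ) (m : ℕ), ∀ g : GL (Fin n) ℂ,
    f g = MvPolynomial.eval (fun ij => g.val ij.1 ij.2) p * (g.val.det)⁻¹ ^ m

/-- A representation of `GL_n(ℂ)` is algebraic if all its matrix coefficients are regular. -/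
def IsAlgebraic {n : ℕ} {V : Type*} [AddCommGroup V] [Module ℂ V]
    (ρ : Representation ℂ (GL (Fin n) ℂ) V) : Prop :=
  ∀ (v : V) (φ : Module.Dual ℂ V), IsRegular fun g => φ (ρ g v)

/-- `v` is a highest weight vector of weight `lam`: it is nonzero and every upper triangular
matrix `b` acts on it through the scalar `∏ bᵢᵢ ^ lamᵢ` (that is, it is fixed by the unipotent
upper triangular matrices and has weight `lam` for the diagonal torus). -/
def IsHighestWeightVector {n : ℕ} {V : Type*} [AddCommGroup V] [Module ℂ V]
    (ρ : Representation ℂ (GL (Fin n) ℂ) V) (lam : Fin n → ℤ) (v : V) : Prop :=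
  v ≠ 0 ∧ ∀ b : GL (Fin n) ℂ, (∀ i j, j < i → b.val i j = 0) →
    ρ b v = (∏ i, b.val i i ^ lam i) • v

/-- A model of the irreducible (algebraic, finite-dimensional) representation of `GL_n(ℂ)` with
highest weight `lam`. -/
structure HighestWeightIrrep {n : ℕ} (lam : Fin n → ℤ) where
  carrier : Type
  [addCommGroup : AddCommGroup carrier]
  [module : Module ℂ carrier]
  rep : Representation ℂ (GL (Fin n) ℂ) carrier
  finiteDimensional : FiniteDimensional ℂ carrier
  isAlgebraic : IsAlgebraic rep
  isIrreducible : rep.IsIrreducible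
  exists_highestWeightVector : ∃ v, IsHighestWeightVector rep lam v

attribute [instance] HighestWeightIrrep.addCommGroup HighestWeightIrrep.module
  HighestWeightIrrep.finiteDimensional

section Existence

/-! Existence of the irreducible representation with a given dominant highest weight: the functions
on the group spanned by the right translates of a product of principal minors form a
finite-dimensional representation generated by a highest weight vector, and its quotient by a
maximal proper subrepresentation is irreducible. -/

variable {n : ℕ}

theorem IsRegular.const (c : ℂ) : IsRegular (n := n) fun _ => c :=
  ⟨MvPolynomial.C c, 0, fun g => by simp⟩

theorem IsRegular.add {f h : GL (Fin n) ℂ → ℂ} (hf : IsRegular f) (hh : IsRegular h) :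
    IsRegular fun g => f g + h g := by
  obtain ⟨p, m, hp⟩ := hf
  obtain ⟨q, k, hq⟩ := hh
  let D : MvPolynomial (Fin n × Fin n) ℂ := Matrix.det (Matrix.of fun i j => MvPolynomial.X (i, j))
  have hD : ∀ g : GL (Fin n) ℂ,
      MvPolynomial.eval (fun ij => g.val ij.1 ij.2) D = g.val.det := by
    intro g
    rw [RingHom.map_det]
    congr 1
    ext i j
    simp
  refine ⟨p * D ^ k + q * D ^ m, m + k, fun g => ?_⟩
  have hg : g.val.det ≠ 0 := (Matrix.isUnits_det_units g).ne_zero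
  simp only [map_add, map_mul, map_pow, hD, hp, hq, inv_pow]
  rw [pow_add]
  field_simp

theorem IsRegular.mul {f h : GL (Fin n) ℂ → ℂ} (hf : IsRegular f) (hh : IsRegular h) :
    IsRegular fun g => f g * h g := by
  obtain ⟨p, m, hp⟩ := hf
  obtain ⟨q, k, hq⟩ := hh
  refine ⟨p * q, m + k, fun g => ?_⟩
  simp only [map_mul, hp, hq]
  ring

theorem IsRegular.sum {ι : Type*} (s : Finset ι) {f : ι → GL (Fin n) ℂ → ℂ}
    (hf : ∀ i ∈ s, IsRegular (f i)) : IsRegular fun g => ∑ i ∈ s, f i g := by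
  classical
  induction s using Finset.induction_on with
  | empty => simpa using IsRegular.const (n := n) 0
  | insert a s ha ih =>
    simp only [Finset.sum_insert ha]
    exact (hf a (by simp)).add (ih fun i hi => hf i (by simp [hi]))

theorem IsRegular.prod {ι : Type*} (s : Finset ι) {f : ι → GL (Fin n) ℂ → ℂ}
    (hf : ∀ i ∈ s, IsRegular (f i)) : IsRegular fun g => ∏ i ∈ s, f i g := by
  classical
  induction s using Finset.induction_on with
  | empty => simpa using IsRegular.const (n := n) 1
  | insert a s ha ih =>
    simp only [Finset.prod_insert ha]
    exact (hf a (by simp)).mul (ih fun i hi => hf i (by simp [hi]))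

theorem IsRegular.entry (i j : Fin n) : IsRegular fun g : GL (Fin n) ℂ => g.val i j :=
  ⟨MvPolynomial.X (i, j), 0, fun g => by simp⟩

theorem IsRegular.invDet (m : ℕ) : IsRegular fun g : GL (Fin n) ℂ => (g.val.det)⁻¹ ^ m :=
  ⟨1, m, fun g => by simp⟩

theorem IsRegular.minor (S : Fin n → Prop) [DecidablePred S] :
    IsRegular fun g : GL (Fin n) ℂ => (g.val.toSquareBlockProp S).det := by
  simp only [Matrix.det_apply', Matrix.toSquareBlockProp_def, Matrix.of_apply]
  exact IsRegular.sum _ fun σ _ => (IsRegular.const _).mul (IsRegular.prod _ fun i _ =>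
    IsRegular.entry _ _)

/-- The product expansion of a regular function. -/
theorem IsRegular.exists_expansion {f : GL (Fin n) ℂ → ℂ} (hf : IsRegular f) :
    ∃ (s : Finset ((Fin n × Fin n) →₀ ℕ)) (a b : ((Fin n × Fin n) →₀ ℕ) → GL (Fin n) ℂ → ℂ),
      (∀ i, IsRegular (a i)) ∧ ∀ x g, f (x * g) = ∑ i ∈ s, a i g * b i x := by
  obtain ⟨p, m, hp⟩ := hf
  let P : MvPolynomial (Fin n × Fin n) (MvPolynomial (Fin n × Fin n) ℂ) :=
    MvPolynomial.eval₂ (MvPolynomial.C.comp MvPolynomial.C)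
      (fun ij => ∑ k, MvPolynomial.X (ij.1, k) * MvPolynomial.C (MvPolynomial.X (k, ij.2))) p
  have key : ∀ x g : GL (Fin n) ℂ,
      MvPolynomial.eval₂ (MvPolynomial.eval fun ij => g.val ij.1 ij.2)
        (fun ij => x.val ij.1 ij.2) P
      = MvPolynomial.eval (fun ij => (x * g).val ij.1 ij.2) p := by
    intro x g
    have : (MvPolynomial.eval₂Hom (MvPolynomial.eval fun ij : Fin n × Fin n => g.val ij.1 ij.2)
        (fun ij : Fin n × Fin n => x.val ij.1 ij.2)) P
        = MvPolynomial.eval (fun ij => (x * g).val ij.1 ij.2) p := by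
      simp only [P]
      rw [MvPolynomial.hom_eval₂, MvPolynomial.eval, MvPolynomial.coe_eval₂Hom]
      congr 1
      · ext c
        simp
      · ext ij
        simp [Matrix.mul_apply]
    exact this
  refine ⟨P.support,
    fun d g => MvPolynomial.eval (fun ij => g.val ij.1 ij.2) (P.coeff d) * (g.val.det)⁻¹ ^ m,
    fun d x => (∏ i, x.val i.1 i.2 ^ d i) * (x.val.det)⁻¹ ^ m,
    fun d => ⟨_, m, fun g => rfl⟩, fun x g => ?_⟩
  rw [hp, ← key, MvPolynomial.eval₂_eq', Finset.sum_mul]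
  refine Finset.sum_congr rfl fun d _ => ?_
  rw [Units.val_mul, Matrix.det_mul, mul_inv, mul_pow]
  ring

/-- The right regular representation on functions. -/
def rightRegular (n : ℕ) : Representation ℂ (GL (Fin n) ℂ) (GL (Fin n) ℂ → ℂ) where
  toFun g :=
    { toFun := fun f x => f (x * g)
      map_add' := fun _ _ => rfl
      map_smul' := fun _ _ => rfl }
  map_one' := by ext f x; simp
  map_mul' g h := by ext f x; simp [mul_assoc]

theorem rightRegular_apply (g : GL (Fin n) ℂ) (f : GL (Fin n) ℂ → ℂ) (x : GL (Fin n) ℂ) :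
    rightRegular n g f x = f (x * g) := rfl

/-- The subrepresentation generated by a function. -/
def cyclic (f : GL (Fin n) ℂ → ℂ) : Subrepresentation (rightRegular n) where
  toSubmodule := Submodule.span ℂ (Set.range fun g => rightRegular n g f)
  apply_mem_toSubmodule g v hv := by
    induction hv using Submodule.span_induction with
    | mem x hx =>
      obtain ⟨h, rfl⟩ := hx
      refine Submodule.subset_span ⟨g * h, ?_⟩
      simp
    | zero => simp
    | add x y _ _ hx hy => rw [map_add]; exact add_mem hx hy
    | smul a x _ hx => rw [map_smul]; exact Submodule.smul_mem _ _ hx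

theorem cyclic_finite {f : GL (Fin n) ℂ → ℂ} (hf : IsRegular f) :
    FiniteDimensional ℂ (cyclic f).toSubmodule := by
  classical
  obtain ⟨s, a, b, -, h⟩ := hf.exists_expansion
  have hle : (cyclic f).toSubmodule ≤ Submodule.span ℂ ((s.image b : Finset _) : Set _) := by
    refine Submodule.span_le.2 ?_
    rintro _ ⟨g, rfl⟩
    have : rightRegular n g f = ∑ i ∈ s, a i g • b i := by
      ext x
      simp [rightRegular_apply, h]
    change rightRegular n g f ∈ _
    rw [this]
    exact Submodule.sum_mem _ fun i hi => Submodule.smul_mem _ _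
      (Submodule.subset_span (by simpa using ⟨i, hi, rfl⟩))
  have : FiniteDimensional ℂ (Submodule.span ℂ ((s.image b : Finset _) : Set (GL (Fin n) ℂ → ℂ))) :=
    FiniteDimensional.span_finset ℂ _
  exact Submodule.finiteDimensional_of_le hle

theorem IsRegular.leftTranslate {f : GL (Fin n) ℂ → ℂ} (hf : IsRegular f) (x : GL (Fin n) ℂ) :
    IsRegular fun g => f (x * g) := by
  obtain ⟨s, a, b, ha, h⟩ := hf.exists_expansion
  simp only [h]
  exact IsRegular.sum _ fun i _ => (ha i).mul (IsRegular.const _)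

theorem IsRegular.rightTranslate {f : GL (Fin n) ℂ → ℂ} (hf : IsRegular f) (x : GL (Fin n) ℂ) :
    IsRegular fun g => f (g * x) := by
  obtain ⟨p, m, hp⟩ := hf
  refine ⟨MvPolynomial.bind₁ (fun ij => ∑ k, MvPolynomial.X (ij.1, k) *
    MvPolynomial.C (x.val k ij.2)) p * MvPolynomial.C ((x.val.det)⁻¹ ^ m), m, fun g => ?_⟩
  beta_reduce
  rw [hp, map_mul, MvPolynomial.eval_C, Units.val_mul, Matrix.det_mul, mul_inv, mul_pow]
  have : MvPolynomial.eval (fun ij : Fin n × Fin n => (g.val * x.val) ij.1 ij.2) p =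
      MvPolynomial.eval (fun ij : Fin n × Fin n => g.val ij.1 ij.2)
        (MvPolynomial.bind₁ (fun ij : Fin n × Fin n => ∑ k, MvPolynomial.X (ij.1, k) *
          MvPolynomial.C (x.val k ij.2)) p) := by
    rw [← MvPolynomial.coe_aeval_eq_eval, ← MvPolynomial.coe_aeval_eq_eval, RingHom.coe_coe,
      RingHom.coe_coe, MvPolynomial.aeval_bind₁]
    congr 1
    congr 1
    ext ij
    simp [Matrix.mul_apply]
  rw [this]
  ring

theorem cyclic_isAlgebraic {f : GL (Fin n) ℂ → ℂ} (hf : IsRegular f) :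
    IsAlgebraic (cyclic f).toRepresentation := by
  have := cyclic_finite hf
  let ev : GL (Fin n) ℂ → Module.Dual ℂ (cyclic f).toSubmodule := fun x =>
    (LinearMap.proj x).comp (cyclic f).toSubmodule.subtype
  have hev : Submodule.span ℂ (Set.range ev) = ⊤ := by
    refine Submodule.span_eq_top_of_ne_zero ?_
    intro z hz
    by_contra! hcon
    apply hz
    ext x
    exact hcon (ev x) ⟨x, rfl⟩
  have hreg : ∀ v ∈ (cyclic f).toSubmodule, IsRegular v := by
    intro v hv
    induction hv using Submodule.span_induction with
    | mem x hx =>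
      obtain ⟨h, rfl⟩ := hx
      exact hf.rightTranslate h
    | zero => exact IsRegular.const 0
    | add x y _ _ hx hy => exact hx.add hy
    | smul a x _ hx => exact (IsRegular.const a).mul hx
  intro v φ
  have hφ : φ ∈ Submodule.span ℂ (Set.range ev) := hev ▸ Submodule.mem_top
  induction hφ using Submodule.span_induction with
  | mem φ hφ =>
    obtain ⟨x, rfl⟩ := hφ
    exact (hreg v.1 v.2).leftTranslate x
  | zero => exact IsRegular.const 0
  | add x y _ _ hx hy => exact hx.add hy
  | smul a x _ hx => exact (IsRegular.const a).mul hx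

theorem minor_mul_upper {S : Fin n → Prop} [DecidablePred S] (hS : ∀ i j, j ≤ i → S i → S j)
    (x b : Matrix (Fin n) (Fin n) ℂ) (hb : ∀ i j, j < i → b i j = 0) :
    ((x * b).toSquareBlockProp S).det
      = (∏ i, if S i then b i i else 1) * (x.toSquareBlockProp S).det := by
  have h1 : (x * b).toSquareBlockProp S = x.toSquareBlockProp S * b.toSquareBlockProp S := by
    have h0 : b.toBlock (fun i => ¬ S i) S = 0 := by
      ext i j
      refine hb _ _ ?_
      by_contra! hij
      exact i.2 (hS _ _ hij j.2)
    have := Matrix.toBlock_mul_eq_add (p := S) S S x b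
    rw [h0, Matrix.mul_zero, add_zero] at this
    exact this
  rw [h1, Matrix.det_mul, mul_comm]
  congr 1
  rw [Matrix.det_of_isUpperTriangular]
  · rw [Finset.prod_ite, Finset.prod_const_one, mul_one, Finset.prod_subtype _ (p := S) (by simp)]
    rfl
  · intro i j hij
    exact hb _ _ hij

/-- The function on `GL_n` whose translates span a representation of highest weight `lam`. -/
noncomputable def highestWeightFun (lam : Fin n → ℤ) (M : ℕ) (x : GL (Fin n) ℂ) : ℂ :=
  (x.val.det)⁻¹ ^ M * ∏ t ∈ Finset.range (2 * M),
    (x.val.toSquareBlockProp fun j => (t : ℤ) < lam j + M).det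

theorem highestWeightFun_isRegular (lam : Fin n → ℤ) (M : ℕ) :
    IsRegular (highestWeightFun lam M) :=
  (IsRegular.invDet M).mul (IsRegular.prod _ fun _ _ => IsRegular.minor _)

theorem highestWeightFun_one (lam : Fin n → ℤ) (M : ℕ) : highestWeightFun lam M 1 = 1 := by
  have : ∀ t : ℕ, ((1 : Matrix (Fin n) (Fin n) ℂ).toSquareBlockProp
      fun j => (t : ℤ) < lam j + M) = 1 := by
    intro t
    ext i j
    simp [Matrix.toSquareBlockProp_def, Matrix.one_apply, Subtype.ext_iff]
  simp [highestWeightFun, this]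

theorem highestWeightFun_mul_upper {lam : Fin n → ℤ} (hlam : Antitone lam) {M : ℕ}
    (hM : ∀ i, -(M : ℤ) ≤ lam i ∧ lam i ≤ M) (x b : GL (Fin n) ℂ)
    (hb : ∀ i j, j < i → b.val i j = 0) :
    highestWeightFun lam M (x * b) = (∏ i, b.val i i ^ lam i) * highestWeightFun lam M x := by
  have hdet : b.val.det = ∏ i, b.val i i :=
    Matrix.det_of_isUpperTriangular fun i j hij => hb _ _ hij
  have hne : ∀ i, b.val i i ≠ 0 := fun i => by
    have : b.val.det ≠ 0 := (Matrix.isUnits_det_units b).ne_zero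
    rw [hdet] at this
    exact Finset.prod_ne_zero_iff.1 this i (Finset.mem_univ i)
  have hcount : ∏ t ∈ Finset.range (2 * M), ∏ i, (if (t : ℤ) < lam i + M then b.val i i else 1)
      = ∏ i, b.val i i ^ (lam i + M) := by
    rw [Finset.prod_comm]
    refine Finset.prod_congr rfl fun i _ => ?_
    rw [Finset.prod_ite, Finset.prod_const_one, mul_one, Finset.prod_const]
    have : (Finset.range (2 * M)).filter (fun t : ℕ => (t : ℤ) < lam i + M)
        = Finset.range (lam i + M).toNat := by
      ext t
      have := hM i
      simp only [Finset.mem_filter, Finset.mem_range]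
      omega
    rw [this, Finset.card_range, ← zpow_natCast, Int.toNat_of_nonneg (by have := hM i; omega)]
  have hstep : ∀ t ∈ Finset.range (2 * M),
      ((x.val * b.val).toSquareBlockProp fun j => (t : ℤ) < lam j + M).det
      = (∏ i, if (t : ℤ) < lam i + M then b.val i i else 1) *
        (x.val.toSquareBlockProp fun j => (t : ℤ) < lam j + M).det := fun t _ =>
    minor_mul_upper (fun i j hij hi => by have := hlam hij; omega) _ _ hb
  simp only [highestWeightFun, Units.val_mul]
  rw [Finset.prod_congr rfl hstep, Finset.prod_mul_distrib, hcount, Matrix.det_mul, hdet, mul_inv,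
    mul_pow, ← Finset.prod_inv_distrib, ← Finset.prod_pow]
  have : ∏ i, b.val i i ^ lam i = (∏ i, (b.val i i)⁻¹ ^ M) * ∏ i, b.val i i ^ (lam i + M) := by
    rw [← Finset.prod_mul_distrib]
    refine Finset.prod_congr rfl fun i _ => ?_
    rw [zpow_add₀ (hne i), zpow_natCast, mul_comm, mul_assoc, ← mul_pow, mul_inv_cancel₀ (hne i),
      one_pow, mul_one]
  rw [this]
  ring

theorem nonempty_highestWeightIrrep {lam : Fin n → ℤ} (hlam : Antitone lam) :
    Nonempty (HighestWeightIrrep lam) := by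
  let M : ℕ := ∑ i, (lam i).natAbs
  have hM : ∀ i, -(M : ℤ) ≤ lam i ∧ lam i ≤ M := fun i => by
    have : (lam i).natAbs ≤ M :=
      Finset.single_le_sum (f := fun i => (lam i).natAbs) (fun _ _ => Nat.zero_le _)
        (Finset.mem_univ i)
    omega
  let f := highestWeightFun lam M
  have hreg : IsRegular f := highestWeightFun_isRegular lam M
  have hfd := cyclic_finite hreg
  let σ := (cyclic f).toRepresentation
  have hmem : f ∈ (cyclic f).toSubmodule := Submodule.subset_span ⟨1, by simp⟩
  let v : (cyclic f).toSubmodule := ⟨f, hmem⟩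
  have hv0 : v ≠ 0 := by
    intro h
    have h1 : f 1 = 0 := congrFun (congrArg Subtype.val h) 1
    rw [show f 1 = 1 from highestWeightFun_one lam M] at h1
    exact one_ne_zero h1
  have hgen : ∀ S : Subrepresentation σ, v ∈ S.toSubmodule → S = ⊤ := by
    intro S hS
    apply Subrepresentation.toSubmodule_injective
    refine eq_top_iff.2 ?_
    rintro ⟨w, hw⟩ -
    have : (cyclic f).toSubmodule ≤ S.toSubmodule.map (cyclic f).toSubmodule.subtype := by
      refine Submodule.span_le.2 ?_
      rintro _ ⟨g, rfl⟩
      exact ⟨σ g v, S.apply_mem_toSubmodule g hS, rfl⟩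
    obtain ⟨w', hw', h⟩ := this hw
    have : w' = ⟨w, hw⟩ := Subtype.ext h
    exact this ▸ hw'
  have hwf : WellFoundedGT (Subrepresentation σ) :=
    StrictMono.wellFoundedGT (f := fun S : Subrepresentation σ => S.toSubmodule)
      (fun S T h => h)
  have hbt : (⊥ : Subrepresentation σ) ≠ ⊤ := by
    intro h
    have : v ∈ (⊥ : Subrepresentation σ).toSubmodule := h ▸ Submodule.mem_top
    exact hv0 ((Submodule.mem_bot ℂ).1 this)
  have : IsCoatomic (Subrepresentation σ) :=
    isCoatomic_of_orderTop_gt_wellFounded hwf.wf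
  obtain ⟨C, hC, -⟩ := (eq_top_or_exists_le_coatom (⊥ : Subrepresentation σ)).resolve_left hbt
  have hinv : ∀ g, C.toSubmodule ≤ C.toSubmodule.comap (σ g) :=
    fun g w hw => C.apply_mem_toSubmodule g hw
  have hvC : v ∉ C.toSubmodule := fun h => hC.1 (hgen C h)
  let τ := σ.quotient C.toSubmodule hinv
  refine ⟨{ carrier := (cyclic f).toSubmodule ⧸ C.toSubmodule
            rep := τ
            finiteDimensional := inferInstance
            isAlgebraic := ?_
            isIrreducible := ?_
            exists_highestWeightVector := ?_ }⟩
  · intro w φ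
    obtain ⟨w, rfl⟩ := C.toSubmodule.mkQ_surjective w
    exact cyclic_isAlgebraic hreg w (φ.comp C.toSubmodule.mkQ)
  · have hnt : Nontrivial (Subrepresentation τ) := by
      refine ⟨⊥, ⊤, fun h => hvC ?_⟩
      have : C.toSubmodule.mkQ v ∈ (⊥ : Subrepresentation τ).toSubmodule := h ▸ Submodule.mem_top
      exact (Submodule.Quotient.mk_eq_zero _).1 ((Submodule.mem_bot ℂ).1 this)
    refine { toNontrivial := hnt, eq_bot_or_eq_top := fun S => ?_ }
    let T : Subrepresentation σ :=
      { toSubmodule := S.toSubmodule.comap C.toSubmodule.mkQ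
        apply_mem_toSubmodule := fun g w hw => S.apply_mem_toSubmodule g hw }
    have hCT : C ≤ T := fun w hw => by
      change C.toSubmodule.mkQ w ∈ S.toSubmodule
      have : C.toSubmodule.mkQ w = 0 := (Submodule.Quotient.mk_eq_zero _).2 hw
      rw [this]
      exact zero_mem _
    rcases hC.le_iff.1 hCT with h | h
    · right
      apply Subrepresentation.toSubmodule_injective
      refine eq_top_iff.2 fun w _ => ?_
      obtain ⟨w, rfl⟩ := C.toSubmodule.mkQ_surjective w
      have : w ∈ T.toSubmodule := h ▸ Submodule.mem_top
      exact this
    · left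
      apply Subrepresentation.toSubmodule_injective
      refine eq_bot_iff.2 fun w hw => ?_
      obtain ⟨w, rfl⟩ := C.toSubmodule.mkQ_surjective w
      have hw' : w ∈ T.toSubmodule := hw
      rw [h] at hw'
      exact (Submodule.mem_bot ℂ).2 ((Submodule.Quotient.mk_eq_zero _).2 hw')
  · refine ⟨C.toSubmodule.mkQ v, fun h => hvC ((Submodule.Quotient.mk_eq_zero _).1 h),
      fun b hb => ?_⟩
    have h1 : σ b v = (∏ i, b.val i i ^ lam i) • v := by
      apply Subtype.ext
      funext x
      exact highestWeightFun_mul_upper hlam hM x b hb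
    change C.toSubmodule.mkQ (σ b v) = _
    rw [h1, map_smul]

end Existence

/-- The irreducible representation of `GL_n(ℂ)` with highest weight `lam`. -/
noncomputable def irrep {n : ℕ} (lam : DominantWeight n) : HighestWeightIrrep lam.1 :=
  Classical.choice (nonempty_highestWeightIrrep lam.2)

/-- The multiplicity of an irreducible representation `τ` in a representation `σ` of a group `G`:
the dimension of the space of `G`-equivariant linear maps from `τ` to `σ`. -/
noncomputable def multiplicity {G V W : Type*} [Group G] [AddCommGroup V] [Module ℂ V]
    [AddCommGroup W] [Module ℂ W] (τ : Representation ℂ G V) (σ : Representation ℂ G W) : ℕ :=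
  Module.finrank ℂ (τ.IntertwiningMap σ)

/-- The multiplicity of `ρ_ν` in `ρ_λ^∨ ⊗ ρ_μ`, for weights of `GL_r(ℂ)`. -/
noncomputable def tensorMultiplicity {r : ℕ} (lam mu nu : DominantWeight r) : ℕ :=
  multiplicity (irrep nu).rep ((irrep lam).rep.dual.tprod (irrep mu).rep)

open Classical in
/-- The number `N_{λμ}^ν`: the multiplicity of `ρ_ν` in `ρ_λ^∨ ⊗ ρ_μ` if all parts of `ν` are
nonnegative (for a dominant weight: if its last part is), and `0` otherwise. -/
noncomputable def truncatedMultiplicity {r : ℕ} (lam mu nu : DominantWeight r) : ℕ :=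
  if ∀ i, 0 ≤ nu.1 i then tensorMultiplicity lam mu nu else 0

/-- The weight `(ν₁,…,ν_r,0,…,0)` of `GL_n(ℂ)`. -/
def extendByZero {r : ℕ} (n : ℕ) (nu : Fin r → ℤ) (i : Fin n) : ℤ :=
  if h : i.1 < r then nu ⟨i.1, h⟩ else 0

open Classical in
/-- The dimension of the irreducible representation `R_ν` of `GL_n(ℂ)` with highest weight
`(ν₁,…,ν_r,0,…,0)`; it is `0` if this weight is not dominant, as there is no such
representation then. -/
noncomputable def dimR {r : ℕ} (n : ℕ) (nu : Fin r → ℤ) : ℕ :=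
  if h : Antitone (extendByZero n nu) then
    Module.finrank ℂ (irrep (⟨extendByZero n nu, h⟩ : DominantWeight n)).carrier
  else 0

/-- The set `Λ` of dominant weights `n - r ≥ λ₁ ≥ ⋯ ≥ λ_r ≥ 0`. -/
def boxWeights (r n : ℕ) : Set (DominantWeight r) :=
  {lam | ∀ i, 0 ≤ lam.1 i ∧ lam.1 i ≤ (n : ℤ) - r}

/-- The sequence `(λ_{r-i+1} + i)_{i=1}^r`, indexed from `0`. -/
def strictSeq {r : ℕ} (lam : Fin r → ℤ) (i : Fin r) : ℤ :=
  lam i.rev + (i.1 + 1 : ℕ)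

/-- The binomial coefficient of integers, which is `0` if the lower entry is negative. -/
def intBinom (a b : ℤ) : ℤ :=
  if 0 ≤ b then Ring.choose a b.toNat else 0

end GLRep

namespace GLRep

open Topology
open scoped ComplexOrder

/-! ### Density -/

/-! Put δ = (r-1, …, 1, 0) and, for a permutation w, α_w = (μ+δ)∘w - (λ+δ). After reversing rows and
columns, the determinant is the signed sum over w of the products of binomials binom(n + α_w(i) - 1,
α_w(i)) (`det_intBinom`). Each product counts the monomials in the entries of an r × n matrix with
row degrees α_w, so it is the dimension of a weight space for GL_r in the polynomial functions on
such matrices. By the duality between GL_r and GL_n these functions are the sum of the ρ_κ ⊗ R_κ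
over dominant κ with nonnegative entries, so the product is Σ_κ dim ρ_κ[α_w] · dim R_κ
(`prod_intBinom_eq_sum`). After summation over w, the coefficient of dim R_ν is Σ_w sgn(w) dim
ρ_ν[α_w], which is the multiplicity of ρ_ν in ρ_λ^∨ ⊗ ρ_μ (`tensorMultiplicity_eq_sum_weightDim`).
The truncation to ν_r ≥ 0 reflects that only polynomial representations occur in functions on
matrices.

The multiplicity formula comes from the Weyl character formula (`altSum_weightDim`), which in turn
comes from the duality for r × r matrices. There the duality says that Σ_κ dim ρ_κ[α] dim ρ_κ[β] is
the number of tables with row sums α and column sums β. Antisymmetrising in both arguments and using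
Cauchy's determinant gives Σ_κ a_κ(μ+δ)² = 1, where a_κ is the integral coefficient function of the
character of ρ_κ times the Vandermonde determinant. Since a_μ(μ+δ) = 1, all other terms vanish.

The representation theory rests on two density facts: a regular function vanishes if it vanishes on
the unitary group, or on the big cell of products of lower and upper triangular matrices. With Haar
measure, the first gives inner products for which g and its conjugate transpose are adjoint, hence
complete reducibility (`IsAlgebraic.exists_decomposition`). The second determines matrix
coefficients of highest weight vectors up to a scalar. This gives uniqueness of highest weight
vectors and, applied to rectangular matrices, the multiplicity-free duality (`finrank_hwSpace_inf`,
`finrank_rowSpace_inf`). -/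

theorem mvPolynomial_eq_zero_of_eventually {σ : Type*} [Fintype σ] {p : MvPolynomial σ ℂ}
    {a : σ → ℂ} (h : ∀ᶠ x in 𝓝 a, MvPolynomial.eval x p = 0) : p = 0 := by
  obtain ⟨ε, hε, h⟩ := Metric.eventually_nhds_iff_ball.1 h
  refine MvPolynomial.funext_set (fun i => Metric.ball (a i) ε)
    (fun i => infinite_of_mem_nhds (a i) (Metric.ball_mem_nhds _ hε)) fun x hx => ?_
  rw [map_zero]
  refine h x ?_
  rw [ball_pi _ hε]
  exact hx

/-- Upper triangular matrices. -/
def IsUpper {n : ℕ} (b : Matrix (Fin n) (Fin n) ℂ) : Prop := ∀ i j, j < i → b i j = 0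

/-- The `r × n` matrix `(1 | 0)`. -/
def partialOne (r n : ℕ) : Matrix (Fin r) (Fin n) ℂ := Matrix.of fun i j => if i.1 = j.1 then 1 else 0

theorem partialOne_self (n : ℕ) : partialOne n n = 1 := by
  ext i j
  simp [partialOne, Matrix.one_apply, Fin.ext_iff]

/-- Gaussian elimination without pivoting: near (1 | 0) the corner entry stays invertible, and the
Schur complement is again near the smaller (1 | 0), so induction on the number of rows applies. -/
theorem eventually_bigCell {r n : ℕ} (hrn : r ≤ n) : ∀ᶠ x in 𝓝 (partialOne r n),
    ∃ (b : Matrix (Fin r) (Fin r) ℂ) (c : Matrix (Fin n) (Fin n) ℂ),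
      IsUpper b ∧ (∀ i, b i i ≠ 0) ∧ IsUpper c ∧ (∀ i, c i i ≠ 0) ∧
      x = b.transpose * partialOne r n * c := by
  induction r generalizing n with
  | zero =>
    refine Filter.Eventually.of_forall fun x => ⟨1, 1, fun i => i.elim0, fun i => i.elim0,
      fun i j hij => Matrix.one_apply_ne hij.ne', fun i => by simp, ?_⟩
    ext i
    exact i.elim0
  | succ r ih =>
    obtain ⟨n, rfl⟩ : ∃ m, n = m + 1 := ⟨n - 1, by omega⟩
    -- The Schur complement of the corner entry.
    let Y : Matrix (Fin (r + 1)) (Fin (n + 1)) ℂ → Matrix (Fin r) (Fin n) ℂ := fun x =>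
      Matrix.of fun i j => x i.succ j.succ - x i.succ 0 * x 0 j.succ / x 0 0
    have h00 : partialOne (r + 1) (n + 1) 0 0 = 1 := by simp [partialOne]
    have hs0 : ∀ i : Fin r, partialOne (r + 1) (n + 1) i.succ 0 = 0 := by simp [partialOne]
    have h0s : ∀ i : Fin n, partialOne (r + 1) (n + 1) 0 i.succ = 0 := by simp [partialOne]
    have hss : ∀ (i : Fin r) (j : Fin n),
        partialOne (r + 1) (n + 1) i.succ j.succ = partialOne r n i j := by simp [partialOne]
    have hcoord : ∀ i j, Continuous fun x : Matrix (Fin (r + 1)) (Fin (n + 1)) ℂ => x i j :=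
      fun i j => by fun_prop
    have hY : Filter.Tendsto Y (𝓝 (partialOne (r + 1) (n + 1))) (𝓝 (partialOne r n)) := by
      have : Y (partialOne (r + 1) (n + 1)) = partialOne r n := by
        ext i j
        simp [Y, hss, hs0]
      rw [← this]
      refine tendsto_pi_nhds.2 fun i => tendsto_pi_nhds.2 fun j => ?_
      refine ContinuousAt.sub (hcoord _ _).continuousAt (ContinuousAt.div ?_ ?_ ?_)
      · exact ((hcoord _ _).mul (hcoord _ _)).continuousAt
      · exact (hcoord _ _).continuousAt
      · simp [h00]
    have hne : ∀ᶠ x in 𝓝 (partialOne (r + 1) (n + 1)), x 0 0 ≠ 0 :=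
      (hcoord 0 0).continuousAt.eventually_ne (by simp [h00])
    filter_upwards [hne, hY.eventually (ih (n := n) (by omega))] with x hx ⟨b, c, hb, hb0, hc, hc0, hbc⟩
    -- The lower factor carries the multipliers of the elimination in its first column, the upper
    -- factor the first row of `x`; the remaining blocks come from the factorisation of the Schur
    -- complement.
    refine ⟨Matrix.of (Fin.cons (Fin.cons 1 fun j => x j.succ 0 / x 0 0)
        fun i => Fin.cons 0 fun j => b i j),
      Matrix.of (Fin.cons (Fin.cons (x 0 0) fun j => x 0 j.succ)
        fun i => Fin.cons 0 fun j => c i j), ?_, ?_, ?_, ?_, ?_⟩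
    · intro i j
      refine Fin.cases ?_ (fun i => ?_) i <;> refine Fin.cases ?_ (fun j => ?_) j <;> simp
      exact hb i j
    · intro i
      refine Fin.cases ?_ (fun i => ?_) i <;> simp [hb0]
    · intro i j
      refine Fin.cases ?_ (fun i => ?_) i <;> refine Fin.cases ?_ (fun j => ?_) j <;> simp
      exact hc i j
    · intro i
      refine Fin.cases ?_ (fun i => ?_) i <;> simp [hc0, hx]
    · ext i j
      have key : ∀ (i : Fin r) (j : Fin n), x i.succ j.succ - x i.succ 0 * x 0 j.succ / x 0 0
          = (b.transpose * partialOne r n * c) i j := fun i j => congrFun (congrFun hbc i) j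
      simp only [Matrix.mul_apply, Matrix.transpose_apply] at key ⊢
      refine Fin.cases ?_ (fun i => ?_) i <;> refine Fin.cases ?_ (fun j => ?_) j <;>
        simp [Fin.sum_univ_succ, h00, hs0, h0s, hss, ← key] <;> field_simp
      ring

theorem IsUpper.det {n : ℕ} {b : Matrix (Fin n) (Fin n) ℂ} (hb : IsUpper b) :
    b.det = ∏ i, b i i :=
  Matrix.det_of_isUpperTriangular fun i j hij => hb i j hij

theorem IsUpper.isUnit {n : ℕ} {b : Matrix (Fin n) (Fin n) ℂ} (hb : IsUpper b)
    (h0 : ∀ i, b i i ≠ 0) : IsUnit b := by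
  rw [Matrix.isUnit_iff_isUnit_det, hb.det]
  exact (Finset.prod_ne_zero_iff.2 fun i _ => h0 i).isUnit

theorem IsUpper.diag_ne_zero {n : ℕ} {b : GL (Fin n) ℂ} (hb : IsUpper b.val) (i : Fin n) :
    b.val i i ≠ 0 := by
  have : b.val.det ≠ 0 := (Matrix.isUnits_det_units b).ne_zero
  rw [hb.det] at this
  exact Finset.prod_ne_zero_iff.1 this i (Finset.mem_univ i)

/-- The transpose of an invertible matrix. -/
def transposeGL {n : ℕ} (g : GL (Fin n) ℂ) : GL (Fin n) ℂ :=
  ⟨g.val.transpose, g.inv.transpose, by rw [← Matrix.transpose_mul, g.inv_val, Matrix.transpose_one],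
    by rw [← Matrix.transpose_mul, g.val_inv, Matrix.transpose_one]⟩

/-- The matrices covered by the hypothesis contain a neighbourhood of (1 | 0), and a polynomial
vanishing on an open set is zero. -/
theorem eq_zero_of_bigCell {r n : ℕ} (hrn : r ≤ n) {p : MvPolynomial (Fin r × Fin n) ℂ}
    (h : ∀ (b : GL (Fin r) ℂ) (c : GL (Fin n) ℂ), IsUpper b.val → IsUpper c.val →
      MvPolynomial.eval (fun ij => (b.val.transpose * partialOne r n * c.val) ij.1 ij.2) p = 0) :
    p = 0 := by
  refine mvPolynomial_eq_zero_of_eventually (a := fun ij => partialOne r n ij.1 ij.2) ?_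
  have hc : Filter.Tendsto (fun x : Fin r × Fin n → ℂ => (Matrix.of fun i j => x (i, j)))
      (𝓝 (fun ij => partialOne r n ij.1 ij.2)) (𝓝 (partialOne r n)) := by
    have : Continuous fun x : Fin r × Fin n → ℂ => (Matrix.of fun i j => x (i, j)) := by fun_prop
    exact this.tendsto _
  filter_upwards [hc.eventually (eventually_bigCell hrn)] with x ⟨b, c, hb, hb0, hc, hc0, hx⟩
  have := h (hb.isUnit hb0).unit (hc.isUnit hc0).unit hb hc
  simpa [← hx] using this

/-- The square case: the base point is the identity, and the denominator of a regular function never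
vanishes, so only the numerator matters. -/
theorem IsRegular.eq_zero_of_bigCell {n : ℕ} {f : GL (Fin n) ℂ → ℂ} (hf : IsRegular f)
    (h : ∀ b c : GL (Fin n) ℂ, IsUpper b.val → IsUpper c.val → f (transposeGL b * c) = 0)
    (g : GL (Fin n) ℂ) : f g = 0 := by
  obtain ⟨p, m, hp⟩ := hf
  have : p = 0 := by
    refine GLRep.eq_zero_of_bigCell le_rfl fun b c hb hc => ?_
    have h1 := h b c hb hc
    rw [hp] at h1
    have h2 : ((transposeGL b * c).val.det)⁻¹ ^ m ≠ 0 :=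
      pow_ne_zero _ (inv_ne_zero (Matrix.isUnits_det_units _).ne_zero)
    have h3 := (mul_eq_zero.1 h1).resolve_right h2
    rw [partialOne_self, Matrix.mul_one]
    exact h3
  simp [hp, this]

/-- A regular function vanishing on the unitary group vanishes. -/
theorem IsRegular.eq_zero_of_unitary {n : ℕ} {f : GL (Fin n) ℂ → ℂ} (hf : IsRegular f)
    (h : ∀ u : GL (Fin n) ℂ, u.val ∈ Matrix.unitaryGroup (Fin n) ℂ → f u = 0)
    (g : GL (Fin n) ℂ) : f g = 0 := by
  obtain ⟨p, m, hp⟩ := hf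
  have hp' : ∀ u ∈ Matrix.unitaryGroup (Fin n) ℂ,
      MvPolynomial.eval (fun ij => u ij.1 ij.2) p = 0 := by
    intro u hu
    let u' : GL (Fin n) ℂ := Unitary.toUnits ⟨u, hu⟩
    have h1 := h u' hu
    rw [hp] at h1
    have h2 : (u'.val.det)⁻¹ ^ m ≠ 0 :=
      pow_ne_zero _ (inv_ne_zero (Matrix.isUnits_det_units _).ne_zero)
    exact (mul_eq_zero.1 h1).resolve_right h2
  -- singular value decomposition
  obtain ⟨u, hu, w, hw, d, hd⟩ : ∃ u ∈ Matrix.unitaryGroup (Fin n) ℂ,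
      ∃ w ∈ Matrix.unitaryGroup (Fin n) ℂ, ∃ d : Fin n → ℂ, g.val = u * Matrix.diagonal d * w := by
    have hA : (g.val.conjTranspose * g.val).PosDef :=
      Matrix.PosDef.conjTranspose_mul_self _ (Matrix.mulVec_injective_iff_isUnit.2 g.isUnit)
    let hH := hA.isHermitian
    let W : Matrix.unitaryGroup (Fin n) ℂ := hH.eigenvectorUnitary
    have hpos : ∀ i, 0 < hH.eigenvalues i := hA.eigenvalues_pos
    have hspec : g.val.conjTranspose * g.val = W.val *
        Matrix.diagonal (fun i => (hH.eigenvalues i : ℂ)) * star W.val := by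
      conv_lhs => rw [hH.spectral_theorem]
      rfl
    let d : Fin n → ℂ := fun i => (Real.sqrt (hH.eigenvalues i) : ℂ)
    have hd0 : ∀ i, d i ≠ 0 := fun i => by
      simpa [d] using (Real.sqrt_pos.2 (hpos i)).ne'
    have hWs : star W.val * W.val = 1 := Unitary.coe_star_mul_self W
    have hsW : W.val * star W.val = 1 := Unitary.coe_mul_star_self W
    -- The columns of `g W` are orthogonal with squared lengths the eigenvalues of `gᴴ g`; dividing
    -- them by the square roots `d` makes the matrix unitary.
    refine ⟨g.val * W.val * Matrix.diagonal fun i => (d i)⁻¹, ?_, star W.val, ?_, d, ?_⟩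
    · rw [Matrix.mem_unitaryGroup_iff', star_mul, star_mul, Matrix.star_eq_conjTranspose (Matrix.diagonal _),
        Matrix.diagonal_conjTranspose]
      have : star W.val * star g.val * (g.val * W.val) =
          Matrix.diagonal (fun i => (hH.eigenvalues i : ℂ)) := by
        calc _ = star W.val * (g.val.conjTranspose * g.val) * W.val := by
              simp only [Matrix.star_eq_conjTranspose, Matrix.mul_assoc]
          _ = (star W.val * W.val) * Matrix.diagonal (fun i => (hH.eigenvalues i : ℂ)) *
              (star W.val * W.val) :=
            (congrArg (fun A => star W.val * A * W.val) hspec).trans (by simp only [Matrix.mul_assoc])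
          _ = _ := by rw [hWs, Matrix.one_mul, Matrix.mul_one]
      rw [Matrix.mul_assoc, ← Matrix.mul_assoc (star W.val * star g.val), this,
        Matrix.diagonal_mul_diagonal, Matrix.diagonal_mul_diagonal, ← Matrix.diagonal_one]
      congr 1
      funext i
      have hsq : (hH.eigenvalues i : ℂ) = d i * d i := by
        simp only [d]
        rw [← Complex.ofReal_mul, Real.mul_self_sqrt (hpos i).le]
      have hreal : star ((d i)⁻¹) = (d i)⁻¹ := by
        simp only [d]
        rw [← Complex.ofReal_inv]
        exact Complex.conj_ofReal _
      simp only [Pi.star_apply, hreal, hsq]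
      have := hd0 i
      field_simp
    · exact (star W).2
    · rw [Matrix.mul_assoc (g.val * W.val), Matrix.diagonal_mul_diagonal]
      have : (Matrix.diagonal fun i => (d i)⁻¹ * d i) = (1 : Matrix (Fin n) (Fin n) ℂ) := by
        rw [← Matrix.diagonal_one]
        congr 1
        funext i
        exact inv_mul_cancel₀ (hd0 i)
      rw [this, Matrix.mul_one, Matrix.mul_assoc, hsW, Matrix.mul_one]
  -- With `u` and `w` fixed, the value at `u diag(t) w` is polynomial in `t`. It vanishes when all
  -- entries of `t` lie on the unit circle, which is an infinite set, hence for all `t`, in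
  -- particular at the singular values `d`.
  let q : MvPolynomial (Fin n) ℂ := MvPolynomial.bind₁ (fun ij => ∑ k,
    MvPolynomial.C (u ij.1 k) * MvPolynomial.X k * MvPolynomial.C (w k ij.2)) p
  have hq : ∀ t, MvPolynomial.eval t q =
      MvPolynomial.eval (fun ij => (u * Matrix.diagonal t * w) ij.1 ij.2) p := by
    intro t
    simp only [q]
    rw [← MvPolynomial.coe_aeval_eq_eval, ← MvPolynomial.coe_aeval_eq_eval, RingHom.coe_coe,
      RingHom.coe_coe, MvPolynomial.aeval_bind₁]
    congr 1
    congr 1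
    ext ij
    simp [Matrix.mul_apply, Matrix.diagonal_apply]
  have hq0 : q = 0 := by
    refine MvPolynomial.funext_set (fun _ => (Metric.sphere (0 : ℂ) 1)) (fun _ => ?_) fun t ht => ?_
    -- The circle is connected and contains two points, so it is infinite.
    · refine IsPreconnected.infinite_of_nontrivial ?_ ⟨1, by simp, -1, by simp, by norm_num⟩
      exact isPreconnected_sphere (by simp [Complex.rank_real_complex]) _ _
    · rw [map_zero, hq]
      refine hp' _ (mul_mem (mul_mem hu ?_) hw)
      rw [Matrix.mem_unitaryGroup_iff', Matrix.star_eq_conjTranspose, Matrix.diagonal_conjTranspose,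
        Matrix.diagonal_mul_diagonal, ← Matrix.diagonal_one]
      congr 1
      funext i
      have := ht i (Set.mem_univ i)
      rw [mem_sphere_zero_iff_norm] at this
      simp only [Pi.star_apply]
      rw [mul_comm]
      exact (Complex.mul_conj' (t i)).trans (by rw [this]; simp)
  rw [hp]
  have := hq d
  rw [hq0, map_zero, ← hd] at this
  rw [← this, zero_mul]

end GLRep

namespace GLRep

open Topology
open scoped ComplexOrder

/-! ### Invariant inner products -/

theorem isCompact_unitaryGroup (n : ℕ) :
    IsCompact (Matrix.unitaryGroup (Fin n) ℂ : Set (Matrix (Fin n) (Fin n) ℂ)) := by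
  have h : IsCompact (Set.pi Set.univ fun _ : Fin n => Set.pi Set.univ fun _ : Fin n =>
      Metric.closedBall (0 : ℂ) 1) :=
    isCompact_univ_pi fun _ => isCompact_univ_pi fun _ => isCompact_closedBall _ _
  refine h.of_isClosed_subset (isClosed_unitary (R := Matrix (Fin n) (Fin n) ℂ)) fun u hu i _ j _ => ?_
  rw [mem_closedBall_zero_iff]
  exact entry_norm_bound_of_unitary hu i j

/-- The inclusion of the unitary group. -/
def unitaryToGL (n : ℕ) : Matrix.unitaryGroup (Fin n) ℂ →* GL (Fin n) ℂ := Unitary.toUnits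

theorem unitaryToGL_val {n : ℕ} (u : Matrix.unitaryGroup (Fin n) ℂ) :
    (unitaryToGL n u).val = u.val := rfl

theorem IsRegular.continuous_unitary {n : ℕ} {f : GL (Fin n) ℂ → ℂ} (hf : IsRegular f) :
    Continuous fun u => f (unitaryToGL n u) := by
  obtain ⟨p, m, hp⟩ := hf
  simp only [hp, unitaryToGL_val]
  refine Continuous.mul ?_ (Continuous.pow (Continuous.inv₀ ?_ fun u => ?_) m)
  · refine (MvPolynomial.continuous_eval p).comp (continuous_pi fun ij => ?_)
    exact (continuous_apply_apply ij.1 ij.2).comp continuous_subtype_val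
  · exact Continuous.matrix_det continuous_subtype_val
  · exact (Matrix.isUnits_det_units (unitaryToGL n u)).ne_zero

/-- Conjugating both the argument and the value leaves a polynomial with conjugated coefficients and
transposed variables. This makes the antilinear side of an adjointness identity regular, so that
density of the unitary group can be used. -/
theorem IsRegular.conj_star {n : ℕ} {f : GL (Fin n) ℂ → ℂ} (hf : IsRegular f) :
    IsRegular fun g => starRingEnd ℂ (f (star g)) := by
  obtain ⟨p, m, hp⟩ := hf
  refine ⟨MvPolynomial.map (starRingEnd ℂ) (MvPolynomial.rename Prod.swap p), m, fun g => ?_⟩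
  beta_reduce
  rw [hp, map_mul, map_pow, map_inv₀]
  congr 1
  · rw [MvPolynomial.eval_map, MvPolynomial.eval₂_rename, MvPolynomial.eval,
      MvPolynomial.coe_eval₂Hom, MvPolynomial.hom_eval₂]
    congr 1
    · ext ij
      simp
  · congr 2
    change starRingEnd ℂ (g.val.conjTranspose).det = _
    rw [Matrix.det_conjTranspose]
    simp

theorem star_unitaryToGL {n : ℕ} (u : Matrix.unitaryGroup (Fin n) ℂ) :
    star (unitaryToGL n u) = unitaryToGL n u⁻¹ := by
  ext
  rfl

variable {n : ℕ} {V : Type*} [AddCommGroup V] [Module ℂ V] [FiniteDimensional ℂ V]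

/-- Every finite-dimensional algebraic representation of `GL_n(ℂ)` has an inner product for which
the adjoint of the action of `g` is the action of the conjugate transpose of `g`. -/
theorem IsAlgebraic.exists_inner {ρ : Representation ℂ (GL (Fin n) ℂ) V} (hρ : IsAlgebraic ρ) :
    ∃ c : InnerProductSpace.Core ℂ V, ∀ g x y, c.inner (ρ g x) y = c.inner x (ρ (star g) y) := by
  let K := Matrix.unitaryGroup (Fin n) ℂ
  have : CompactSpace K := isCompact_iff_compactSpace.1 (isCompact_unitaryGroup n)
  let _ : MeasurableSpace K := borel K
  have : BorelSpace K := ⟨rfl⟩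
  let μ : MeasureTheory.Measure K := MeasureTheory.Measure.haar
  let b := Module.finBasis ℂ V
  -- The coordinate inner product of `u⁻¹ x` and `u⁻¹ y`. With the inverse, left invariance of Haar
  -- measure makes the average `H` invariant under the unitary group.
  let F : V → V → K → ℂ := fun x y u =>
    ∑ i, starRingEnd ℂ (b.coord i (ρ (unitaryToGL n u⁻¹) x)) * b.coord i (ρ (unitaryToGL n u⁻¹) y)
  have hc : ∀ i x, Continuous fun u : K => b.coord i (ρ (unitaryToGL n u⁻¹) x) := fun i x =>
    (hρ x (b.coord i)).continuous_unitary.comp continuous_inv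
  have hF : ∀ x y, Continuous (F x y) := fun x y =>
    continuous_finsetSum _ fun i _ => (Complex.continuous_conj.comp (hc i x)).mul (hc i y)
  have hint : ∀ x y, MeasureTheory.Integrable (F x y) μ := fun x y =>
    (hF x y).integrable_of_hasCompactSupport (HasCompactSupport.of_compactSpace _)
  let H : V → V → ℂ := fun x y => ∫ u, F x y u ∂μ
  have hnn : ∀ x u, F x x u = ((∑ i, ‖b.coord i (ρ (unitaryToGL n u⁻¹) x)‖ ^ 2 : ℝ) : ℂ) := by
    intro x u
    simp only [F, Complex.ofReal_sum, Complex.ofReal_pow, ← Complex.conj_mul']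
  have hHre : ∀ x, H x x = ((∫ u, ∑ i, ‖b.coord i (ρ (unitaryToGL n u⁻¹) x)‖ ^ 2 ∂μ : ℝ) : ℂ) := by
    intro x
    simp only [H, hnn]
    exact integral_ofReal
  have hHinv : ∀ (u : K) x y, H (ρ (unitaryToGL n u) x) y = H x (ρ (unitaryToGL n u⁻¹) y) := by
    intro u x y
    have h1 : ∀ x y w, F (ρ (unitaryToGL n u) x) (ρ (unitaryToGL n u) y) w = F x y (u⁻¹ * w) := by
      intro x y w
      simp only [F, ← Module.End.mul_apply, ← map_mul, mul_inv_rev, inv_inv]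
    have h2 : y = ρ (unitaryToGL n u) (ρ (unitaryToGL n u⁻¹) y) := by
      rw [← Module.End.mul_apply, ← map_mul, ← map_mul, mul_inv_cancel, map_one, map_one]
      rfl
    calc H (ρ (unitaryToGL n u) x) y
        = H (ρ (unitaryToGL n u) x) (ρ (unitaryToGL n u) (ρ (unitaryToGL n u⁻¹) y)) := by rw [← h2]
      _ = ∫ w, F x (ρ (unitaryToGL n u⁻¹) y) (u⁻¹ * w) ∂μ := by simp only [H, h1]
      _ = _ := MeasureTheory.integral_mul_left_eq_self _ _
  have hsymm : ∀ x y, starRingEnd ℂ (H y x) = H x y := by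
    intro x y
    simp only [H]
    rw [← integral_conj]
    congr 1
    funext u
    simp only [F, map_sum, map_mul, RingHomCompTriple.comp_apply, RingHom.id_apply]
    exact Finset.sum_congr rfl fun i _ => mul_comm _ _
  have hadd : ∀ x y z, H (x + y) z = H x z + H y z := by
    intro x y z
    simp only [H]
    rw [← MeasureTheory.integral_add (hint x z) (hint y z)]
    congr 1
    funext u
    simp only [F, map_add, add_mul, Finset.sum_add_distrib]
  have hsmul : ∀ x y (r : ℂ), H (r • x) y = starRingEnd ℂ r * H x y := by
    intro x y r
    simp only [H]
    rw [← MeasureTheory.integral_const_mul]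
    congr 1
    funext u
    simp only [F, map_smul, smul_eq_mul, map_mul, Finset.mul_sum, mul_assoc]
  have hdef : ∀ x, H x x = 0 → x = 0 := by
    intro x hx
    by_contra hne
    rw [hHre, Complex.ofReal_eq_zero] at hx
    have hcont : Continuous fun u : K => ∑ i, ‖b.coord i (ρ (unitaryToGL n u⁻¹) x)‖ ^ 2 :=
      continuous_finsetSum _ fun i _ => (hc i x).norm.pow 2
    obtain ⟨i, hi⟩ : ∃ i, b.coord i x ≠ 0 := by
      by_contra! hcon
      exact hne (b.ext_elem fun i => by simpa using hcon i)
    have hpos := hcont.integral_pos_of_hasCompactSupport_nonneg_nonzero (μ := μ) (x := 1)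
      (HasCompactSupport.of_compactSpace _)
      (fun u => Finset.sum_nonneg fun i _ => by positivity) ?_
    · exact hpos.ne' hx
    · refine (Finset.sum_pos' (fun i _ => by positivity) ⟨i, Finset.mem_univ i, ?_⟩).ne'
      have : 0 < ‖b.coord i x‖ ^ 2 := pow_pos (norm_pos_iff.2 hi) 2
      simpa only [inv_one, map_one, Module.End.one_apply] using this
  let B : V →ₗ⋆[ℂ] V →ₗ[ℂ] ℂ := LinearMap.mk₂'ₛₗ (starRingEnd ℂ) (RingHom.id ℂ) H hadd
    (fun r x y => hsmul x y r)
    (fun x y z => by rw [← hsymm, hadd, map_add, hsymm, hsymm])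
    (fun r x y => by rw [← hsymm, hsmul, map_mul, hsymm]; simp)
  refine ⟨{ inner := H, conj_inner_symm := hsymm, re_inner_nonneg := fun x => ?_,
            add_left := hadd, smul_left := hsmul, definite := hdef }, fun g x y => ?_⟩
  · rw [hHre]
    exact MeasureTheory.integral_nonneg fun u => Finset.sum_nonneg fun i _ => by positivity
  -- Unitary invariance is adjointness for unitary `g`, where the conjugate transpose is the
  -- inverse. The defect of the identity is regular in `g`, so it vanishes on the whole group.
  · have hD : IsRegular fun g => B y (ρ g x) + -1 * starRingEnd ℂ (B x (ρ (star g) y)) :=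
      (hρ x (B y)).add ((IsRegular.const _).mul (hρ y (B x)).conj_star)
    have h0 := hD.eq_zero_of_unitary (fun u hu => ?_) g
    · have h1 : H y (ρ g x) = starRingEnd ℂ (H x (ρ (star g) y)) := by
        have h2 : H y (ρ g x) + -1 * starRingEnd ℂ (H x (ρ (star g) y)) = 0 := h0
        linear_combination h2
      change H (ρ g x) y = H x (ρ (star g) y)
      rw [← hsymm, h1, Complex.conj_conj]
    · obtain ⟨w, rfl⟩ : ∃ w : K, unitaryToGL n w = u := ⟨⟨u.val, hu⟩, by ext; rfl⟩
      change H y (ρ (unitaryToGL n w) x) + -1 * starRingEnd ℂ (H x (ρ (star (unitaryToGL n w)) y)) = 0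
      rw [star_unitaryToGL, ← hHinv, hsymm]
      ring

end GLRep

namespace GLRep

open Topology

/-! ### Weights -/

/-! ### Semi-invariant vectors: a common form of weight spaces, highest weight vectors and (for the
empty set) the whole space -/

section SemiInvariants

variable {G V W : Type*} [Group G] [AddCommGroup V] [Module ℂ V] [AddCommGroup W] [Module ℂ W]

/-- The vectors on which every element `b` of `S` acts by the scalar `χ b`. -/
def semiInv (ρ : Representation ℂ G V) (S : Set G) (χ : G → ℂ) : Submodule ℂ V where
  carrier := {x | ∀ b ∈ S, ρ b x = χ b • x}
  zero_mem' b _ := by simp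
  add_mem' hx hy b hb := by rw [map_add, hx b hb, hy b hb, smul_add]
  smul_mem' c x hx b hb := by rw [map_smul, hx b hb, smul_comm]

theorem mem_semiInv {ρ : Representation ℂ G V} {S : Set G} {χ : G → ℂ} {x : V} :
    x ∈ semiInv ρ S χ ↔ ∀ b ∈ S, ρ b x = χ b • x := Iff.rfl

/-- Equivalent representations have the same dimensions of semi-invariants. -/
theorem finrank_semiInv_congr {ρ : Representation ℂ G V} {σ : Representation ℂ G W} (e : V ≃ₗ[ℂ] W)
    (he : ∀ g x, e (ρ g x) = σ g (e x)) (S : Set G) (χ : G → ℂ) :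
    Module.finrank ℂ (semiInv ρ S χ) = Module.finrank ℂ (semiInv σ S χ) := by
  have : (semiInv ρ S χ).map e.toLinearMap = semiInv σ S χ := by
    ext y
    constructor
    · rintro ⟨x, hx, rfl⟩ b hb
      change σ b (e x) = χ b • e x
      rw [← he, hx b hb, map_smul]
    · intro hy
      refine ⟨e.symm y, fun b hb => ?_, by simp⟩
      apply e.injective
      rw [he, map_smul, e.apply_symm_apply, hy b hb]
  rw [← this]
  exact (LinearEquiv.finrank_map_eq e _).symm

theorem finrank_semiInv_prod [FiniteDimensional ℂ V] [FiniteDimensional ℂ W]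
    (ρ : Representation ℂ G V) (σ : Representation ℂ G W)
    (S : Set G) (χ : G → ℂ) : Module.finrank ℂ (semiInv (ρ.prod σ) S χ) =
      Module.finrank ℂ (semiInv ρ S χ) + Module.finrank ℂ (semiInv σ S χ) := by
  have : semiInv (ρ.prod σ) S χ = (semiInv ρ S χ).prod (semiInv σ S χ) := by
    ext ⟨x, y⟩
    simp only [mem_semiInv, Submodule.mem_prod]
    constructor
    · intro h
      exact ⟨fun b hb => congrArg Prod.fst (h b hb), fun b hb => congrArg Prod.snd (h b hb)⟩
    · rintro ⟨h1, h2⟩ b hb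
      exact Prod.ext (h1 b hb) (h2 b hb)
  rw [this, ← Module.finrank_prod]
  exact LinearEquiv.finrank_eq
    { toFun := fun x => (⟨x.1.1, x.2.1⟩, ⟨x.1.2, x.2.2⟩)
      invFun := fun x => ⟨(x.1.1, x.2.1), x.1.2, x.2.2⟩
      map_add' := fun _ _ => rfl
      map_smul' := fun _ _ => rfl }

end SemiInvariants

/-- The character `b ↦ ∏ bᵢᵢ ^ κᵢ` of upper triangular matrices. -/
noncomputable def diagChar {n : ℕ} (κ : Fin n → ℤ) (g : GL (Fin n) ℂ) : ℂ := ∏ i, g.val i i ^ κ i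

/-- Invertible diagonal matrices. -/
def diagonalSet (n : ℕ) : Set (GL (Fin n) ℂ) := {g | ∀ i j, i ≠ j → g.val i j = 0}

/-- Invertible upper triangular matrices. -/
def borelSet (n : ℕ) : Set (GL (Fin n) ℂ) := {g | IsUpper g.val}

theorem diagonalSet_subset (n : ℕ) : diagonalSet n ⊆ borelSet n := fun _ hg i j hij => hg i j hij.ne'

/-- The diagonal matrix with given entries. -/
def torus {n : ℕ} : (Fin n → ℂˣ) →* GL (Fin n) ℂ where
  toFun t := ⟨Matrix.diagonal fun i => (t i : ℂ), Matrix.diagonal fun i => ((t i)⁻¹ : ℂˣ),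
    by simp [Matrix.diagonal_mul_diagonal], by simp [Matrix.diagonal_mul_diagonal]⟩
  map_one' := by ext; simp
  map_mul' s t := by
    ext : 1
    simp only [Units.val_mul, Pi.mul_apply]
    exact (Matrix.diagonal_mul_diagonal _ _).symm

theorem torus_val {n : ℕ} (t : Fin n → ℂˣ) : (torus t).val = Matrix.diagonal fun i => (t i : ℂ) := rfl

theorem torus_mem {n : ℕ} (t : Fin n → ℂˣ) : torus t ∈ diagonalSet n := fun _ _ hij =>
  Matrix.diagonal_apply_ne _ hij

/-- The characters of the torus. -/
noncomputable def torusChar {n : ℕ} (κ : Fin n → ℤ) : (Fin n → ℂˣ) →* ℂ where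
  toFun t := ∏ i, (t i : ℂ) ^ κ i
  map_one' := by simp
  map_mul' s t := by simp [mul_zpow, Finset.prod_mul_distrib]

theorem torusChar_apply {n : ℕ} (κ : Fin n → ℤ) (t : Fin n → ℂˣ) :
    torusChar κ t = ∏ i, (t i : ℂ) ^ κ i := rfl

theorem torusChar_add {n : ℕ} (κ κ' : Fin n → ℤ) (t : Fin n → ℂˣ) :
    torusChar (κ + κ') t = torusChar κ t * torusChar κ' t := by
  simp only [torusChar_apply, ← Finset.prod_mul_distrib, Pi.add_apply]
  exact Finset.prod_congr rfl fun i _ => zpow_add₀ (t i).ne_zero _ _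

theorem torusChar_zero {n : ℕ} (t : Fin n → ℂˣ) : torusChar 0 t = 1 := by
  simp [torusChar_apply]

theorem diagChar_torus {n : ℕ} (κ : Fin n → ℤ) (t : Fin n → ℂˣ) :
    diagChar κ (torus t) = torusChar κ t := by
  simp [diagChar, torus_val, torusChar_apply]

theorem torusChar_injective (n : ℕ) : Function.Injective (torusChar (n := n)) := by
  intro κ κ' h
  funext i
  have h2 : (2 : ℂ) ≠ 0 := two_ne_zero
  -- Entry 2 in place `i` and 1 elsewhere isolates the exponent `κ i`, which absolute values then
  -- recover.
  have := DFunLike.congr_fun h (Pi.mulSingle i (Units.mk0 2 h2))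
  simp only [torusChar_apply] at this
  rw [Finset.prod_eq_single i, Finset.prod_eq_single i] at this
  · simp only [Pi.mulSingle_eq_same, Units.val_mk0] at this
    have h3 := congrArg (‖·‖) this
    simp only [norm_zpow, Complex.norm_ofNat] at h3
    exact zpow_right_injective₀ (by norm_num) (by norm_num) h3
  all_goals simp +contextual [Pi.mulSingle_eq_of_ne]

theorem linearIndependent_torusChar (n : ℕ) :
    LinearIndependent ℂ (fun κ : Fin n → ℤ => (torusChar κ : (Fin n → ℂˣ) → ℂ)) :=
  (linearIndependent_monoidHom (Fin n → ℂˣ) ℂ).comp _ (torusChar_injective n)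

theorem exists_torus_of_mem {n : ℕ} {g : GL (Fin n) ℂ} (hg : g ∈ diagonalSet n) :
    ∃ t, g = torus t := by
  have h0 := fun i => IsUpper.diag_ne_zero (diagonalSet_subset n hg) i
  refine ⟨fun i => Units.mk0 _ (h0 i), ?_⟩
  ext i j
  rw [torus_val]
  by_cases h : i = j
  · subst h; simp
  · rw [Matrix.diagonal_apply_ne _ h, hg i j h]

variable {n : ℕ} {V : Type*} [AddCommGroup V] [Module ℂ V]

/-- The weight spaces of a representation. -/
noncomputable abbrev weightSpace (ρ : Representation ℂ (GL (Fin n) ℂ) V) (κ : Fin n → ℤ) : Submodule ℂ V :=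
  semiInv ρ (diagonalSet n) (diagChar κ)

/-- The vectors on which the upper triangular matrices act through the character `κ`. -/
noncomputable abbrev hwSpace (ρ : Representation ℂ (GL (Fin n) ℂ) V) (κ : Fin n → ℤ) : Submodule ℂ V :=
  semiInv ρ (borelSet n) (diagChar κ)

theorem hwSpace_le_weightSpace (ρ : Representation ℂ (GL (Fin n) ℂ) V) (κ : Fin n → ℤ) :
    hwSpace ρ κ ≤ weightSpace ρ κ := fun _ hx b hb => hx b (diagonalSet_subset n hb)

theorem mem_weightSpace {ρ : Representation ℂ (GL (Fin n) ℂ) V} {κ : Fin n → ℤ} {x : V} :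
    x ∈ weightSpace ρ κ ↔ ∀ t, ρ (torus t) x = torusChar κ t • x := by
  constructor
  · intro h t
    rw [h _ (torus_mem t), diagChar_torus]
  · intro h b hb
    obtain ⟨t, rfl⟩ := exists_torus_of_mem hb
    rw [h, diagChar_torus]

/-- On the torus, off-diagonal entries vanish while diagonal entries and the inverse determinant are
characters; regular functions therefore restrict to Laurent polynomials. -/
theorem IsRegular.torus_mem_span {f : GL (Fin n) ℂ → ℂ} (hf : IsRegular f) :
    (fun t => f (torus t)) ∈
      Submodule.span ℂ (Set.range fun κ : Fin n → ℤ => (torusChar κ : (Fin n → ℂˣ) → ℂ)) := by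
  set L := Submodule.span ℂ (Set.range fun κ : Fin n → ℤ => (torusChar κ : (Fin n → ℂˣ) → ℂ))
  have hmul : ∀ (κ : Fin n → ℤ) (f : (Fin n → ℂˣ) → ℂ), f ∈ L → f * torusChar κ ∈ L := by
    intro κ f hf
    induction hf using Submodule.span_induction with
    | mem f hf =>
      obtain ⟨κ', rfl⟩ := hf
      refine Submodule.subset_span ⟨κ' + κ, ?_⟩
      funext t
      exact torusChar_add κ' κ t
    | zero => rw [zero_mul]; exact zero_mem _
    | add f g _ _ hf hg => rw [add_mul]; exact add_mem hf hg
    | smul a f _ hf => rw [smul_mul_assoc]; exact Submodule.smul_mem _ _ hf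
  obtain ⟨p, m, hp⟩ := hf
  have hdet : ∀ t : Fin n → ℂˣ, ((torus t).val.det)⁻¹ ^ m = torusChar (fun _ => -(m : ℤ)) t := by
    intro t
    rw [torus_val, Matrix.det_diagonal, torusChar_apply, ← Finset.prod_inv_distrib,
      ← Finset.prod_pow]
    refine Finset.prod_congr rfl fun i _ => ?_
    rw [zpow_neg, zpow_natCast, inv_pow]
  have : (fun t => f (torus t)) = (fun t => MvPolynomial.eval (fun ij => (torus t).val ij.1 ij.2) p)
      * (torusChar fun _ => -(m : ℤ) : (Fin n → ℂˣ) →* ℂ) := by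
    funext t
    rw [hp, hdet]
    rfl
  rw [this]
  apply hmul
  clear this hp hdet
  induction p using MvPolynomial.induction_on with
  | C a =>
    have : (fun t : Fin n → ℂˣ => MvPolynomial.eval (fun ij : Fin n × Fin n => (torus t).val ij.1 ij.2)
        (MvPolynomial.C a)) = a • ((torusChar 0 : (Fin n → ℂˣ) →* ℂ) : (Fin n → ℂˣ) → ℂ) := by
      funext t
      simp [torusChar_zero]
    rw [this]
    exact Submodule.smul_mem _ _ (Submodule.subset_span ⟨0, rfl⟩)
  | add p q hp hq =>
    simp only [map_add]
    exact add_mem hp hq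
  | mul_X p ij hp =>
    simp only [map_mul, MvPolynomial.eval_X]
    by_cases h : ij.1 = ij.2
    · refine (congrArg (· ∈ L) ?_).mp (hmul (Pi.single ij.1 1) _ hp)
      funext t
      rw [Pi.mul_apply, torusChar_apply, Finset.prod_eq_single ij.1, torus_val, ← h]
      · simp
      · intro j _ hj
        simp [hj]
      · simp
    · have : ∀ t : Fin n → ℂˣ, (torus t).val ij.1 ij.2 = 0 := fun t => torus_mem t _ _ h
      simp only [this, mul_zero]
      exact zero_mem L

theorem eq_zero_of_sum_torusChar_smul [FiniteDimensional ℂ V] {F : Finset (Fin n → ℤ)}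
    {y : (Fin n → ℤ) → V} (h : ∀ t, ∑ κ ∈ F, torusChar κ t • y κ = 0) :
    ∀ κ ∈ F, y κ = 0 := by
  intro κ hκ
  let b := Module.finBasis ℂ V
  refine b.ext_elem fun i => ?_
  have := linearIndependent_iff'.1 (linearIndependent_torusChar n) F (fun κ => b.coord i (y κ)) ?_ κ hκ
  · simpa using this
  · funext t
    have h1 := congrArg (b.coord i) (h t)
    simp only [map_sum, map_smul, smul_eq_mul, map_zero] at h1
    simp only [Finset.sum_apply, Pi.smul_apply, smul_eq_mul, Pi.zero_apply]
    rw [← h1]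
    exact Finset.sum_congr rfl fun _ _ => mul_comm _ _

variable [FiniteDimensional ℂ V] {ρ : Representation ℂ (GL (Fin n) ℂ) V}

/-- The coordinates of `ρ t x` are Laurent polynomials in `t`, so `ρ t x` is a sum of characters
with vector coefficients `y κ`. Comparing the actions of `t * s` and of `t` followed by `s`,
independence of characters shows that `y κ` has weight `κ`; putting `t = 1` recovers `x`. -/
theorem IsAlgebraic.exists_weight_decomposition (hρ : IsAlgebraic ρ) (x : V) :
    ∃ (F : Finset (Fin n → ℤ)) (y : (Fin n → ℤ) → V),
      (∀ κ, y κ ∈ weightSpace ρ κ) ∧ x = ∑ κ ∈ F, y κ := by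
  classical
  let b := Module.finBasis ℂ V
  have h1 : ∀ i, ∃ c : (Fin n → ℤ) →₀ ℂ, ∀ t,
      b.coord i (ρ (torus t) x) = ∑ κ ∈ c.support, c κ * torusChar κ t := by
    intro i
    obtain ⟨c, hc⟩ := Finsupp.mem_span_range_iff_exists_finsupp.1 (hρ x (b.coord i)).torus_mem_span
    refine ⟨c, fun t => ?_⟩
    rw [← congrFun hc t]
    simp [Finsupp.sum]
  choose c hc using h1
  let F : Finset (Fin n → ℤ) := Finset.univ.biUnion fun i => (c i).support
  let y : (Fin n → ℤ) → V := fun κ => ∑ i, c i κ • b i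
  have hy0 : ∀ κ ∉ F, y κ = 0 := by
    intro κ hκ
    refine Finset.sum_eq_zero fun i _ => ?_
    have : κ ∉ (c i).support := fun h => hκ (Finset.mem_biUnion.2 ⟨i, Finset.mem_univ i, h⟩)
    rw [Finsupp.notMem_support_iff.1 this, zero_smul]
  have key : ∀ t, ρ (torus t) x = ∑ κ ∈ F, torusChar κ t • y κ := by
    intro t
    conv_lhs => rw [← b.sum_repr (ρ (torus t) x)]
    simp only [y, Finset.smul_sum]
    rw [Finset.sum_comm]
    refine Finset.sum_congr rfl fun i _ => ?_
    have : b.repr (ρ (torus t) x) i = ∑ κ ∈ F, c i κ * torusChar κ t := by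
      have h2 := hc i t
      rw [Module.Basis.coord_apply] at h2
      rw [h2]
      refine Finset.sum_subset (Finset.subset_biUnion_of_mem (fun i => (c i).support)
        (Finset.mem_univ i)) fun κ _ hκ => ?_
      rw [Finsupp.notMem_support_iff.1 hκ, zero_mul]
    rw [this, Finset.sum_smul]
    exact Finset.sum_congr rfl fun κ _ => by rw [smul_smul, mul_comm]
  refine ⟨F, y, fun κ => mem_weightSpace.2 fun s => ?_, ?_⟩
  · by_cases hκ : κ ∈ F
    · have h3 : ∀ t, ∑ κ ∈ F, torusChar κ t • (ρ (torus s) (y κ) - torusChar κ s • y κ) = 0 := by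
        intro t
        have h4 : ρ (torus s) (ρ (torus t) x) = ρ (torus (t * s)) x := by
          rw [mul_comm, map_mul, map_mul, Module.End.mul_apply]
        rw [key, key, map_sum] at h4
        simp only [smul_sub, Finset.sum_sub_distrib, smul_smul, ← map_mul]
        rw [← h4, sub_eq_zero]
        exact Finset.sum_congr rfl fun κ _ => by rw [map_smul]
      exact sub_eq_zero.1 (eq_zero_of_sum_torusChar_smul h3 κ hκ)
    · rw [hy0 κ hκ]; simp
  · have := key 1
    simpa using this

theorem iSupIndep_weightSpace (ρ : Representation ℂ (GL (Fin n) ℂ) V) : iSupIndep (weightSpace ρ) := by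
  rw [iSupIndep_iff_finsetSum_eq_zero_imp_eq_zero]
  intro F y hy h0
  refine eq_zero_of_sum_torusChar_smul fun t => ?_
  have := congrArg (ρ (torus t)) h0
  rw [map_sum, map_zero] at this
  rw [← this]
  exact Finset.sum_congr rfl fun κ hκ => (mem_weightSpace.1 (hy κ hκ) t).symm

theorem finite_weights (ρ : Representation ℂ (GL (Fin n) ℂ) V) :
    {κ | weightSpace ρ κ ≠ ⊥}.Finite :=
  WellFoundedGT.finite_ne_bot_of_iSupIndep (iSupIndep_weightSpace ρ)

theorem IsAlgebraic.iSup_weightSpace (hρ : IsAlgebraic ρ) : ⨆ κ, weightSpace ρ κ = ⊤ := by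
  refine eq_top_iff.2 fun x _ => ?_
  obtain ⟨F, y, hy, rfl⟩ := hρ.exists_weight_decomposition x
  exact Submodule.sum_mem _ fun κ _ => Submodule.mem_iSup_of_mem κ (hy κ)

theorem IsAlgebraic.isInternal (hρ : IsAlgebraic ρ) : DirectSum.IsInternal (weightSpace ρ) :=
  DirectSum.isInternal_submodule_of_iSupIndep_of_iSup_eq_top (iSupIndep_weightSpace ρ)
    hρ.iSup_weightSpace

theorem IsAlgebraic.trace_torus (hρ : IsAlgebraic ρ) (t : Fin n → ℂˣ) :
    LinearMap.trace ℂ V (ρ (torus t)) = ∑ κ ∈ (finite_weights ρ).toFinset,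
      (Module.finrank ℂ (weightSpace ρ κ) : ℂ) * torusChar κ t := by
  have hmaps : ∀ κ, Set.MapsTo (ρ (torus t)) (weightSpace ρ κ) (weightSpace ρ κ) := by
    intro κ x hx
    rw [SetLike.mem_coe, mem_weightSpace.1 hx t]
    exact Submodule.smul_mem _ _ hx
  rw [LinearMap.trace_eq_sum_trace_restrict' hρ.isInternal (finite_weights ρ) hmaps]
  refine Finset.sum_congr rfl fun κ _ => ?_
  have : (ρ (torus t)).restrict (hmaps κ) = torusChar κ t • LinearMap.id := by
    ext x
    exact mem_weightSpace.1 x.2 t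
  rw [this, map_smul, LinearMap.trace_id, smul_eq_mul, mul_comm]

end GLRep

namespace GLRep

open Topology

/-! ### Highest weight theory -/

/-- The pairing of a weight with `(n-1, …, 1, 0)`. -/
def heightPairing {n : ℕ} (κ : Fin n → ℤ) : ℤ := ∑ i, ((i.rev.1 : ℕ) : ℤ) * κ i

/-- A positive one-parameter subgroup. -/
def oneParam (n : ℕ) (s : ℂˣ) : GL (Fin n) ℂ := torus fun i => s ^ i.rev.1

theorem torusChar_oneParam {n : ℕ} (κ : Fin n → ℤ) (s : ℂˣ) :
    torusChar κ (fun i => s ^ i.rev.1) = (s : ℂ) ^ heightPairing κ := by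
  rw [torusChar_apply, heightPairing]
  have : ∀ F : Finset (Fin n), ∏ i ∈ F, (((s ^ i.rev.1 : ℂˣ) : ℂ) ^ κ i) =
      (s : ℂ) ^ ∑ i ∈ F, ((i.rev.1 : ℕ) : ℤ) * κ i := by
    classical
    intro F
    induction F using Finset.induction_on with
    | empty => simp
    | insert a F ha ih =>
      rw [Finset.prod_insert ha, Finset.sum_insert ha, zpow_add₀ s.ne_zero, ih, zpow_mul, zpow_natCast]
      push_cast
      rfl
  exact this _

section

variable {n : ℕ} {V : Type*} [AddCommGroup V] [Module ℂ V] [FiniteDimensional ℂ V]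
  {ρ : Representation ℂ (GL (Fin n) ℂ) V}

/-- Conjugating `u` by `oneParam n s` multiplies entry (i, j) by a nonnegative power of `s`, so the
coefficient of the conjugate at `x` is a polynomial in `s`, with value `φ x` at 0 and `φ (ρ u x)` at
1. Computed through weights, it involves only nonpositive powers of `s`, because the height of `κ`
is maximal. Hence it is constant. -/
theorem IsAlgebraic.unipotent_apply (hρ : IsAlgebraic ρ) {κ : Fin n → ℤ}
    (hκ : ∀ κ', weightSpace ρ κ' ≠ ⊥ → heightPairing κ' ≤ heightPairing κ) {x : V}
    (hx : x ∈ weightSpace ρ κ) {u : GL (Fin n) ℂ} (hu : IsUpper u.val) (hu1 : ∀ i, u.val i i = 1) :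
    ρ u x = x := by
  obtain ⟨F, y, hy, hxy⟩ := hρ.exists_weight_decomposition (ρ u x)
  refine (Module.finBasis ℂ V).ext_elem fun i => ?_
  set φ : Module.Dual ℂ V := (Module.finBasis ℂ V).coord i with hφ
  change φ _ = φ _
  obtain ⟨p, m, hp⟩ := hρ x φ
  beta_reduce at hp
  -- The numerator of the coefficient at the conjugate of `u`; the determinant of the conjugate is
  -- 1, so no denominator appears.
  let Q : Polynomial ℂ := MvPolynomial.aeval (fun ij : Fin n × Fin n =>
    Polynomial.C (u.val ij.1 ij.2) * Polynomial.X ^ (ij.2.1 - ij.1.1)) p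
  have hQ : ∀ s, Q.eval s = MvPolynomial.eval (fun ij => u.val ij.1 ij.2 * s ^ (ij.2.1 - ij.1.1)) p := by
    intro s
    simp only [Q]
    rw [← Polynomial.coe_evalRingHom, MvPolynomial.aeval_def, MvPolynomial.hom_eval₂,
      MvPolynomial.eval, MvPolynomial.coe_eval₂Hom]
    congr 1
    · ext; simp
    · funext ij; simp
  have hconj : ∀ s : ℂˣ, ∀ i j, (oneParam n s * u * (oneParam n s)⁻¹).val i j =
      u.val i j * (s : ℂ) ^ (j.1 - i.1) := by
    intro s i j
    have hinv : (oneParam n s)⁻¹ = torus fun i => (s ^ i.rev.1)⁻¹ := by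
      rw [oneParam, ← map_inv]; rfl
    rw [hinv, Units.val_mul, Units.val_mul, torus_val, oneParam, torus_val, Matrix.mul_diagonal,
      Matrix.diagonal_mul]
    by_cases hij : j < i
    · simp [hu i j hij]
    · have h1 : i.rev.1 = j.rev.1 + (j.1 - i.1) := by
        simp only [Fin.val_rev]
        have := j.2
        have : i.1 ≤ j.1 := not_lt.1 hij
        omega
      rw [h1, pow_add]
      have hs := s.ne_zero
      push_cast
      field_simp
  have hdet : u.val.det = 1 := by rw [hu.det]; simp [hu1]
  have hQs : ∀ s : ℂˣ, Q.eval (s : ℂ) = φ (ρ (oneParam n s * u * (oneParam n s)⁻¹) x) := by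
    intro s
    rw [hp, hQ]
    have : (oneParam n s * u * (oneParam n s)⁻¹).val.det = 1 := by
      rw [Units.val_mul, Units.val_mul, Matrix.det_mul, Matrix.det_mul, hdet, mul_one,
        ← Matrix.det_mul, ← Units.val_mul, mul_inv_cancel]
      simp
    rw [this]
    simp [hconj]
  have hQ0 : Q.eval 0 = φ x := by
    have h1 := hp 1
    rw [map_one] at h1
    rw [hQ]
    simp only [Module.End.one_apply, Units.val_one, Matrix.det_one, inv_one, one_pow, mul_one] at h1
    rw [h1]
    congr 2
    funext ij
    -- At 0 the entries above the diagonal are killed by a positive power. Below it the truncated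
    -- exponent is 0, but there `u` itself vanishes.
    rcases lt_trichotomy ij.1 ij.2 with h | h | h
    · rw [Matrix.one_apply_ne h.ne, zero_pow, mul_zero]
      have : ij.1.1 < ij.2.1 := h
      omega
    · rw [h, Matrix.one_apply_eq, hu1]; simp
    · rw [Matrix.one_apply_ne h.ne', hu _ _ h, zero_mul]
  have hQ1 : Q.eval 1 = φ (ρ u x) := by
    have := hQs 1
    have h1 : oneParam n 1 = 1 := by
      simp only [oneParam, one_pow]
      exact map_one torus
    rw [h1] at this
    simpa using this
  -- The drop in height from `κ`; `hκ` makes it nonnegative whenever `y κ'` is nonzero, so the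
  -- truncation is harmless.
  let d : (Fin n → ℤ) → ℕ := fun κ' => (heightPairing κ - heightPairing κ').toNat
  have hR : ∀ s : ℂˣ, Q.eval (s : ℂ) = ∑ κ' ∈ F, φ (y κ') * ((s : ℂ)⁻¹) ^ d κ' := by
    intro s
    have h1 : (oneParam n s)⁻¹ = torus (fun i => s ^ i.rev.1)⁻¹ := by rw [oneParam, ← map_inv]
    rw [hQs, map_mul, map_mul, Module.End.mul_apply, Module.End.mul_apply, h1, mem_weightSpace.1 hx,
      map_smul, hxy, map_smul, map_sum, map_smul, map_sum, smul_eq_mul, Finset.mul_sum]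
    refine Finset.sum_congr rfl fun κ' _ => ?_
    by_cases h0 : y κ' = 0
    · simp [h0]
    have hle := hκ κ' fun h => h0 ((Submodule.mem_bot ℂ).1 (h ▸ hy κ'))
    rw [oneParam, mem_weightSpace.1 (hy κ'), map_smul, smul_eq_mul, torusChar_oneParam]
    have h2 : torusChar κ (fun i => s ^ i.rev.1)⁻¹ = ((s : ℂ) ^ heightPairing κ)⁻¹ := by
      rw [← torusChar_oneParam, torusChar_apply, torusChar_apply, ← Finset.prod_inv_distrib]
      refine Finset.prod_congr rfl fun i _ => ?_
      rw [Pi.inv_apply, Units.val_inv_eq_inv_val, inv_zpow]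
    rw [h2]
    have h3 : ((s : ℂ)⁻¹) ^ d κ' = ((s : ℂ) ^ heightPairing κ)⁻¹ * (s : ℂ) ^ heightPairing κ' := by
      rw [← zpow_natCast, inv_zpow', ← zpow_neg, ← zpow_add₀ s.ne_zero]
      congr 1
      simp only [d]
      rw [Int.toNat_of_nonneg (by omega)]
      ring
    rw [h3]
    ring
  -- Multiplying by `X ^ D` clears the negative powers; the degree bound `D` for the product then
  -- leaves degree 0 for `Q`.
  let D : ℕ := F.sup d
  have hpoly : Q * Polynomial.X ^ D = ∑ κ' ∈ F, Polynomial.C (φ (y κ')) * Polynomial.X ^ (D - d κ') := by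
    refine Polynomial.eq_of_infinite_eval_eq _ _ (Set.Infinite.mono (s := {0}ᶜ) ?_
      (Set.finite_singleton 0).infinite_compl)
    intro s hs
    have hs0 : s ≠ 0 := hs
    have := hR (Units.mk0 s hs0)
    simp only [Set.mem_ofPred_eq, Polynomial.eval_mul, Polynomial.eval_pow, Polynomial.eval_X,
      Polynomial.eval_finsetSum, Polynomial.eval_C]
    rw [Units.val_mk0] at this
    rw [this, Finset.sum_mul]
    refine Finset.sum_congr rfl fun κ' hκ' => ?_
    have hdD : d κ' ≤ D := Finset.le_sup hκ'
    obtain ⟨k, hk⟩ := Nat.exists_eq_add_of_le hdD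
    rw [hk, Nat.add_sub_cancel_left, pow_add, inv_pow]
    field_simp
  have hdeg : (Q * Polynomial.X ^ D).natDegree ≤ D := by
    rw [hpoly]
    refine Polynomial.natDegree_sum_le_of_forall_le _ _ fun κ' _ => ?_
    exact (Polynomial.natDegree_C_mul_X_pow_le _ _).trans (Nat.sub_le _ _)
  have hQc : Q.natDegree = 0 := by
    by_cases h : Q = 0
    · simp [h]
    rw [Polynomial.natDegree_mul_X_pow D h] at hdeg
    omega
  rw [← hQ1, ← hQ0]
  rw [Polynomial.eq_C_of_natDegree_eq_zero hQc]
  simp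

/-- Vectors whose weight is maximal for the height pairing are semi-invariant under the upper
triangular matrices. -/
theorem IsAlgebraic.weightSpace_le_hwSpace (hρ : IsAlgebraic ρ) {κ : Fin n → ℤ}
    (hκ : ∀ κ', weightSpace ρ κ' ≠ ⊥ → heightPairing κ' ≤ heightPairing κ) :
    weightSpace ρ κ ≤ hwSpace ρ κ := by
  intro x hx b hb
  have h0 := fun i => IsUpper.diag_ne_zero hb i
  let t : GL (Fin n) ℂ := torus fun i => Units.mk0 _ (h0 i)
  have ht : t⁻¹ = torus (fun i => (Units.mk0 _ (h0 i))⁻¹) := by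
    simp only [t]; rw [← map_inv]; rfl
  have hval : ∀ i j, (t⁻¹ * b).val i j = (b.val i i)⁻¹ * b.val i j := by
    intro i j
    rw [ht, Units.val_mul, torus_val, Matrix.diagonal_mul]
    simp
  have hu := hρ.unipotent_apply hκ hx (u := t⁻¹ * b)
    (fun i j hij => by rw [hval, hb i j hij, mul_zero])
    (fun i => by rw [hval, inv_mul_cancel₀ (h0 i)])
  have h1 : b = t * (t⁻¹ * b) := by group
  conv_lhs => rw [h1, map_mul, Module.End.mul_apply, hu]
  rw [hx t (torus_mem _)]
  simp [diagChar, t, torus_val]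

/-- Permutation matrices. -/
def permGL {n : ℕ} (σ : Equiv.Perm (Fin n)) : GL (Fin n) ℂ where
  val := Matrix.of fun i j => if σ i = j then 1 else 0
  inv := Matrix.of fun i j => if σ j = i then 1 else 0
  val_inv := by
    ext i j
    simp [Matrix.mul_apply, Matrix.one_apply, eq_comm]
  inv_val := by
    ext i j
    rw [Matrix.mul_apply, Finset.sum_eq_single (σ.symm i)]
    · simp [Matrix.one_apply]
    · intro k _ hk
      have : σ k ≠ i := fun h => hk (by rw [← h]; simp)
      simp [this]
    · simp

omit [FiniteDimensional ℂ V] in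
theorem permGL_mem_weightSpace (σ : Equiv.Perm (Fin n)) {κ : Fin n → ℤ} {x : V}
    (hx : x ∈ weightSpace ρ κ) : ρ (permGL σ) x ∈ weightSpace ρ (κ ∘ σ) := by
  rw [mem_weightSpace] at hx ⊢
  intro t
  have h1 : torus t * permGL σ = permGL σ * torus (t ∘ σ.symm) := by
    ext i j
    rw [Units.val_mul, Units.val_mul, torus_val, torus_val, Matrix.diagonal_mul,
      Matrix.mul_diagonal]
    simp only [permGL, Matrix.of_apply, Function.comp_apply]
    by_cases h : σ i = j
    · simp [← h]
    · simp [h]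
  rw [← Module.End.mul_apply, ← map_mul, h1, map_mul, Module.End.mul_apply, hx, map_smul]
  congr 1
  rw [torusChar_apply, torusChar_apply, ← Equiv.prod_comp σ]
  simp

/-- A permutation matrix maps one weight space injectively into the other, and the inverse
permutation gives the opposite inequality. -/
theorem finrank_weightSpace_perm (ρ : Representation ℂ (GL (Fin n) ℂ) V) (σ : Equiv.Perm (Fin n))
    (κ : Fin n → ℤ) :
    Module.finrank ℂ (weightSpace ρ (κ ∘ σ)) = Module.finrank ℂ (weightSpace ρ κ) := by
  have h : ∀ (σ : Equiv.Perm (Fin n)) (κ : Fin n → ℤ),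
      Module.finrank ℂ (weightSpace ρ κ) ≤ Module.finrank ℂ (weightSpace ρ (κ ∘ σ)) := by
    intro σ κ
    refine LinearMap.finrank_le_finrank_of_injective (f := (ρ (permGL σ)).restrict
      (fun x hx => permGL_mem_weightSpace σ hx)) ?_
    intro x y hxy
    have := congrArg Subtype.val hxy
    simp only [LinearMap.coe_restrict_apply] at this
    exact Subtype.ext ((ρ.apply_bijective _).1 this)
  refine le_antisymm ?_ (h σ κ)
  have := h σ⁻¹ (κ ∘ σ)
  rwa [Function.comp_assoc, ← Equiv.Perm.coe_mul, mul_inv_cancel, Equiv.Perm.coe_one,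
    Function.comp_id] at this

/-- A weight of largest height exists because there are finitely many weights. It is dominant:
swapping two entries in the wrong order would give another weight, by symmetry, of larger height. -/
theorem IsAlgebraic.exists_maximal_weight [Nontrivial V] (hρ : IsAlgebraic ρ) :
    ∃ κ, Antitone κ ∧ weightSpace ρ κ ≠ ⊥ ∧
      ∀ κ', weightSpace ρ κ' ≠ ⊥ → heightPairing κ' ≤ heightPairing κ := by
  have hne : {κ | weightSpace ρ κ ≠ ⊥}.Nonempty := by
    by_contra! h
    have h1 : ∀ κ, weightSpace ρ κ = ⊥ := fun κ => by
      by_contra hκ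
      have : κ ∈ {κ | weightSpace ρ κ ≠ ⊥} := hκ
      rw [h] at this
      exact this
    have h2 := hρ.iSup_weightSpace
    simp only [h1, iSup_bot] at h2
    exact bot_ne_top h2
  obtain ⟨κ, hκ, hmax⟩ := Set.exists_max_image _ heightPairing (finite_weights ρ) hne
  refine ⟨κ, ?_, hκ, hmax⟩
  intro i j hij
  by_contra! hlt
  have hne : i ≠ j := by rintro rfl; exact lt_irrefl _ hlt
  have hw : weightSpace ρ (κ ∘ Equiv.swap i j) ≠ ⊥ := by
    intro h
    have h1 := finrank_weightSpace_perm ρ (Equiv.swap i j) κ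
    rw [h, finrank_bot] at h1
    exact hκ (Submodule.finrank_eq_zero.1 h1.symm)
  have h2 := hmax _ hw
  have h3 : heightPairing (κ ∘ Equiv.swap i j) - heightPairing κ =
      (((i.rev.1 : ℕ) : ℤ) - ((j.rev.1 : ℕ) : ℤ)) * (κ j - κ i) := by
    simp only [heightPairing]
    rw [← Finset.sum_sub_distrib, ← Finset.sum_subset (Finset.subset_univ {i, j}),
      Finset.sum_pair hne]
    · simp
      ring
    · intro k _ hk
      simp only [Finset.mem_insert, Finset.mem_singleton, not_or] at hk
      simp [Equiv.swap_apply_of_ne_of_ne hk.1 hk.2]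
  have h4 : ((j.rev.1 : ℕ) : ℤ) < ((i.rev.1 : ℕ) : ℤ) := by
    have : i.1 < j.1 := lt_of_le_of_ne hij fun h => hne (Fin.ext h)
    simp only [Fin.val_rev]
    have := j.2
    omega
  nlinarith

end

end GLRep

namespace GLRep

open Topology
open scoped ComplexOrder InnerProductSpace

/-! ### Complete reducibility -/

/-- A definite Hermitian form for which the adjoint of `g` is the conjugate transpose of `g`. -/
structure ContravariantForm {n : ℕ} {V : Type*} [AddCommGroup V] [Module ℂ V]
    (ρ : Representation ℂ (GL (Fin n) ℂ) V) where
  form : V →ₗ⋆[ℂ] V →ₗ[ℂ] ℂ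
  conj_form : ∀ x y, starRingEnd ℂ (form x y) = form y x
  definite : ∀ x, form x x = 0 → x = 0
  apply_form : ∀ g x y, form (ρ g x) y = form x (ρ (star g) y)
  isCompl : ∀ W : Submodule ℂ V, ∃ W' : Submodule ℂ V, (∀ x, x ∈ W' ↔ ∀ w ∈ W, form w x = 0) ∧
    IsCompl W W'

section

variable {n : ℕ} {V : Type*} [AddCommGroup V] [Module ℂ V]
  {ρ : Representation ℂ (GL (Fin n) ℂ) V}

theorem IsAlgebraic.nonempty_contravariantForm [FiniteDimensional ℂ V] (hρ : IsAlgebraic ρ) :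
    Nonempty (ContravariantForm ρ) := by
  obtain ⟨c, hc⟩ := hρ.exists_inner
  let _ : NormedAddCommGroup V := c.toNormedAddCommGroup
  let _ : InnerProductSpace ℂ V := InnerProductSpace.ofCore c.toCore
  refine ⟨{ form := innerₛₗ ℂ, conj_form := fun x y => inner_conj_symm y x,
            definite := fun x hx => inner_self_eq_zero.1 hx, apply_form := hc,
            isCompl := fun W => ⟨Wᗮ, fun x => Submodule.mem_orthogonal W x,
              Submodule.isCompl_orthogonal _⟩ }⟩

theorem star_transposeGL_isUpper {b : GL (Fin n) ℂ} (hb : IsUpper b.val) :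
    IsUpper (star (transposeGL b)).val := by
  intro i j hij
  change star (b.val i j) = 0
  rw [hb i j hij, star_zero]

theorem diagChar_star_transposeGL (κ : Fin n → ℤ) (b : GL (Fin n) ℂ) :
    starRingEnd ℂ (diagChar κ (star (transposeGL b))) = diagChar κ b := by
  rw [diagChar, map_prod]
  refine Finset.prod_congr rfl fun i _ => ?_
  change starRingEnd ℂ ((starRingEnd ℂ (b.val i i)) ^ κ i) = _
  rw [map_zpow₀, Complex.conj_conj]

/-- The adjoint of the lower triangular factor is the entrywise conjugate of `b`, again upper
triangular, so it acts on `m'` by a scalar. Thus the matrix coefficient is known on the big cell up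
to the single number `B.form m' m`. -/
theorem ContravariantForm.form_bigCell (B : ContravariantForm ρ) {κ κ' : Fin n → ℤ} {m m' : V}
    (hm : m ∈ hwSpace ρ κ) (hm' : m' ∈ hwSpace ρ κ') {b c : GL (Fin n) ℂ} (hb : IsUpper b.val)
    (hc : IsUpper c.val) :
    B.form m' (ρ (transposeGL b * c) m) = diagChar κ' b * diagChar κ c * B.form m' m := by
  rw [map_mul, Module.End.mul_apply, hm c hc, map_smul, map_smul]
  have h1 := B.apply_form (star (transposeGL b)) m' m
  rw [star_star, hm' _ (star_transposeGL_isUpper hb), LinearMap.map_smulₛₗ,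
    LinearMap.smul_apply, diagChar_star_transposeGL] at h1
  rw [← h1]
  simp only [smul_eq_mul]
  ring

theorem ContravariantForm.form_eq_zero (B : ContravariantForm ρ) (hρ : IsAlgebraic ρ)
    {κ κ' : Fin n → ℤ} {m m' : V} (hm : m ∈ hwSpace ρ κ) (hm' : m' ∈ hwSpace ρ κ')
    (h : B.form m' m = 0) (g : GL (Fin n) ℂ) : B.form m' (ρ g m) = 0 :=
  (hρ m (B.form m')).eq_zero_of_bigCell
    (fun b c hb hc => by rw [B.form_bigCell hm hm' hb hc, h, mul_zero]) g

/-- The vectors whose whole orbit is killed by `φ` form a subrepresentation, which contains `m`. -/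
theorem dual_eq_zero_of_isIrreducible (hirr : ρ.IsIrreducible) {m : V} (hm : m ≠ 0)
    {φ : Module.Dual ℂ V} (h : ∀ g, φ (ρ g m) = 0) : φ = 0 := by
  let S : Subrepresentation ρ :=
    { toSubmodule := ⨅ g, LinearMap.ker (φ ∘ₗ ρ g)
      apply_mem_toSubmodule := fun g x hx => by
        rw [Submodule.mem_iInf] at hx ⊢
        intro h
        have := hx (h * g)
        simpa using this }
  have hmS : m ∈ S.toSubmodule := by
    refine Submodule.mem_iInf _ |>.2 fun g => h g
  have htop : S = ⊤ := (hirr.eq_bot_or_eq_top S).resolve_left fun hS => hm (by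
    rw [hS] at hmS
    exact (Submodule.mem_bot ℂ).1 hmS)
  ext x
  have hx : x ∈ S.toSubmodule := by rw [htop]; exact Submodule.mem_top
  have := (Submodule.mem_iInf _).1 hx 1
  simpa using this

/-- In an irreducible algebraic representation, highest weight vectors have the same weight. -/
theorem IsAlgebraic.weight_unique [FiniteDimensional ℂ V] (hρ : IsAlgebraic ρ)
    (hirr : ρ.IsIrreducible) {κ κ' : Fin n → ℤ} {m m' : V} (hm : m ∈ hwSpace ρ κ)
    (hm' : m' ∈ hwSpace ρ κ') (hm0 : m ≠ 0) (hm0' : m' ≠ 0) :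
    κ = κ' ∧ ∃ a : ℂ, m' = a • m := by
  obtain ⟨B⟩ := hρ.nonempty_contravariantForm
  have key : ∀ {κ'} {m'}, m' ∈ hwSpace ρ κ' → m' ≠ 0 → B.form m' m ≠ 0 := by
    intro κ' m' hm' hm0' h
    have h1 := dual_eq_zero_of_isIrreducible hirr hm0 (B.form_eq_zero hρ hm hm' h)
    exact hm0' (B.definite m' (by rw [h1]; rfl))
  -- A torus element may be read as the lower or as the upper factor; the two big cell formulas give
  -- the two characters times the same nonzero number.
  have hκ : κ = κ' := by
    refine torusChar_injective n (MonoidHom.ext fun t => ?_)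
    have ht : IsUpper (torus t).val := diagonalSet_subset n (torus_mem t)
    have h1 := B.form_bigCell hm hm' (b := 1) (c := torus t) (fun i j hij => Matrix.one_apply_ne hij.ne') ht
    have h2 := B.form_bigCell hm hm' (c := 1) (b := torus t) ht (fun i j hij => Matrix.one_apply_ne hij.ne')
    have h3 : transposeGL (1 : GL (Fin n) ℂ) * torus t = transposeGL (torus t) * 1 := by
      rw [mul_one]
      ext i j
      simp +contextual [transposeGL, torus_val, Matrix.one_apply, Matrix.diagonal_apply]
    have h4 : ∀ κ : Fin n → ℤ, diagChar κ (1 : GL (Fin n) ℂ) = 1 := by intro κ; simp [diagChar]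
    rw [h3, h2] at h1
    simpa [h4, diagChar_torus, key hm' hm0', eq_comm] using h1
  subst hκ
  -- The coefficient of the orthogonal projection of `m'` to `m`: the difference is a highest weight
  -- vector orthogonal to `m`, hence zero by `key`.
  refine ⟨rfl, B.form m m' / B.form m m, ?_⟩
  by_contra hne
  have h1 := key (sub_mem hm' (Submodule.smul_mem _ (B.form m m' / B.form m m) hm)) (sub_ne_zero.2 hne)
  apply h1
  rw [← B.conj_form, map_sub, map_smul, smul_eq_mul, div_mul_cancel₀ _ (key hm hm0), sub_self,
    map_zero]

variable {κ : Fin n → ℤ}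

theorem HighestWeightIrrep.finrank_hwSpace (R : HighestWeightIrrep κ) (κ' : Fin n → ℤ) :
    Module.finrank ℂ (hwSpace R.rep κ') = if κ' = κ then 1 else 0 := by
  obtain ⟨v, hv0, hv⟩ := R.exists_highestWeightVector
  have hvm : v ∈ hwSpace R.rep κ := hv
  split_ifs with h
  · subst h
    refine finrank_eq_one ⟨v, hvm⟩ (fun h => hv0 (congrArg Subtype.val h)) fun w => ?_
    by_cases hw : w = 0
    · exact ⟨0, by rw [hw, zero_smul]⟩
    · obtain ⟨-, a, ha⟩ := R.isAlgebraic.weight_unique R.isIrreducible hvm w.2 hv0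
        (fun h => hw (Subtype.ext h))
      exact ⟨a, Subtype.ext ha.symm⟩
  · rw [Submodule.finrank_eq_zero, eq_bot_iff]
    intro w hw
    by_contra hw0
    exact h (R.isAlgebraic.weight_unique R.isIrreducible hvm hw hv0 hw0).1.symm

theorem HighestWeightIrrep.nontrivial (R : HighestWeightIrrep κ) : Nontrivial R.carrier := by
  obtain ⟨v, hv0, -⟩ := R.exists_highestWeightVector
  exact ⟨v, 0, hv0⟩

/-- A weight of maximal height is carried by highest weight vectors, and uniqueness of the highest
weight identifies it with `κ`. -/
theorem HighestWeightIrrep.maximal_weight (R : HighestWeightIrrep κ) :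
    (∀ κ', weightSpace R.rep κ' ≠ ⊥ → heightPairing κ' ≤ heightPairing κ) ∧ Antitone κ := by
  have := R.nontrivial
  obtain ⟨κ₀, h1, h2, h3⟩ := R.isAlgebraic.exists_maximal_weight
  have h4 := R.isAlgebraic.weightSpace_le_hwSpace h3
  have h5 : κ₀ = κ := by
    by_contra hne
    have h6 := R.finrank_hwSpace κ₀
    rw [if_neg hne, Submodule.finrank_eq_zero] at h6
    exact h2 (eq_bot_iff.2 (h6 ▸ h4))
  subst h5
  exact ⟨h3, h1⟩

theorem HighestWeightIrrep.finrank_weightSpace_self (R : HighestWeightIrrep κ) :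
    Module.finrank ℂ (weightSpace R.rep κ) = 1 := by
  have h : weightSpace R.rep κ = hwSpace R.rep κ :=
    le_antisymm (R.isAlgebraic.weightSpace_le_hwSpace R.maximal_weight.1) (hwSpace_le_weightSpace _ _)
  rw [h, R.finrank_hwSpace, if_pos rfl]

/-- A semi-invariant vector is the image of the highest weight vector of an irreducible
representation. -/
theorem HighestWeightIrrep.exists_intertwiningMap [FiniteDimensional ℂ V]
    (R : HighestWeightIrrep κ) {v : R.carrier} (hv0 : v ≠ 0) (hv : v ∈ hwSpace R.rep κ)
    (hρ : IsAlgebraic ρ) {m : V} (hm : m ∈ hwSpace ρ κ) :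
    ∃ φ : R.rep.IntertwiningMap ρ, φ v = m := by
  obtain ⟨B⟩ := R.isAlgebraic.nonempty_contravariantForm
  obtain ⟨C⟩ := hρ.nonempty_contravariantForm
  -- Both matrix coefficients are multiples of the same function on the big cell, so they are
  -- proportional everywhere.
  have hgram : ∀ g, C.form m m * B.form v (R.rep g v) = B.form v v * C.form m (ρ g m) := by
    intro g
    have h1 := (((IsRegular.const (C.form m m)).mul (R.isAlgebraic v (B.form v))).add
      (((IsRegular.const (-B.form v v))).mul (hρ m (C.form m)))).eq_zero_of_bigCell ?_ g
    · linear_combination h1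
    · intro b c hb hc
      rw [B.form_bigCell hv hv hb hc, C.form_bigCell hm hm hb hc]
      ring
  -- `T` and `U` send a group element to the translate of `v` and of `m`. Their Gram matrices are
  -- proportional with `B.form v v ≠ 0`, so definiteness gives that the kernel of `T` lies in that
  -- of `U`. As `v` generates, `U` factors through `T`, and the factor is the intertwining map.
  let T := Finsupp.linearCombination ℂ fun g => R.rep g v
  let U := Finsupp.linearCombination ℂ fun g => ρ g m
  have hTU : ∀ a b, C.form m m * B.form (T a) (T b) = B.form v v * C.form (U a) (U b) := by
    intro a b
    simp only [T, U, Finsupp.linearCombination_apply, Finsupp.sum, map_sum, LinearMap.sum_apply,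
      map_smul, LinearMap.map_smulₛₗ, LinearMap.smul_apply, Finset.mul_sum, smul_eq_mul]
    refine Finset.sum_congr rfl fun g _ => Finset.sum_congr rfl fun h _ => ?_
    rw [B.apply_form, C.apply_form, ← Module.End.mul_apply, ← Module.End.mul_apply, ← map_mul,
      ← map_mul]
    linear_combination b g * starRingEnd ℂ (a h) * hgram (star h * g)
  have hBv : B.form v v ≠ 0 := fun h => hv0 (B.definite v h)
  have hker : ∀ a, T a = 0 → U a = 0 := by
    intro a ha
    have h1 := hTU a a
    rw [ha] at h1
    simp only [map_zero, mul_zero] at h1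
    exact C.definite _ ((mul_eq_zero.1 h1.symm).resolve_left hBv)
  have hsurj : Function.Surjective T := by
    rw [← LinearMap.range_eq_top]
    by_contra hne
    obtain ⟨φ, hφ0, hφ⟩ := Submodule.exists_le_ker_of_lt_top _ (lt_top_iff_ne_top.2 hne)
    refine hφ0 (dual_eq_zero_of_isIrreducible R.isIrreducible hv0 fun g => ?_)
    exact hφ ⟨Finsupp.single g 1, by simp [T]⟩
  obtain ⟨s, hs⟩ := LinearMap.exists_rightInverse_of_surjective T (LinearMap.range_eq_top.2 hsurj)
  have hφ : ∀ a, U (s (T a)) = U a := by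
    intro a
    rw [← sub_eq_zero, ← map_sub]
    apply hker
    rw [map_sub, sub_eq_zero]
    exact LinearMap.congr_fun hs (T a)
  have hφg : ∀ g, U (s (R.rep g v)) = ρ g m := by
    intro g
    have := hφ (Finsupp.single g 1)
    simpa [T, U] using this
  refine ⟨⟨U ∘ₗ s, fun g => ?_⟩, ?_⟩
  · rw [← LinearMap.cancel_right hsurj]
    refine Finsupp.lhom_ext' fun h => LinearMap.ext_ring ?_
    simp only [LinearMap.comp_apply, Finsupp.lsingle_apply, T, Finsupp.linearCombination_single, one_smul]
    rw [hφg, ← Module.End.mul_apply, ← Module.End.mul_apply, ← map_mul, ← map_mul, hφg]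
  · have := hφg 1
    rw [map_one, map_one] at this
    exact this

/-- Evaluation at the highest weight vector is injective, since the kernel of an intertwining map is
a subrepresentation, and surjective by `exists_intertwiningMap`. -/
theorem HighestWeightIrrep.multiplicity_eq [FiniteDimensional ℂ V]
    (R : HighestWeightIrrep κ) (hρ : IsAlgebraic ρ) :
    multiplicity R.rep ρ = Module.finrank ℂ (hwSpace ρ κ) := by
  obtain ⟨v, hv0, hv⟩ := R.exists_highestWeightVector
  have hvm : v ∈ hwSpace R.rep κ := hv
  let E : R.rep.IntertwiningMap ρ →ₗ[ℂ] hwSpace ρ κ :=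
    { toFun := fun φ => ⟨φ v, fun b hb => by rw [← φ.isIntertwining, hvm b hb, map_smul]⟩
      map_add' := fun φ ψ => rfl
      map_smul' := fun a φ => rfl }
  refine LinearEquiv.finrank_eq (LinearEquiv.ofBijective E ⟨?_, ?_⟩)
  · rw [← LinearMap.ker_eq_bot, eq_bot_iff]
    intro φ hφ
    have h1 : φ v = 0 := congrArg Subtype.val hφ
    have h2 := (R.isIrreducible.eq_bot_or_eq_top φ.ker).resolve_left fun h => hv0 (by
      have h3 : v ∈ φ.ker := h1
      rw [h] at h3
      exact (Submodule.mem_bot ℂ).1 h3)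
    refine (Submodule.mem_bot ℂ).2 ?_
    refine Representation.IntertwiningMap.ext (LinearMap.ext fun x => ?_)
    have h3 : x ∈ φ.ker := by rw [h2]; exact Submodule.mem_top
    exact h3
  · intro m
    obtain ⟨φ, hφ⟩ := R.exists_intertwiningMap hv0 hvm hρ m.2
    exact ⟨φ, Subtype.ext hφ⟩

theorem IsAlgebraic.subrepresentation (hρ : IsAlgebraic ρ) (S : Subrepresentation ρ) :
    IsAlgebraic S.toRepresentation := by
  intro v φ
  obtain ⟨ψ, hψ⟩ := LinearMap.exists_extend φ
  have := hρ v ψ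
  convert this using 2 with g
  rw [← hψ]
  rfl

/-- Every finite-dimensional algebraic representation is a direct sum of irreducible ones. -/
theorem IsAlgebraic.exists_decomposition [FiniteDimensional ℂ V] (hρ : IsAlgebraic ρ) :
    ∃ s : Multiset (DominantWeight n), ∀ S χ, Module.finrank ℂ (semiInv ρ S χ) =
      (s.map fun ν => Module.finrank ℂ (semiInv (irrep ν).rep S χ)).sum := by
  induction h : Module.finrank ℂ V using Nat.strong_induction_on generalizing V with
  | _ d ih =>
  rcases subsingleton_or_nontrivial V with hV | hV
  · refine ⟨0, fun S χ => ?_⟩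
    simp [Module.finrank_zero_of_subsingleton]
  obtain ⟨κ, hκ, hne, hmax⟩ := hρ.exists_maximal_weight
  obtain ⟨m, hm, hm0⟩ := Submodule.exists_mem_ne_zero_of_ne_bot hne
  have hmw : m ∈ hwSpace ρ κ := hρ.weightSpace_le_hwSpace hmax hm
  let ν : DominantWeight n := ⟨κ, hκ⟩
  obtain ⟨v, hv0, hv⟩ := (irrep ν).exists_highestWeightVector
  obtain ⟨φ, hφ⟩ := (irrep ν).exists_intertwiningMap hv0 hv hρ hmw
  have hinj : Function.Injective φ := by
    have := (irrep ν).isIrreducible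
    refine (Representation.IsIrreducible.injective_or_eq_zero φ).resolve_right fun h => hm0 ?_
    rw [← hφ, h]
    rfl
  obtain ⟨B⟩ := hρ.nonempty_contravariantForm
  obtain ⟨W', hW', hcompl⟩ := B.isCompl (LinearMap.range φ.toLinearMap)
  -- The orthogonal complement of the image is stable because the adjoint of each group element
  -- again belongs to the group.
  let W : Subrepresentation ρ :=
    { toSubmodule := W'
      apply_mem_toSubmodule := fun g x hx => by
        rw [hW'] at hx ⊢
        rintro _ ⟨y, rfl⟩
        have h1 := B.apply_form (star g) (φ y) x
        rw [star_star] at h1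
        rw [Representation.IntertwiningMap.toLinearMap_apply, ← h1, ← φ.isIntertwining]
        exact hx _ ⟨_, rfl⟩ }
  let e : ((irrep ν).carrier × W.toSubmodule) ≃ₗ[ℂ] V :=
    ((LinearEquiv.ofInjective φ.toLinearMap hinj).prodCongr (LinearEquiv.refl ℂ _)).trans
      (Submodule.prodEquivOfIsCompl _ _ hcompl)
  have he : ∀ g x, e (((irrep ν).rep.prod W.toRepresentation) g x) = ρ g (e x) := by
    rintro g ⟨x, y⟩
    change φ ((irrep ν).rep g x) + ρ g y.1 = ρ g (φ x + y.1)
    rw [φ.isIntertwining, map_add]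
  have hdim := e.finrank_eq
  rw [Module.finrank_prod] at hdim
  have hpos : 0 < Module.finrank ℂ (irrep ν).carrier := by
    have := (irrep ν).nontrivial
    exact Module.finrank_pos
  obtain ⟨s, hs⟩ := ih (Module.finrank ℂ W.toSubmodule) (by omega) (hρ.subrepresentation W) rfl
  refine ⟨ν ::ₘ s, fun S χ => ?_⟩
  rw [Multiset.map_cons, Multiset.sum_cons, ← hs, ← finrank_semiInv_prod]
  exact (finrank_semiInv_congr e he S χ).symm

/-- Each irreducible summand has one line of highest weight vectors, so counting those of weight `ν`
reads off the multiplicity of `ν` in a decomposition. -/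
theorem sum_map_finrank_hwSpace (s : Multiset (DominantWeight n)) (ν : DominantWeight n) :
    (s.map fun ν' => Module.finrank ℂ (hwSpace (irrep ν').rep ν.1)).sum = s.count ν := by
  classical
  induction s using Multiset.induction_on with
  | empty => simp
  | cons a s ih =>
    rw [Multiset.map_cons, Multiset.sum_cons, ih, (irrep a).finrank_hwSpace, Multiset.count_cons,
      add_comm]
    congr 1
    exact if_congr Subtype.ext_iff.symm rfl rfl

end

end GLRep

namespace GLRep

open Topology

/-! ### Polynomial functions on rectangular matrices -/

/-! ### Commuting group actions -/

section Commuting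

variable {G H V : Type*} [Group G] [Group H] [AddCommGroup V] [Module ℂ V]

/-- The representation of `H` on the semi-invariants of a commuting representation of `G`. -/
def semiInvRep (ρ : Representation ℂ G V) (σ : Representation ℂ H V)
    (hcomm : ∀ g h x, ρ g (σ h x) = σ h (ρ g x)) (S : Set G) (χ : G → ℂ) :
    Representation ℂ H (semiInv ρ S χ) :=
  Subrepresentation.toRepresentation (ρ := σ)
    { toSubmodule := semiInv ρ S χ
      apply_mem_toSubmodule := fun h x hx b hb => by rw [hcomm, hx b hb, map_smul] }

theorem finrank_semiInv_semiInvRep (ρ : Representation ℂ G V) (σ : Representation ℂ H V)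
    (hcomm : ∀ g h x, ρ g (σ h x) = σ h (ρ g x)) (S : Set G) (χ : G → ℂ) (S' : Set H)
    (χ' : H → ℂ) :
    Module.finrank ℂ (semiInv (semiInvRep ρ σ hcomm S χ) S' χ') =
      Module.finrank ℂ (semiInv ρ S χ ⊓ semiInv σ S' χ' : Submodule ℂ V) := by
  have : (semiInv (semiInvRep ρ σ hcomm S χ) S' χ').map (semiInv ρ S χ).subtype =
      semiInv ρ S χ ⊓ semiInv σ S' χ' := by
    ext x
    constructor
    · rintro ⟨y, hy, rfl⟩
      exact ⟨y.2, fun b hb => congrArg Subtype.val (hy b hb)⟩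
    · rintro ⟨h1, h2⟩
      exact ⟨⟨x, h1⟩, fun b hb => Subtype.ext (h2 b hb), rfl⟩
  rw [← this]
  exact (LinearEquiv.finrank_eq (Submodule.equivMapOfInjective _ (semiInv ρ S χ).injective_subtype _))

end Commuting

/-! ### The two commuting actions on polynomials in the matrix entries -/

section MatrixPolynomials

variable {r n : ℕ}

/-- Evaluation of a polynomial at a matrix. -/
noncomputable def evalMatrix (M : Matrix (Fin r) (Fin n) ℂ) (f : MvPolynomial (Fin r × Fin n) ℂ) : ℂ :=
  MvPolynomial.eval (fun ij => M ij.1 ij.2) f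

theorem ext_evalMatrix {f g : MvPolynomial (Fin r × Fin n) ℂ}
    (h : ∀ M, evalMatrix M f = evalMatrix M g) : f = g :=
  MvPolynomial.funext fun x => h (Matrix.of fun i j => x (i, j))

/-- The substitution `f(x) ↦ f(aᵀ x b)`. -/
noncomputable def biAct (a : Matrix (Fin r) (Fin r) ℂ) (b : Matrix (Fin n) (Fin n) ℂ) :
    MvPolynomial (Fin r × Fin n) ℂ →ₐ[ℂ] MvPolynomial (Fin r × Fin n) ℂ :=
  MvPolynomial.aeval fun ij => ∑ l, (∑ k, MvPolynomial.C (a k ij.1) * MvPolynomial.X (k, l)) *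
    MvPolynomial.C (b l ij.2)

theorem evalMatrix_biAct (a : Matrix (Fin r) (Fin r) ℂ) (b : Matrix (Fin n) (Fin n) ℂ)
    (M : Matrix (Fin r) (Fin n) ℂ) (f : MvPolynomial (Fin r × Fin n) ℂ) :
    evalMatrix M (biAct a b f) = evalMatrix (a.transpose * M * b) f := by
  rw [evalMatrix, biAct, MvPolynomial.aeval_def, MvPolynomial.eval, MvPolynomial.coe_eval₂Hom,
    ← MvPolynomial.coe_eval₂Hom, MvPolynomial.hom_eval₂, evalMatrix, MvPolynomial.eval,
    MvPolynomial.coe_eval₂Hom]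
  congr 1
  · ext; simp
  · funext ij; simp [Matrix.mul_apply]

/-- The action of `GL_n` on polynomials on `r × n` matrices by `f(x) ↦ f(x h)`. -/
noncomputable def rightAct (r n : ℕ) :
    Representation ℂ (GL (Fin n) ℂ) (MvPolynomial (Fin r × Fin n) ℂ) where
  toFun h := (biAct 1 h.val).toLinearMap
  map_one' := by
    refine LinearMap.ext fun f => ext_evalMatrix fun M => ?_
    simp [evalMatrix_biAct]
  map_mul' g h := by
    refine LinearMap.ext fun f => ext_evalMatrix fun M => ?_
    simp [evalMatrix_biAct, Matrix.mul_assoc]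

/-- The action of `GL_r` on polynomials on `r × n` matrices by `f(x) ↦ f(gᵀ x)`. -/
noncomputable def leftAct (r n : ℕ) :
    Representation ℂ (GL (Fin r) ℂ) (MvPolynomial (Fin r × Fin n) ℂ) where
  toFun h := (biAct h.val 1).toLinearMap
  map_one' := by
    refine LinearMap.ext fun f => ext_evalMatrix fun M => ?_
    simp [evalMatrix_biAct]
  map_mul' g h := by
    refine LinearMap.ext fun f => ext_evalMatrix fun M => ?_
    simp [evalMatrix_biAct, Matrix.mul_assoc]

theorem rightAct_apply (h : GL (Fin n) ℂ) (f : MvPolynomial (Fin r × Fin n) ℂ) :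
    rightAct r n h f = biAct 1 h.val f := rfl

theorem leftAct_apply (h : GL (Fin r) ℂ) (f : MvPolynomial (Fin r × Fin n) ℂ) :
    leftAct r n h f = biAct h.val 1 f := rfl

theorem leftAct_rightAct_comm (g : GL (Fin r) ℂ) (h : GL (Fin n) ℂ)
    (f : MvPolynomial (Fin r × Fin n) ℂ) :
    leftAct r n g (rightAct r n h f) = rightAct r n h (leftAct r n g f) := by
  refine ext_evalMatrix fun M => ?_
  simp [rightAct_apply, leftAct_apply, evalMatrix_biAct, Matrix.mul_assoc]

theorem rightAct_leftAct_comm (h : GL (Fin n) ℂ) (g : GL (Fin r) ℂ)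
    (f : MvPolynomial (Fin r × Fin n) ℂ) :
    rightAct r n h (leftAct r n g f) = leftAct r n g (rightAct r n h f) :=
  (leftAct_rightAct_comm g h f).symm

theorem coeff_aeval_C_mul_X {σ : Type*} (c : σ → ℂ) (f : MvPolynomial σ ℂ) (A : σ →₀ ℕ) :
    (MvPolynomial.aeval (fun i => MvPolynomial.C (c i) * MvPolynomial.X i) f).coeff A =
      (A.prod fun i k => c i ^ k) * f.coeff A := by
  classical
  induction f using MvPolynomial.induction_on' with
  | monomial B a =>
    rw [MvPolynomial.aeval_monomial, Finsupp.prod]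
    simp only [mul_pow, Finset.prod_mul_distrib, ← map_pow, ← map_prod]
    have : ∏ i ∈ B.support, (MvPolynomial.X i : MvPolynomial σ ℂ) ^ B i = MvPolynomial.monomial B 1 := by
      rw [MvPolynomial.monomial_eq]
      simp [Finsupp.prod]
    rw [this, MvPolynomial.algebraMap_eq, MvPolynomial.coeff_C_mul, MvPolynomial.coeff_C_mul,
      MvPolynomial.coeff_monomial, MvPolynomial.coeff_monomial]
    split_ifs with h
    · subst h
      simp [Finsupp.prod, mul_comm]
    · simp
  | add p q hp hq => rw [map_add, MvPolynomial.coeff_add, hp, hq, MvPolynomial.coeff_add, mul_add]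

/-- Row sums of an exponent. -/
def rowSum (A : (Fin r × Fin n) →₀ ℕ) (i : Fin r) : ℤ := ∑ j, (A (i, j) : ℤ)

/-- Column sums of an exponent. -/
def colSum (A : (Fin r × Fin n) →₀ ℕ) (j : Fin n) : ℤ := ∑ i, (A (i, j) : ℤ)

theorem coeff_leftAct_torus (t : Fin r → ℂˣ) (f : MvPolynomial (Fin r × Fin n) ℂ)
    (A : (Fin r × Fin n) →₀ ℕ) :
    (leftAct r n (torus t) f).coeff A = torusChar (rowSum A) t * f.coeff A := by
  have : biAct (torus t).val 1 = MvPolynomial.aeval fun ij : Fin r × Fin n =>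
      MvPolynomial.C (t ij.1 : ℂ) * MvPolynomial.X ij := by
    refine MvPolynomial.algHom_ext fun ij => ?_
    simp [biAct, torus_val, Matrix.diagonal_apply, Matrix.one_apply, apply_ite MvPolynomial.C]
  rw [leftAct_apply, this, coeff_aeval_C_mul_X, Finsupp.prod_fintype _ _ (by simp),
    Fintype.prod_prod_type, torusChar_apply]
  congr 1
  refine Finset.prod_congr rfl fun i _ => ?_
  change ∏ j, (t i : ℂ) ^ A (i, j) = _
  rw [rowSum, Finset.prod_pow_eq_pow_sum, ← zpow_natCast]
  push_cast
  rfl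

theorem coeff_rightAct_torus (t : Fin n → ℂˣ) (f : MvPolynomial (Fin r × Fin n) ℂ)
    (A : (Fin r × Fin n) →₀ ℕ) :
    (rightAct r n (torus t) f).coeff A = torusChar (colSum A) t * f.coeff A := by
  have : biAct 1 (torus t).val = MvPolynomial.aeval fun ij : Fin r × Fin n =>
      MvPolynomial.C (t ij.2 : ℂ) * MvPolynomial.X ij := by
    refine MvPolynomial.algHom_ext fun ij => ?_
    simp [biAct, torus_val, Matrix.diagonal_apply, Matrix.one_apply, apply_ite MvPolynomial.C,
      mul_comm]
  rw [rightAct_apply, this, coeff_aeval_C_mul_X, Finsupp.prod_fintype _ _ (by simp),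
    Fintype.prod_prod_type_right, torusChar_apply]
  congr 1
  refine Finset.prod_congr rfl fun i _ => ?_
  change ∏ j, (t i : ℂ) ^ A (j, i) = _
  rw [colSum, Finset.prod_pow_eq_pow_sum, ← zpow_natCast]
  push_cast
  rfl

/-- Monomials are eigenvectors of the torus with weight their row degrees. Dimensions of weight
spaces thereby become counts of exponents. -/
theorem weightSpace_leftAct (α : Fin r → ℤ) :
    weightSpace (leftAct r n) α = MvPolynomial.restrictSupport ℂ {A | rowSum A = α} := by
  ext f
  rw [mem_weightSpace, MvPolynomial.mem_restrictSupport_iff]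
  constructor
  · intro h A hA
    refine torusChar_injective r (MonoidHom.ext fun t => ?_)
    have h1 := congrArg (MvPolynomial.coeff A) (h t)
    rw [coeff_leftAct_torus, MvPolynomial.coeff_smul, smul_eq_mul] at h1
    exact mul_right_cancel₀ (MvPolynomial.mem_support_iff.1 hA) h1
  · intro h t
    ext A
    rw [coeff_leftAct_torus, MvPolynomial.coeff_smul, smul_eq_mul]
    by_cases hA : f.coeff A = 0
    · rw [hA, mul_zero, mul_zero]
    · rw [show rowSum A = α from h (MvPolynomial.mem_support_iff.2 hA)]

theorem weightSpace_rightAct (β : Fin n → ℤ) :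
    weightSpace (rightAct r n) β = MvPolynomial.restrictSupport ℂ {A | colSum A = β} := by
  ext f
  rw [mem_weightSpace, MvPolynomial.mem_restrictSupport_iff]
  constructor
  · intro h A hA
    refine torusChar_injective n (MonoidHom.ext fun t => ?_)
    have h1 := congrArg (MvPolynomial.coeff A) (h t)
    rw [coeff_rightAct_torus, MvPolynomial.coeff_smul, smul_eq_mul] at h1
    exact mul_right_cancel₀ (MvPolynomial.mem_support_iff.1 hA) h1
  · intro h t
    ext A
    rw [coeff_rightAct_torus, MvPolynomial.coeff_smul, smul_eq_mul]
    by_cases hA : f.coeff A = 0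
    · rw [hA, mul_zero, mul_zero]
    · rw [show colSum A = β from h (MvPolynomial.mem_support_iff.2 hA)]

theorem finite_rowSum (α : Fin r → ℤ) : {A : (Fin r × Fin n) →₀ ℕ | rowSum A = α}.Finite := by
  refine (Set.finite_Iic (Finsupp.equivFunOnFinite.symm fun ij : Fin r × Fin n =>
    (α ij.1).toNat)).subset fun A hA ij => ?_
  have h1 : rowSum A ij.1 = α ij.1 := congrFun hA ij.1
  have h2 : (A ij : ℤ) ≤ rowSum A ij.1 :=
    Finset.single_le_sum (f := fun j => (A (ij.1, j) : ℤ)) (fun _ _ => by positivity)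
      (Finset.mem_univ ij.2)
  simp only [Finsupp.equivFunOnFinite_symm_apply_apply]
  omega

theorem finite_colSum (β : Fin n → ℤ) : {A : (Fin r × Fin n) →₀ ℕ | colSum A = β}.Finite := by
  refine (Set.finite_Iic (Finsupp.equivFunOnFinite.symm fun ij : Fin r × Fin n =>
    (β ij.2).toNat)).subset fun A hA ij => ?_
  have h1 : colSum A ij.2 = β ij.2 := congrFun hA ij.2
  have h2 : (A ij : ℤ) ≤ colSum A ij.2 :=
    Finset.single_le_sum (f := fun i => (A (i, ij.2) : ℤ)) (fun _ _ => by positivity)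
      (Finset.mem_univ ij.1)
  simp only [Finsupp.equivFunOnFinite_symm_apply_apply]
  omega

theorem finiteDimensional_restrictSupport {σ : Type*} {s : Set (σ →₀ ℕ)} (hs : s.Finite) :
    FiniteDimensional ℂ (MvPolynomial.restrictSupport ℂ s) := by
  have := hs.to_subtype
  exact Module.Finite.of_basis (MvPolynomial.basisRestrictSupport ℂ s)

theorem finrank_restrictSupport {σ : Type*} (s : Set (σ →₀ ℕ)) :
    Module.finrank ℂ (MvPolynomial.restrictSupport ℂ s) = Nat.card s :=
  Module.finrank_eq_nat_card_basis (MvPolynomial.basisRestrictSupport ℂ s)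

instance finiteDimensional_weightSpace_leftAct (α : Fin r → ℤ) :
    FiniteDimensional ℂ (weightSpace (leftAct r n) α) := by
  rw [weightSpace_leftAct]
  exact finiteDimensional_restrictSupport (finite_rowSum α)

instance finiteDimensional_hwSpace_rightAct (β : Fin n → ℤ) :
    FiniteDimensional ℂ (hwSpace (rightAct r n) β) := by
  have : FiniteDimensional ℂ (weightSpace (rightAct r n) β) := by
    rw [weightSpace_rightAct]
    exact finiteDimensional_restrictSupport (finite_colSum β)
  exact Submodule.finiteDimensional_of_le (hwSpace_le_weightSpace _ _)

/-- A family of polynomials whose coefficients depend regularly on the parameter. -/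
def RegularCoeff {m : ℕ} {σ : Type*} (F : GL (Fin m) ℂ → MvPolynomial σ ℂ) : Prop :=
  ∀ A, IsRegular fun g => (F g).coeff A

section RegularCoeff

variable {m : ℕ} {σ : Type*} {F F' : GL (Fin m) ℂ → MvPolynomial σ ℂ}

theorem RegularCoeff.const (f : MvPolynomial σ ℂ) : RegularCoeff fun _ : GL (Fin m) ℂ => f :=
  fun A => IsRegular.const (f.coeff A)

theorem RegularCoeff.C {f : GL (Fin m) ℂ → ℂ} (hf : IsRegular f) :
    RegularCoeff (σ := σ) fun g => MvPolynomial.C (f g) := by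
  classical
  intro A
  simp only [MvPolynomial.coeff_C]
  split_ifs
  · exact hf
  · exact IsRegular.const 0

theorem RegularCoeff.add (hF : RegularCoeff F) (hF' : RegularCoeff F') :
    RegularCoeff fun g => F g + F' g := fun A => by
  simp only [MvPolynomial.coeff_add]
  exact (hF A).add (hF' A)

theorem RegularCoeff.mul (hF : RegularCoeff F) (hF' : RegularCoeff F') :
    RegularCoeff fun g => F g * F' g := fun A => by
  classical
  simp only [MvPolynomial.coeff_mul]
  exact IsRegular.sum _ fun _ _ => (hF _).mul (hF' _)

theorem RegularCoeff.sum {ι : Type*} {s : Finset ι} {F : ι → GL (Fin m) ℂ → MvPolynomial σ ℂ}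
    (hF : ∀ i ∈ s, RegularCoeff (F i)) : RegularCoeff fun g => ∑ i ∈ s, F i g := fun A => by
  simp only [MvPolynomial.coeff_sum]
  exact IsRegular.sum _ fun i hi => hF i hi A

theorem RegularCoeff.aeval {τ : Type*} {F : GL (Fin m) ℂ → τ → MvPolynomial σ ℂ}
    (hF : ∀ i, RegularCoeff fun g => F g i) (f : MvPolynomial τ ℂ) :
    RegularCoeff fun g => MvPolynomial.aeval (F g) f := by
  induction f using MvPolynomial.induction_on with
  | C a =>
    simp only [MvPolynomial.aeval_C]
    exact RegularCoeff.const _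
  | add p q hp hq =>
    simp only [map_add]
    exact hp.add hq
  | mul_X p i hp =>
    simp only [map_mul, MvPolynomial.aeval_X]
    exact hp.mul (hF i)

/-- A functional on `U` extends to all polynomials, and on `U` it is a fixed linear combination of
the finitely many coefficients indexed by `s`. -/
theorem RegularCoeff.isRegular_apply {U : Submodule ℂ (MvPolynomial σ ℂ)} {s : Set (σ →₀ ℕ)}
    (hs : s.Finite) (hU : U ≤ MvPolynomial.restrictSupport ℂ s) {F : GL (Fin m) ℂ → U}
    (hF : RegularCoeff fun g => (F g : MvPolynomial σ ℂ)) (φ : Module.Dual ℂ U) :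
    IsRegular fun g => φ (F g) := by
  obtain ⟨ψ, hψ⟩ := LinearMap.exists_extend φ
  have : ∀ g, φ (F g) = ∑ A ∈ hs.toFinset,
      (F g : MvPolynomial σ ℂ).coeff A * ψ (MvPolynomial.monomial A 1) := by
    intro g
    have h1 : φ (F g) = ψ (F g : MvPolynomial σ ℂ) := by rw [← hψ]; rfl
    have h2 : (F g : MvPolynomial σ ℂ) = ∑ A ∈ hs.toFinset,
        (F g : MvPolynomial σ ℂ).coeff A • MvPolynomial.monomial A 1 := by
      conv_lhs => rw [(F g : MvPolynomial σ ℂ).as_sum]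
      refine (Finset.sum_subset (fun A hA => ?_) fun A _ hA => ?_).trans
        (Finset.sum_congr rfl fun A _ => by rw [MvPolynomial.smul_monomial, smul_eq_mul, mul_one])
      · exact hs.mem_toFinset.2 (hU (F g).2 hA)
      · rw [MvPolynomial.notMem_support_iff.1 hA, map_zero]
    rw [h1]
    conv_lhs => rw [h2]
    simp
  simp only [this]
  exact IsRegular.sum _ fun A _ => (hF A).mul (IsRegular.const _)

end RegularCoeff

theorem regularCoeff_rightAct (f : MvPolynomial (Fin r × Fin n) ℂ) :
    RegularCoeff fun g => rightAct r n g f :=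
  RegularCoeff.aeval (fun _ => RegularCoeff.sum fun _ _ => (RegularCoeff.const _).mul
    (RegularCoeff.C (IsRegular.entry _ _))) f

theorem regularCoeff_leftAct (f : MvPolynomial (Fin r × Fin n) ℂ) :
    RegularCoeff fun g => leftAct r n g f :=
  RegularCoeff.aeval (fun _ => RegularCoeff.sum fun _ _ => (RegularCoeff.sum fun _ _ =>
    (RegularCoeff.C (IsRegular.entry _ _)).mul (RegularCoeff.const _)).mul (RegularCoeff.const _)) f

/-- The representation of `GL_n` on the polynomials with given row degrees. -/
noncomputable abbrev rowRep (n : ℕ) (α : Fin r → ℤ) :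
    Representation ℂ (GL (Fin n) ℂ) (weightSpace (leftAct r n) α) :=
  semiInvRep (leftAct r n) (rightAct r n) leftAct_rightAct_comm (diagonalSet r) (diagChar α)

/-- The representation of `GL_r` on the highest weight polynomials for `GL_n`. -/
noncomputable abbrev hwRep (r : ℕ) (ν : Fin n → ℤ) :
    Representation ℂ (GL (Fin r) ℂ) (hwSpace (rightAct r n) ν) :=
  semiInvRep (rightAct r n) (leftAct r n) rightAct_leftAct_comm (borelSet n) (diagChar ν)

theorem rowRep_isAlgebraic (α : Fin r → ℤ) : IsAlgebraic (rowRep n α) := fun v φ =>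
  RegularCoeff.isRegular_apply (F := fun g => rowRep n α g v) (finite_rowSum α)
    (weightSpace_leftAct α).le (regularCoeff_rightAct v.1) φ

theorem hwRep_isAlgebraic (ν : Fin n → ℤ) : IsAlgebraic (hwRep r ν) := fun v φ =>
  RegularCoeff.isRegular_apply (F := fun g => hwRep r ν g v) (finite_colSum ν)
    ((hwSpace_le_weightSpace _ _).trans (weightSpace_rightAct ν).le) (regularCoeff_leftAct v.1) φ

end MatrixPolynomials

end GLRep

namespace GLRep

open Topology

/-! ### Duality between `GL_r` and `GL_n` -/

section

variable {r n : ℕ}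

theorem prod_extendByZero {M : Type*} [CommMonoid M] (hrn : r ≤ n) (κ : Fin r → ℤ)
    (F : Fin n → ℤ → M) (hF : ∀ i, F i 0 = 1) :
    ∏ i, F i (extendByZero n κ i) = ∏ i, F (Fin.castLE hrn i) (κ i) := by
  obtain ⟨k, rfl⟩ := Nat.exists_eq_add_of_le hrn
  rw [Fin.prod_univ_add]
  simp only [extendByZero, Fin.val_castAdd, Fin.is_lt, dite_true, Fin.val_natAdd]
  rw [Finset.prod_eq_one (s := Finset.univ) (f := fun i : Fin k => _), mul_one]
  · rfl
  · intro i _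
    rw [dif_neg (by omega), hF]

theorem extendByZero_castLE (hrn : r ≤ n) (κ : Fin r → ℤ) (i : Fin r) :
    extendByZero n κ (Fin.castLE hrn i) = κ i := by
  simp [extendByZero]

theorem extendByZero_injective (hrn : r ≤ n) : Function.Injective (extendByZero (r := r) n) := by
  intro κ κ' h
  funext i
  rw [← extendByZero_castLE hrn κ, h, extendByZero_castLE]

theorem antitone_extendByZero {κ : Fin r → ℤ} (hκ : Antitone κ) (h0 : ∀ i, 0 ≤ κ i) :
    Antitone (extendByZero n κ) := by
  intro i j hij
  unfold extendByZero
  split_ifs with h1 h2 h2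
  · exact hκ (show (⟨i.1, _⟩ : Fin r) ≤ ⟨j.1, _⟩ from hij)
  · exact absurd (lt_of_le_of_lt (show i.1 ≤ j.1 from hij) h1) h2
  · exact h0 _
  · exact le_rfl

theorem evalMatrix_hw (f : MvPolynomial (Fin r × Fin n) ℂ) {κ : Fin r → ℤ} {ν : Fin n → ℤ}
    (hr : f ∈ hwSpace (rightAct r n) ν) (hl : f ∈ hwSpace (leftAct r n) κ)
    {b : GL (Fin r) ℂ} {c : GL (Fin n) ℂ} (hb : IsUpper b.val) (hc : IsUpper c.val)
    (M : Matrix (Fin r) (Fin n) ℂ) :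
    evalMatrix (b.val.transpose * M * c.val) f = diagChar κ b * diagChar ν c * evalMatrix M f := by
  have h1 : ∀ M, evalMatrix (b.val.transpose * M) f = diagChar κ b * evalMatrix M f := by
    intro M
    have := congrArg (evalMatrix M) (hl b hb)
    rw [leftAct_apply, evalMatrix_biAct, Matrix.mul_one] at this
    rw [this]
    simp [evalMatrix]
  have h2 : ∀ M, evalMatrix (M * c.val) f = diagChar ν c * evalMatrix M f := by
    intro M
    have := congrArg (evalMatrix M) (hr c hc)
    rw [rightAct_apply, evalMatrix_biAct, Matrix.transpose_one, Matrix.one_mul] at this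
    rw [this]
    simp [evalMatrix]
  rw [Matrix.mul_assoc, h1, h2, mul_assoc]

/-- A joint highest weight polynomial is known, up to its value at (1 | 0), on the orbit of that
point under both triangular groups, and this orbit is dense enough by `eq_zero_of_bigCell`. -/
theorem hw_eq_zero (hrn : r ≤ n) {f : MvPolynomial (Fin r × Fin n) ℂ} {κ : Fin r → ℤ}
    {ν : Fin n → ℤ} (hr : f ∈ hwSpace (rightAct r n) ν) (hl : f ∈ hwSpace (leftAct r n) κ)
    (h0 : evalMatrix (partialOne r n) f = 0) : f = 0 :=
  eq_zero_of_bigCell hrn fun b c hb hc => by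
    have := evalMatrix_hw f hr hl hb hc (partialOne r n)
    rw [h0, mul_zero] at this
    exact this

/-- The point (1 | 0) is fixed by pairs of torus elements that are inverse to each other in the
first `r` entries. The value there is nonzero, so the two characters cancel on these pairs.
Nonnegativity holds because `κ` consists of row degrees of a monomial. -/
theorem hw_weights (hrn : r ≤ n) {f : MvPolynomial (Fin r × Fin n) ℂ} {κ : Fin r → ℤ}
    {ν : Fin n → ℤ} (hr : f ∈ hwSpace (rightAct r n) ν) (hl : f ∈ hwSpace (leftAct r n) κ)
    (h0 : f ≠ 0) : ν = extendByZero n κ ∧ ∀ i, 0 ≤ κ i := by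
  constructor
  · refine torusChar_injective n (MonoidHom.ext fun t => ?_)
    -- The choice for which `(s, t)` stabilises (1 | 0).
    let s : Fin r → ℂˣ := fun i => (t (Fin.castLE hrn i))⁻¹
    have h1 := evalMatrix_hw f hr hl (diagonalSet_subset r (torus_mem s))
      (diagonalSet_subset n (torus_mem t)) (partialOne r n)
    have h2 : (torus s).val.transpose * partialOne r n * (torus t).val = partialOne r n := by
      ext i j
      rw [torus_val, torus_val, Matrix.diagonal_transpose, Matrix.mul_diagonal, Matrix.diagonal_mul]
      by_cases h : i.1 = j.1
      · have : Fin.castLE hrn i = j := Fin.ext h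
        simp [partialOne, h, s, this]
      · simp [partialOne, h]
    have h3 : evalMatrix (partialOne r n) f ≠ 0 := fun h => h0 (hw_eq_zero hrn hr hl h)
    rw [h2, diagChar_torus, diagChar_torus] at h1
    have h4 : torusChar κ s * torusChar ν t = 1 :=
      mul_right_cancel₀ h3 (by rw [one_mul]; exact h1.symm)
    have h5 : torusChar κ s * torusChar (extendByZero n κ) t = 1 := by
      rw [torusChar_apply (extendByZero n κ),
        prod_extendByZero hrn κ (fun i k => (t i : ℂ) ^ k) (fun i => zpow_zero _), torusChar_apply,
        ← Finset.prod_mul_distrib]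
      refine Finset.prod_eq_one fun i _ => ?_
      rw [← mul_zpow]
      simp [s]
    exact mul_left_cancel₀ (left_ne_zero_of_mul_eq_one h4) (h4.trans h5.symm)
  · intro i
    obtain ⟨A, hA⟩ := MvPolynomial.ne_zero_iff.1 h0
    have h1 := hwSpace_le_weightSpace _ _ hl
    rw [weightSpace_leftAct] at h1
    have h2 : rowSum A = κ := h1 (MvPolynomial.mem_support_iff.2 hA)
    rw [← h2]
    exact Finset.sum_nonneg fun _ _ => by positivity

/-- The left `r × r` block of the generic matrix. -/
noncomputable def genericBlock (hrn : r ≤ n) :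
    Matrix (Fin r) (Fin r) (MvPolynomial (Fin r × Fin n) ℂ) :=
  Matrix.of fun i j => MvPolynomial.X (i, Fin.castLE hrn j)

/-- The product of principal minors of highest weight `κ`. -/
noncomputable def minorProduct (hrn : r ≤ n) (κ : Fin r → ℤ) : MvPolynomial (Fin r × Fin n) ℂ :=
  ∏ t ∈ Finset.range (∑ i, (κ i).toNat),
    ((genericBlock hrn).toSquareBlockProp fun j => (t : ℤ) < κ j).det

theorem evalMatrix_minorProduct (hrn : r ≤ n) (κ : Fin r → ℤ) (M : Matrix (Fin r) (Fin n) ℂ) :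
    evalMatrix M (minorProduct hrn κ) = ∏ t ∈ Finset.range (∑ i, (κ i).toNat),
      ((M.submatrix id (Fin.castLE hrn)).toSquareBlockProp fun j => (t : ℤ) < κ j).det := by
  rw [evalMatrix, minorProduct, map_prod]
  refine Finset.prod_congr rfl fun t _ => ?_
  rw [RingHom.map_det]
  congr 1
  ext i j
  simp [genericBlock, Matrix.toSquareBlockProp_def]

/-- The diagonal entry `b i i` occurs once for each `t < κ i`. The range is only an upper bound for
these `t`; beyond the largest entry of `κ` the minors are empty and equal to 1. -/
theorem prod_minor_mul_upper {κ : Fin r → ℤ} (hκ : Antitone κ) (h0 : ∀ i, 0 ≤ κ i)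
    (x b : Matrix (Fin r) (Fin r) ℂ) (hb : IsUpper b) :
    (∏ t ∈ Finset.range (∑ i, (κ i).toNat), ((x * b).toSquareBlockProp fun j => (t : ℤ) < κ j).det) =
    (∏ i, b i i ^ κ i) * ∏ t ∈ Finset.range (∑ i, (κ i).toNat),
      (x.toSquareBlockProp fun j => (t : ℤ) < κ j).det := by
  rw [Finset.prod_congr rfl fun t _ => minor_mul_upper
    (fun i j hij hi => lt_of_lt_of_le hi (hκ hij)) x b hb, Finset.prod_mul_distrib,
    Finset.prod_comm]
  congr 1
  refine Finset.prod_congr rfl fun i _ => ?_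
  rw [Finset.prod_ite, Finset.prod_const_one, mul_one, Finset.prod_const]
  have hi : (κ i).toNat ≤ ∑ i, (κ i).toNat :=
    Finset.single_le_sum (f := fun i => (κ i).toNat) (fun _ _ => Nat.zero_le _) (Finset.mem_univ i)
  have : (Finset.range (∑ i, (κ i).toNat)).filter (fun t : ℕ => (t : ℤ) < κ i)
      = Finset.range (κ i).toNat := by
    ext t
    have := h0 i
    simp only [Finset.mem_filter, Finset.mem_range]
    omega
  rw [this, Finset.card_range, ← zpow_natCast, Int.toNat_of_nonneg (h0 i)]

theorem minorProduct_mem (hrn : r ≤ n) {κ : Fin r → ℤ} (hκ : Antitone κ) (h0 : ∀ i, 0 ≤ κ i) :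
    minorProduct hrn κ ∈ hwSpace (rightAct r n) (extendByZero n κ) ∧
    minorProduct hrn κ ∈ hwSpace (leftAct r n) κ := by
  constructor
  · intro c hc
    refine ext_evalMatrix fun M => ?_
    -- Since `c` is upper triangular, the first `r` columns of `M c` involve only the first `r`
    -- columns of `M`.
    have h1 : (M * c.val).submatrix id (Fin.castLE hrn) =
        M.submatrix id (Fin.castLE hrn) * c.val.submatrix (Fin.castLE hrn) (Fin.castLE hrn) := by
      ext i j
      simp only [Matrix.submatrix_apply, Matrix.mul_apply, id]
      symm
      refine Finset.sum_of_injOn (Fin.castLE hrn) (Fin.castLE_injective hrn).injOn (fun _ _ => Finset.mem_coe.2 (Finset.mem_univ _))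
        (fun l _ hl => ?_) (fun _ _ => rfl)
      have : ¬ l.1 < r := fun h => hl ⟨⟨l.1, h⟩, by simp, Fin.ext rfl⟩
      rw [hc l (Fin.castLE hrn j) (by
        rw [Fin.lt_def, Fin.val_castLE]
        have := j.2
        omega), mul_zero]
    rw [rightAct_apply, evalMatrix_biAct, Matrix.transpose_one, Matrix.one_mul,
      evalMatrix_minorProduct, h1, prod_minor_mul_upper hκ h0 _ (c.val.submatrix (Fin.castLE hrn) (Fin.castLE hrn))
        (fun i j hij => hc (Fin.castLE hrn i) (Fin.castLE hrn j) hij), ← evalMatrix_minorProduct, evalMatrix, evalMatrix, MvPolynomial.smul_eval, diagChar,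
      prod_extendByZero hrn κ (fun i k => c.val i i ^ k) (fun i => zpow_zero _)]
    rfl
  · intro b hb
    refine ext_evalMatrix fun M => ?_
    -- Transposition turns the left action into the right one and preserves principal minors.
    have h1 : (b.val.transpose * M).submatrix id (Fin.castLE hrn) =
        ((M.submatrix id (Fin.castLE hrn)).transpose * b.val).transpose := by
      ext i j
      simp [Matrix.mul_apply, mul_comm]
    have h2 : ∀ (x : Matrix (Fin r) (Fin r) ℂ) (t : ℕ),
        (x.transpose.toSquareBlockProp fun j => (t : ℤ) < κ j).det =
        (x.toSquareBlockProp fun j => (t : ℤ) < κ j).det := fun x t => by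
      rw [← Matrix.det_transpose]
      rfl
    rw [leftAct_apply, evalMatrix_biAct, Matrix.mul_one, evalMatrix_minorProduct, h1]
    simp only [h2]
    rw [prod_minor_mul_upper hκ h0 _ _ hb]
    simp only [h2]
    rw [← evalMatrix_minorProduct, evalMatrix, evalMatrix, MvPolynomial.smul_eval, diagChar]

theorem minorProduct_ne_zero (hrn : r ≤ n) (κ : Fin r → ℤ) : minorProduct hrn κ ≠ 0 := by
  intro h
  have h1 := evalMatrix_minorProduct hrn κ (partialOne r n)
  have h2 : (partialOne r n).submatrix id (Fin.castLE hrn) = 1 := by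
    ext i j
    simp [partialOne, Matrix.one_apply, Fin.ext_iff]
  have h3 : ∀ t : ℕ, ((1 : Matrix (Fin r) (Fin r) ℂ).toSquareBlockProp
      fun j => (t : ℤ) < κ j) = 1 := by
    intro t
    ext i j
    simp [Matrix.toSquareBlockProp_def, Matrix.one_apply, Subtype.ext_iff]
  rw [h2, h, evalMatrix, map_zero] at h1
  simp [h3] at h1

/-- Evaluation at (1 | 0) is injective on joint highest weight polynomials, so they form at most a
line, and `minorProduct` spans it for the admissible weights. This is the multiplicity-freeness of
the duality. -/
theorem finrank_hwSpace_inf (hrn : r ≤ n) (κ : DominantWeight r) (ν : Fin n → ℤ) [Decidable (ν = extendByZero n κ.1 ∧ ∀ i, 0 ≤ κ.1 i)] :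
    Module.finrank ℂ (hwSpace (rightAct r n) ν ⊓ hwSpace (leftAct r n) κ.1 :
      Submodule ℂ (MvPolynomial (Fin r × Fin n) ℂ)) =
    if ν = extendByZero n κ.1 ∧ ∀ i, 0 ≤ κ.1 i then 1 else 0 := by
  split_ifs with h
  · obtain ⟨rfl, h0⟩ := h
    refine finrank_eq_one ⟨minorProduct hrn κ.1, minorProduct_mem hrn κ.2 h0⟩
      (fun h => minorProduct_ne_zero hrn κ.1 (congrArg Subtype.val h)) fun w => ?_
    have hne : evalMatrix (partialOne r n) (minorProduct hrn κ.1) ≠ 0 := fun h =>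
      minorProduct_ne_zero hrn κ.1 (hw_eq_zero hrn (minorProduct_mem hrn κ.2 h0).1
        (minorProduct_mem hrn κ.2 h0).2 h)
    refine ⟨evalMatrix (partialOne r n) w.1 / evalMatrix (partialOne r n) (minorProduct hrn κ.1),
      Subtype.ext (sub_eq_zero.1 ?_).symm⟩
    refine hw_eq_zero hrn (sub_mem w.2.1 (Submodule.smul_mem _ _ (minorProduct_mem hrn κ.2 h0).1))
      (sub_mem w.2.2 (Submodule.smul_mem _ _ (minorProduct_mem hrn κ.2 h0).2)) ?_
    have hsub : ∀ (a : ℂ) (f g : MvPolynomial (Fin r × Fin n) ℂ),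
        evalMatrix (partialOne r n) (f - a • g) =
          evalMatrix (partialOne r n) f - a * evalMatrix (partialOne r n) g := fun a f g => by
      simp [evalMatrix]
    exact (hsub _ _ _).trans (sub_eq_zero.2 (div_mul_cancel₀ _ hne).symm)
  · rw [Submodule.finrank_eq_zero, eq_bot_iff]
    intro f hf
    by_contra hf0
    exact h (hw_weights hrn hf.1 hf.2 hf0)

/-- The dimension of a weight space of the irreducible representation with highest weight `ν`. -/
noncomputable def weightDim (ν : DominantWeight n) (α : Fin n → ℤ) : ℕ :=
  Module.finrank ℂ (weightSpace (irrep ν).rep α)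

/-- The highest weight polynomials for GL_n of this weight form a representation of GL_r with just
one line of highest weight vectors, of weight `κ`; by complete reducibility it is a copy of `irrep
κ`. -/
theorem finrank_hwSpace_inf_weightSpace (hrn : r ≤ n) (κ : DominantWeight r) (h0 : ∀ i, 0 ≤ κ.1 i)
    (α : Fin r → ℤ) :
    Module.finrank ℂ (hwSpace (rightAct r n) (extendByZero n κ.1) ⊓ weightSpace (leftAct r n) α :
      Submodule ℂ (MvPolynomial (Fin r × Fin n) ℂ)) = weightDim κ α := by
  classical
  obtain ⟨s, hs⟩ := (hwRep_isAlgebraic (r := r) (extendByZero n κ.1)).exists_decomposition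
  have hcount : ∀ κ' : DominantWeight r, s.count κ' = if κ' = κ then 1 else 0 := by
    intro κ'
    rw [← sum_map_finrank_hwSpace, ← hs, finrank_semiInv_semiInvRep, finrank_hwSpace_inf hrn]
    refine if_congr ⟨fun h => ?_, fun h => ?_⟩ rfl rfl
    · exact Subtype.ext (extendByZero_injective hrn h.1).symm
    · subst h; exact ⟨rfl, h0⟩
  have hsing : s = {κ} := by
    ext κ'
    rw [hcount, Multiset.count_singleton]
  rw [← finrank_semiInv_semiInvRep _ _ rightAct_leftAct_comm, hs, hsing]
  simp [weightDim]

/-- A nonzero representation of GL_r has a constituent, whose highest weight vector is a joint one;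
`finrank_hwSpace_inf` then restricts the weight. -/
theorem exists_of_finrank_hwSpace_inf_ne_zero (hrn : r ≤ n) {ν : Fin n → ℤ} {α : Fin r → ℤ}
    (h : Module.finrank ℂ (hwSpace (rightAct r n) ν ⊓ weightSpace (leftAct r n) α :
      Submodule ℂ (MvPolynomial (Fin r × Fin n) ℂ)) ≠ 0) :
    ∃ κ : DominantWeight r, (∀ i, 0 ≤ κ.1 i) ∧ ν = extendByZero n κ.1 := by
  classical
  obtain ⟨s, hs⟩ := (hwRep_isAlgebraic (r := r) ν).exists_decomposition
  rw [← finrank_semiInv_semiInvRep _ _ rightAct_leftAct_comm, hs] at h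
  obtain ⟨κ, hκ⟩ : ∃ κ, κ ∈ s := by
    refine Multiset.exists_mem_of_ne_zero fun h0 => h ?_
    rw [h0]; rfl
  have h1 := Multiset.one_le_count_iff_mem.2 hκ
  rw [← sum_map_finrank_hwSpace, ← hs, finrank_semiInv_semiInvRep, finrank_hwSpace_inf hrn] at h1
  split_ifs at h1 with h2
  · exact ⟨κ, h2.2, h2.1⟩
  · omega

open Classical in
/-- The dimension of the semi-invariants in the irreducible representation of `GL_n` whose highest
weight is `κ` extended by zero. -/
noncomputable def extDim (n : ℕ) (κ : Fin r → ℤ) (S : Set (GL (Fin n) ℂ)) (χ : GL (Fin n) ℂ → ℂ) : ℕ :=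
  if h : Antitone (extendByZero n κ) then
    Module.finrank ℂ (semiInv (irrep (⟨extendByZero n κ, h⟩ : DominantWeight n)).rep S χ)
  else 0

theorem extDim_empty (κ : Fin r → ℤ) (χ : GL (Fin n) ℂ → ℂ) : extDim n κ ∅ χ = dimR n κ := by
  unfold extDim dimR
  split_ifs
  · have : ∀ (V : Type) [AddCommGroup V] [Module ℂ V] (ρ : Representation ℂ (GL (Fin n) ℂ) V),
        semiInv ρ ∅ χ = ⊤ := by
      intro V _ _ ρ
      exact eq_top_iff.2 fun x _ b hb => hb.elim
    rw [this, finrank_top]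
  · rfl

/-- The decomposition of the polynomials on `r × n` matrices under `GL_r × GL_n`. -/
theorem finrank_rowSpace_inf (hrn : r ≤ n) (α : Fin r → ℤ) :
    ∃ K : Finset (DominantWeight r), (∀ κ ∈ K, ∀ i, 0 ≤ κ.1 i) ∧
      (∀ κ : DominantWeight r, (∀ i, 0 ≤ κ.1 i) → weightDim κ α ≠ 0 → κ ∈ K) ∧
      ∀ S χ, Module.finrank ℂ (weightSpace (leftAct r n) α ⊓ semiInv (rightAct r n) S χ :
        Submodule ℂ (MvPolynomial (Fin r × Fin n) ℂ)) =
        ∑ κ ∈ K, weightDim κ α * extDim n κ.1 S χ := by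
  classical
  obtain ⟨s, hs⟩ := (rowRep_isAlgebraic (n := n) α).exists_decomposition
  have hcount : ∀ ν : DominantWeight n, s.count ν = Module.finrank ℂ
      (hwSpace (rightAct r n) ν.1 ⊓ weightSpace (leftAct r n) α :
        Submodule ℂ (MvPolynomial (Fin r × Fin n) ℂ)) := by
    intro ν
    rw [← sum_map_finrank_hwSpace, ← hs, finrank_semiInv_semiInvRep, inf_comm]
  -- Every constituent has a highest weight that is zero after the first `r` entries, so this
  -- truncation loses nothing, and on constituents it is injective.
  let res : DominantWeight n → DominantWeight r := fun ν =>
    ⟨fun i => ν.1 (Fin.castLE hrn i), fun i j hij => ν.2 (show Fin.castLE hrn i ≤ Fin.castLE hrn j from hij)⟩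
  have hex : ∀ ν ∈ s.toFinset, (∀ i, 0 ≤ (res ν).1 i) ∧ ν.1 = extendByZero n (res ν).1 := by
    intro ν hν
    have h1 := Multiset.one_le_count_iff_mem.2 (Multiset.mem_toFinset.1 hν)
    rw [hcount] at h1
    obtain ⟨κ, h2, h3⟩ := exists_of_finrank_hwSpace_inf_ne_zero hrn (by omega :
      Module.finrank ℂ (hwSpace (rightAct r n) ν.1 ⊓ weightSpace (leftAct r n) α :
        Submodule ℂ (MvPolynomial (Fin r × Fin n) ℂ)) ≠ 0)
    have h4 : res ν = κ := by
      refine Subtype.ext (funext fun i => ?_)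
      change ν.1 _ = _
      rw [h3, extendByZero_castLE]
    rw [h4]
    exact ⟨h2, h3⟩
  refine ⟨s.toFinset.image res, ?_, ?_, fun S χ => ?_⟩
  · intro κ hκ
    obtain ⟨ν, hν, rfl⟩ := Finset.mem_image.1 hκ
    exact (hex ν hν).1
  · intro κ h0 hκ
    let ν : DominantWeight n := ⟨extendByZero n κ.1, antitone_extendByZero κ.2 h0⟩
    refine Finset.mem_image.2 ⟨ν, ?_, Subtype.ext (funext fun i => extendByZero_castLE hrn κ.1 i)⟩
    rw [Multiset.mem_toFinset, ← Multiset.one_le_count_iff_mem, hcount,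
      finrank_hwSpace_inf_weightSpace hrn κ h0]
    omega
  · rw [← finrank_semiInv_semiInvRep _ _ leftAct_rightAct_comm, hs, Finset.sum_multiset_map_count,
      Finset.sum_image]
    · refine Finset.sum_congr rfl fun ν hν => ?_
      obtain ⟨h1, h2⟩ := hex ν hν
      rw [smul_eq_mul, ← finrank_hwSpace_inf_weightSpace hrn _ h1, ← h2, hcount]
      congr 1
      rw [extDim, dif_pos (antitone_extendByZero (res ν).2 h1)]
      have h3 : ν = ⟨extendByZero n (res ν).1, antitone_extendByZero (res ν).2 h1⟩ := Subtype.ext h2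
      rw [← h3]
    · intro ν hν ν' hν' h
      refine Subtype.ext ?_
      rw [(hex ν hν).2, (hex ν' hν').2]
      exact congrArg (fun κ : DominantWeight r => extendByZero n κ.1) h

end

end GLRep

namespace GLRep

/-! ### Counting exponents -/

section

variable {r n : ℕ}

theorem card_natSum (n m : ℕ) : Nat.card {P : Fin n → ℕ // ∑ i, P i = m} = Nat.multichoose n m := by
  rw [← Nat.card_congr (Sym.equivNatSumOfFintype (Fin n) m), Nat.card_eq_fintype_card,
    Sym.card_sym_eq_multichoose, Fintype.card_fin]

theorem intBinom_eq_multichoose (hn : 0 < n) {m : ℤ} (hm : 0 ≤ m) :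
    intBinom (n + m - 1) m = Nat.multichoose n m.toNat := by
  rw [intBinom, if_pos hm, Nat.multichoose_eq]
  have : (n : ℤ) + m - 1 = ((n + m.toNat - 1 : ℕ) : ℤ) := by omega
  rw [this, Ring.choose_natCast]

/-- The rows are chosen independently, each by stars and bars. A negative row sum leaves no exponent
and makes the corresponding binomial zero. -/
theorem card_rowSum (hn : 0 < n) (α : Fin r → ℤ) :
    (Nat.card {A : (Fin r × Fin n) →₀ ℕ | rowSum A = α} : ℤ) =
      ∏ i, intBinom (n + α i - 1) (α i) := by
  by_cases h0 : ∀ i, 0 ≤ α i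
  · have e : {A : (Fin r × Fin n) →₀ ℕ | rowSum A = α} ≃
        ∀ i, {P : Fin n → ℕ // ∑ j, P j = (α i).toNat} :=
      { toFun := fun A i => ⟨fun j => A.1 (i, j), by
          have h1 : rowSum A.1 i = α i := congrFun A.2 i
          have h2 := h0 i
          rw [rowSum, ← Nat.cast_sum] at h1
          change ∑ j, A.1 (i, j) = _
          omega⟩
        invFun := fun P => ⟨Finsupp.equivFunOnFinite.symm fun ij => (P ij.1).1 ij.2, by
          funext i
          have h1 := (P i).2
          have h2 := h0 i
          simp only [rowSum, Finsupp.equivFunOnFinite_symm_apply_apply]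
          rw [← Nat.cast_sum]
          omega⟩
        left_inv := fun A => by ext; rfl
        right_inv := fun P => by ext; rfl }
    rw [Nat.card_congr e, Nat.card_pi, Nat.cast_prod]
    exact Finset.prod_congr rfl fun i _ => by
      rw [card_natSum, intBinom_eq_multichoose hn (h0 i)]
  · obtain ⟨i, hi⟩ := not_forall.1 h0
    have h1 : IsEmpty {A : (Fin r × Fin n) →₀ ℕ | rowSum A = α} := by
      refine ⟨fun A => hi ?_⟩
      rw [← show rowSum A.1 = α from A.2]
      exact Finset.sum_nonneg fun _ _ => by positivity
    rw [Nat.card_of_isEmpty, Finset.prod_eq_zero (Finset.mem_univ i)]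
    · rfl
    · rw [intBinom, if_neg hi]

/-- The dimension of the polynomials with row degrees `α`, computed once by counting monomials and
once by the duality, with no condition imposed on the side of GL_n. -/
theorem prod_intBinom_eq_sum (hrn : r ≤ n) (hn : 0 < n) (α : Fin r → ℤ) :
    ∃ K : Finset (DominantWeight r), (∀ κ ∈ K, ∀ i, 0 ≤ κ.1 i) ∧
      (∀ κ : DominantWeight r, (∀ i, 0 ≤ κ.1 i) → weightDim κ α ≠ 0 → κ ∈ K) ∧
      ∏ i, intBinom (n + α i - 1) (α i) = ∑ κ ∈ K, (weightDim κ α : ℤ) * dimR n κ.1 := by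
  obtain ⟨K, h1, h2, h3⟩ := finrank_rowSpace_inf hrn α
  refine ⟨K, h1, h2, ?_⟩
  have h4 := h3 ∅ 1
  have h5 : weightSpace (leftAct r n) α ⊓ semiInv (rightAct r n) ∅ 1 =
      MvPolynomial.restrictSupport ℂ {A | rowSum A = α} := by
    rw [weightSpace_leftAct]
    exact inf_eq_left.2 fun _ _ b hb => hb.elim
  rw [h5, finrank_restrictSupport] at h4
  rw [← card_rowSum hn, h4]
  push_cast
  exact Finset.sum_congr rfl fun κ _ => by rw [extDim_empty]

/-- The number of tables with given row and column sums. -/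
noncomputable def tableCount (α : Fin r → ℤ) (β : Fin n → ℤ) : ℕ :=
  Nat.card {A : (Fin r × Fin n) →₀ ℕ | rowSum A = α ∧ colSum A = β}

theorem extendByZero_self (κ : Fin n → ℤ) : extendByZero n κ = κ := by
  funext i
  simp [extendByZero]

/-- The duality for square matrices, refined by weights on both sides: Cauchy's identity for the
characters, coefficient by coefficient. The index set is independent of `β`. -/
theorem tableCount_eq_sum (α : Fin r → ℤ) :
    ∃ K : Finset (DominantWeight r), (∀ κ ∈ K, ∀ i, 0 ≤ κ.1 i) ∧
      (∀ κ : DominantWeight r, (∀ i, 0 ≤ κ.1 i) → weightDim κ α ≠ 0 → κ ∈ K) ∧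
      ∀ β : Fin r → ℤ, tableCount α β = ∑ κ ∈ K, weightDim κ α * weightDim κ β := by
  obtain ⟨K, h1, h2, h3⟩ := finrank_rowSpace_inf (le_refl r) α
  refine ⟨K, h1, h2, fun β => ?_⟩
  have h4 := h3 (diagonalSet r) (diagChar β)
  have h5 : weightSpace (leftAct r r) α ⊓ weightSpace (rightAct r r) β =
      MvPolynomial.restrictSupport ℂ {A | rowSum A = α ∧ colSum A = β} := by
    rw [weightSpace_leftAct, weightSpace_rightAct]
    ext f
    simp only [Submodule.mem_inf, MvPolynomial.mem_restrictSupport_iff, Set.subset_def,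
      Set.mem_ofPred_eq]
    exact ⟨fun h A hA => ⟨h.1 A hA, h.2 A hA⟩, fun h => ⟨fun A hA => (h A hA).1, fun A hA => (h A hA).2⟩⟩
  rw [h5, finrank_restrictSupport] at h4
  rw [tableCount, h4]
  refine Finset.sum_congr rfl fun κ _ => ?_
  congr 1
  have h6 : Antitone (extendByZero r κ.1) := by rw [extendByZero_self]; exact κ.2
  rw [extDim, dif_pos h6]
  have h7 : (⟨extendByZero r κ.1, h6⟩ : DominantWeight r) = κ := Subtype.ext (extendByZero_self κ.1)
  rw [h7]
  rfl

end

/-! ### The Cauchy determinant -/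

section Cauchy

variable {R : Type*} [CommRing R] {r : ℕ}

/-- Entry (i, j) is a form of degree r - 1 in `(v i, w i)` with coefficients depending on `j` alone,
which is a matrix factorisation. It is used at `(x, 1)` and `(1, y)`, with the same second factor.
-/
theorem of_prod_erase_eq_mul (v w y : Fin r → R) :
    Matrix.of (fun i j => ∏ l ∈ Finset.univ.erase j, (w i - v i * y l)) =
    Matrix.projVandermonde v w * Matrix.of fun k j : Fin r =>
      ∑ t ∈ Finset.powersetCard k.1 (Finset.univ.erase j), ∏ l ∈ t, -y l := by
  ext i j
  have hcard : (Finset.univ.erase j).card + 1 = r := by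
    rw [Finset.card_erase_add_one (Finset.mem_univ j), Finset.card_univ, Fintype.card_fin]
  rw [Matrix.of_apply, Matrix.mul_apply]
  simp only [Matrix.projVandermonde_apply, Matrix.of_apply]
  have h1 : ∀ l, w i - v i * y l = v i * -y l + w i := fun l => by ring
  simp only [h1]
  rw [Finset.prod_add, Finset.sum_powerset, hcard, Finset.sum_range]
  refine Finset.sum_congr rfl fun k _ => ?_
  rw [Finset.mul_sum]
  refine Finset.sum_congr rfl fun t ht => ?_
  obtain ⟨ht1, ht2⟩ := Finset.mem_powersetCard.1 ht
  rw [Finset.prod_mul_distrib, Finset.prod_const, Finset.prod_const, ht2,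
    Finset.card_sdiff_of_subset ht1, ht2]
  have : (Finset.univ.erase j).card - k.1 = k.rev.1 := by
    rw [Fin.val_rev]
    omega
  rw [this]
  ring

/-- The first specialisation splits off the Vandermonde determinant of `x`. The second makes the
left side diagonal and so determines the determinant of the common factor `Q`. -/
theorem det_of_prod_erase [IsDomain R] (x y : Fin r → R) (hy : Function.Injective y) :
    (Matrix.of fun i j => ∏ l ∈ Finset.univ.erase j, (1 - x i * y l)).det =
    (Matrix.vandermonde x).det * (Matrix.vandermonde y).det := by
  set Q : Matrix (Fin r) (Fin r) R := Matrix.of fun k j : Fin r =>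
      ∑ t ∈ Finset.powersetCard k.1 (Finset.univ.erase j), ∏ l ∈ t, -y l with hQ
  have h1 := of_prod_erase_eq_mul x 1 y
  simp only [Pi.one_apply] at h1
  rw [h1, Matrix.det_mul, ← Matrix.vandermonde_eq_projVandermonde]
  congr 1
  -- Here an off-diagonal entry contains the factor `y i - y i`. The resulting identity determines
  -- `det Q` once the nonzero product of differences is cancelled.
  have h2 := of_prod_erase_eq_mul 1 y y
  simp only [Pi.one_apply, one_mul] at h2
  have h3 : Matrix.of (fun i j => ∏ l ∈ Finset.univ.erase j, (y i - y l)) =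
      Matrix.diagonal fun j => ∏ l ∈ Finset.univ.erase j, (y j - y l) := by
    ext i j
    by_cases hij : i = j
    · subst hij; simp
    · rw [Matrix.diagonal_apply_ne _ hij]
      exact Finset.prod_eq_zero (Finset.mem_erase.2 ⟨hij, Finset.mem_univ i⟩) (sub_self _)
  have h4 := congrArg Matrix.det h2
  rw [h3, Matrix.det_diagonal, Matrix.det_mul, Matrix.det_projVandermonde] at h4
  simp only [Pi.one_apply, one_mul] at h4
  have h5 : ∏ j, ∏ l ∈ Finset.univ.erase j, (y j - y l) =
      (∏ i, ∏ j ∈ Finset.Ioi i, (y i - y j)) * ∏ i, ∏ j ∈ Finset.Ioi i, (y j - y i) := by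
    have h6 : ∏ i, ∏ j ∈ Finset.Ioi i, (y j - y i) = ∏ i, ∏ j ∈ Finset.Iio i, (y i - y j) :=
      Finset.prod_comm' (by simp)
    rw [h6, ← Finset.prod_mul_distrib]
    refine Finset.prod_congr rfl fun j _ => ?_
    rw [← Finset.prod_union]
    · congr 1
      ext l
      simp [lt_or_lt_iff_ne, eq_comm]
    · rw [Finset.disjoint_left]
      intro l hl hl'
      exact lt_asymm (Finset.mem_Ioi.1 hl) (Finset.mem_Iio.1 hl')
  rw [h5] at h4
  have h7 : ∏ i, ∏ j ∈ Finset.Ioi i, (y i - y j) ≠ 0 :=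
    Finset.prod_ne_zero_iff.2 fun i _ => Finset.prod_ne_zero_iff.2 fun j hj =>
      sub_ne_zero.2 fun h => (Finset.mem_Ioi.1 hj).ne (hy h)
  rw [Matrix.det_vandermonde]
  exact (mul_left_cancel₀ h7 h4).symm

/-- Vandermonde matrix with decreasing exponents. -/
def revVandermonde (x : Fin r → R) : Matrix (Fin r) (Fin r) R := Matrix.of fun i j => x i ^ j.rev.1

theorem det_revVandermonde (x : Fin r → R) :
    (revVandermonde x).det = Equiv.Perm.sign (Fin.revPerm (n := r)) * (Matrix.vandermonde x).det := by
  rw [← Matrix.det_permute']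
  rfl

/-- Cauchy's determinant for entries 1 / (1 - x_i y_j): multiplying row `i` by the product of its
denominators gives the matrix of `det_of_prod_erase`. The two signs from reversing exponents cancel.
-/
theorem cauchy_det [IsDomain R] (x y : Fin r → R) (hy : Function.Injective y)
    (G : Fin r → Fin r → R) (hG : ∀ i j, G i j * (1 - x i * y j) = 1) :
    (∏ i, ∏ j, G i j) * ((revVandermonde x).det * (revVandermonde y).det) = (Matrix.of G).det := by
  have h1 : (revVandermonde x).det * (revVandermonde y).det =
      (Matrix.vandermonde x).det * (Matrix.vandermonde y).det := by
    rw [det_revVandermonde, det_revVandermonde]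
    have : ((Equiv.Perm.sign (Fin.revPerm (n := r)) : ℤ) : R) *
        ((Equiv.Perm.sign (Fin.revPerm (n := r)) : ℤ) : R) = 1 := by
      rw [← Int.cast_mul, ← Units.val_mul, Int.units_mul_self]; simp
    linear_combination (Matrix.vandermonde x).det * (Matrix.vandermonde y).det * this
  have h2 : Matrix.of (fun i j => ∏ l ∈ Finset.univ.erase j, (1 - x i * y l)) =
      Matrix.of fun i j => (∏ l, (1 - x i * y l)) * Matrix.of G i j := by
    ext i j
    rw [Matrix.of_apply, Matrix.of_apply, Matrix.of_apply,
      ← Finset.mul_prod_erase _ _ (Finset.mem_univ j)]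
    linear_combination -(∏ l ∈ Finset.univ.erase j, (1 - x i * y l)) * hG i j
  rw [h1, ← det_of_prod_erase x y hy, h2, Matrix.det_mul_column, ← mul_assoc,
    ← Finset.prod_mul_distrib, Finset.prod_eq_one, one_mul]
  intro i _
  rw [← Finset.prod_mul_distrib]
  exact Finset.prod_eq_one fun j _ => hG i j

end Cauchy

end GLRep

namespace GLRep

/-! ### The generating function of tables -/

section

variable {r : ℕ}

/-- The exponent of `xᵢ yⱼ`. -/
noncomputable def pairExp (ij : Fin r × Fin r) : Fin r ⊕ Fin r →₀ ℕ :=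
  Finsupp.single (Sum.inl ij.1) 1 + Finsupp.single (Sum.inr ij.2) 1

theorem pairExp_inl (ij : Fin r × Fin r) (i : Fin r) :
    pairExp ij (Sum.inl i) = if ij.1 = i then 1 else 0 := by
  simp [pairExp, Finsupp.single_apply]

theorem pairExp_inr (ij : Fin r × Fin r) (i : Fin r) :
    pairExp ij (Sum.inr i) = if ij.2 = i then 1 else 0 := by
  simp [pairExp, Finsupp.single_apply]

theorem smul_pairExp_injective (ij : Fin r × Fin r) {k l : ℕ} (h : k • pairExp ij = l • pairExp ij) :
    k = l := by
  have := DFunLike.congr_fun h (Sum.inl ij.1)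
  simpa [pairExp_inl] using this

open Classical in
/-- The geometric series `∑ₖ (xᵢ yⱼ)ᵏ`. -/
noncomputable def geomSeries (ij : Fin r × Fin r) : MvPowerSeries (Fin r ⊕ Fin r) ℤ :=
  fun m => if ∃ k : ℕ, m = k • pairExp ij then 1 else 0

open Classical in
theorem coeff_geomSeries (ij : Fin r × Fin r) (m : Fin r ⊕ Fin r →₀ ℕ) :
    MvPowerSeries.coeff m (geomSeries ij) = if ∃ k : ℕ, m = k • pairExp ij then 1 else 0 := rfl

theorem X_mul_X_eq_monomial (i j : Fin r) :
    (MvPowerSeries.X (Sum.inl i) * MvPowerSeries.X (Sum.inr j) : MvPowerSeries (Fin r ⊕ Fin r) ℤ) =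
      MvPowerSeries.monomial (pairExp (i, j)) 1 := by
  rw [MvPowerSeries.X_def, MvPowerSeries.X_def, MvPowerSeries.monomial_mul_monomial, one_mul, pairExp]

theorem geomSeries_mul (i j : Fin r) : geomSeries (i, j) *
    (1 - MvPowerSeries.X (Sum.inl i) * MvPowerSeries.X (Sum.inr j)) = 1 := by
  classical
  rw [X_mul_X_eq_monomial]
  ext m
  rw [mul_sub, mul_one, map_sub, mul_comm, MvPowerSeries.coeff_monomial_mul, one_mul,
    coeff_geomSeries, coeff_geomSeries, MvPowerSeries.coeff_one]
  by_cases hm : ∃ k : ℕ, m = k • pairExp (i, j)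
  · obtain ⟨k, rfl⟩ := hm
    rw [if_pos ⟨k, rfl⟩]
    rcases Nat.eq_zero_or_pos k with rfl | hk
    · have : ¬ pairExp (i, j) ≤ 0 • pairExp (i, j) := fun h => by
        have := h (Sum.inl i)
        simp [pairExp_inl] at this
      rw [if_neg this]
      simp
    · obtain ⟨k, rfl⟩ := Nat.exists_eq_succ_of_ne_zero hk.ne'
      have h1 : (k + 1) • pairExp (i, j) = k • pairExp (i, j) + pairExp (i, j) := succ_nsmul _ _
      have h2 : (k + 1) • pairExp (i, j) ≠ 0 := fun h => by
        have := smul_pairExp_injective (i, j) (h.trans (zero_smul ℕ _).symm)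
        omega
      rw [if_neg h2, Nat.succ_eq_add_one, h1, if_pos (le_add_left le_rfl), add_tsub_cancel_right,
        if_pos ⟨k, rfl⟩, sub_self]
  · rw [if_neg hm]
    have h0 : m ≠ 0 := fun h => hm ⟨0, by rw [h, zero_smul]⟩
    rw [if_neg h0, zero_sub, neg_eq_zero, ite_eq_right_iff]
    intro hle
    rw [if_neg]
    rintro ⟨k, hk⟩
    refine hm ⟨k + 1, ?_⟩
    rw [succ_nsmul, ← hk, tsub_add_cancel_of_le hle]

theorem sum_smul_pairExp_eq_iff (A : Fin r × Fin r →₀ ℕ) (m : Fin r ⊕ Fin r →₀ ℕ) :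
    ∑ ij, A ij • pairExp ij = m ↔
      rowSum A = (fun i => (m (Sum.inl i) : ℤ)) ∧ colSum A = (fun i => (m (Sum.inr i) : ℤ)) := by
  have hl : ∀ i, ((∑ ij, A ij • pairExp ij) (Sum.inl i) : ℤ) = rowSum A i := by
    intro i
    simp [Finsupp.finsetSum_apply, pairExp_inl, Fintype.sum_prod_type, rowSum]
  have hr : ∀ i, ((∑ ij, A ij • pairExp ij) (Sum.inr i) : ℤ) = colSum A i := by
    intro i
    simp [Finsupp.finsetSum_apply, pairExp_inr, Fintype.sum_prod_type_right, colSum]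
  constructor
  · rintro rfl
    exact ⟨funext fun i => (hl i).symm, funext fun i => (hr i).symm⟩
  · rintro ⟨h1, h2⟩
    ext x
    rcases x with i | i
    · have := (hl i).trans (congrFun h1 i)
      exact_mod_cast this
    · have := (hr i).trans (congrFun h2 i)
      exact_mod_cast this

/-- Expanding the product means choosing a power `A ij` of each x_i y_j with `ij` in `s`, that is, a
table supported on `s`. The full square and the graph of a permutation are the cases needed. -/
theorem coeff_prod_geomSeries (s : Finset (Fin r × Fin r)) (m : Fin r ⊕ Fin r →₀ ℕ) :
    MvPowerSeries.coeff m (∏ ij ∈ s, geomSeries ij) =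
      Nat.card {A : Fin r × Fin r →₀ ℕ | A.support ⊆ s ∧
        rowSum A = (fun i => (m (Sum.inl i) : ℤ)) ∧ colSum A = (fun i => (m (Sum.inr i) : ℤ))} := by
  classical
  set T := {A : Fin r × Fin r →₀ ℕ | A.support ⊆ s ∧
        rowSum A = (fun i => (m (Sum.inl i) : ℤ)) ∧ colSum A = (fun i => (m (Sum.inr i) : ℤ))} with hT
  have hfin : T.Finite := (finite_rowSum _).subset fun A hA => hA.2.1
  have hcard : Nat.card T = hfin.toFinset.card := by
    rw [Nat.card_coe_set_eq, Set.ncard_eq_toFinset_card T hfin]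
  rw [hcard, MvPowerSeries.coeff_prod, Finset.card_eq_sum_ones, Nat.cast_sum]
  symm
  refine Finset.sum_of_injOn
    (fun A => Finsupp.equivFunOnFinite.symm fun ij => A ij • pairExp ij) ?_ ?_ ?_ ?_
  · intro A _ B _ h
    ext ij
    exact smul_pairExp_injective ij (by simpa using DFunLike.congr_fun h ij)
  · intro A hA
    obtain ⟨h1, h2⟩ := hfin.mem_toFinset.1 hA
    rw [Finset.mem_coe, Finset.mem_finsuppAntidiag]
    have hsub : ∀ ij ∉ s, A ij • pairExp ij = 0 := fun ij hij => by
      have : A ij = 0 := by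
        by_contra h
        exact hij (h1 (Finsupp.mem_support_iff.2 h))
      rw [this, zero_smul]
    constructor
    · rw [← (sum_smul_pairExp_eq_iff A m).2 h2]
      exact Finset.sum_subset (Finset.subset_univ s) fun ij _ hij => hsub ij hij
    · intro ij hij
      by_contra h
      exact Finsupp.mem_support_iff.1 hij (hsub ij h)
  · intro l hl hnot
    obtain ⟨h1, h2⟩ := Finset.mem_finsuppAntidiag.1 hl
    by_contra hne
    have h3 := fun ij hij => Finset.prod_ne_zero_iff.1 hne ij hij
    have h4 : ∀ ij, ∃ k : ℕ, l ij = k • pairExp ij ∧ (ij ∉ s → k = 0) := by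
      intro ij
      by_cases hij : ij ∈ s
      · have := h3 ij hij
        rw [coeff_geomSeries] at this
        obtain ⟨k, hk⟩ := (ite_ne_right_iff.1 this).1
        exact ⟨k, hk, fun h => absurd hij h⟩
      · refine ⟨0, ?_, fun _ => rfl⟩
        rw [zero_smul]
        by_contra h
        exact hij (h2 (Finsupp.mem_support_iff.2 h))
    choose k hk hk0 using h4
    refine hnot ⟨Finsupp.equivFunOnFinite.symm k, ?_, ?_⟩
    · rw [Finset.mem_coe, Set.Finite.mem_toFinset]
      refine ⟨fun ij hij => ?_, (sum_smul_pairExp_eq_iff _ m).1 ?_⟩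
      · by_contra h
        exact Finsupp.mem_support_iff.1 hij (hk0 ij h)
      · rw [← h1]
        simp only [Finsupp.equivFunOnFinite_symm_apply_apply, ← hk]
        symm
        refine Finset.sum_subset (Finset.subset_univ s) fun ij _ hij => ?_
        rw [hk, hk0 ij hij, zero_smul]
    · ext1 ij
      simp [← hk]
  · intro A _
    rw [Nat.cast_one, Finset.prod_eq_one]
    intro ij _
    rw [coeff_geomSeries, if_pos ⟨A ij, by simp⟩]

theorem coeff_prod_geomSeries_univ (m : Fin r ⊕ Fin r →₀ ℕ) :
    MvPowerSeries.coeff m (∏ i, ∏ j, geomSeries (i, j)) =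
      tableCount (fun i : Fin r => (m (Sum.inl i) : ℤ)) (fun i : Fin r => (m (Sum.inr i) : ℤ)) := by
  rw [← Fintype.prod_prod_type (f := fun ij : Fin r × Fin r => geomSeries ij), coeff_prod_geomSeries,
    tableCount]
  simp

/-- The term of `σ` counts tables supported on the graph of `σ` with row and column sums `p`. Such a
table forces `p ∘ σ = p`, hence `σ = 1`, and then it is the diagonal table of `p`. -/
theorem coeff_det_geomSeries {p : Fin r → ℕ} (hp : Function.Injective p) :
    MvPowerSeries.coeff (Finsupp.equivFunOnFinite.symm (Sum.elim p p))
      (Matrix.of fun i j : Fin r => geomSeries (i, j)).det = 1 := by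
  classical
  rw [Matrix.det_apply', map_sum]
  have h1 : ∀ σ : Equiv.Perm (Fin r), MvPowerSeries.coeff (Finsupp.equivFunOnFinite.symm (Sum.elim p p))
      (((Equiv.Perm.sign σ : ℤ) : MvPowerSeries (Fin r ⊕ Fin r) ℤ) *
        ∏ i, (Matrix.of fun i j : Fin r => geomSeries (i, j)) (σ i) i) =
      if σ = 1 then 1 else 0 := by
    intro σ
    have h2 : ∏ i, (Matrix.of fun i j : Fin r => geomSeries (i, j)) (σ i) i =
        ∏ ij ∈ Finset.univ.image (fun i => (σ i, i)), geomSeries ij := by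
      rw [Finset.prod_image fun i _ j _ h => congrArg Prod.snd h]
      rfl
    rw [h2, ← zsmul_eq_mul, map_zsmul, coeff_prod_geomSeries]
    simp only [Finsupp.equivFunOnFinite_symm_apply_apply, Sum.elim_inl, Sum.elim_inr]
    have hA0 : ∀ A : Fin r × Fin r →₀ ℕ, A.support ⊆ Finset.univ.image (fun i => (σ i, i)) →
        ∀ k j, k ≠ σ j → A (k, j) = 0 := by
      intro A hA k j hkj
      by_contra h
      obtain ⟨i, -, hi⟩ := Finset.mem_image.1 (hA (Finsupp.mem_support_iff.2 h))
      rw [Prod.mk.injEq] at hi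
      exact hkj (by rw [← hi.1, hi.2])
    have hcol : ∀ A : Fin r × Fin r →₀ ℕ, A.support ⊆ Finset.univ.image (fun i => (σ i, i)) →
        ∀ j, colSum A j = A (σ j, j) := by
      intro A hA j
      exact Finset.sum_eq_single _ (fun k _ hk => by rw [hA0 A hA k j hk]; rfl) (by simp)
    have hrow : ∀ A : Fin r × Fin r →₀ ℕ, A.support ⊆ Finset.univ.image (fun i => (σ i, i)) →
        ∀ j, rowSum A (σ j) = A (σ j, j) := by
      intro A hA j
      exact Finset.sum_eq_single _ (fun k _ hk => by
        rw [hA0 A hA (σ j) k fun h => hk (σ.injective h).symm]; rfl) (by simp)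
    split_ifs with hσ
    · subst hσ
      rw [Equiv.Perm.sign_one, Units.val_one, one_smul]
      rw [Nat.cast_eq_one, Nat.card_eq_one_iff_unique]
      refine ⟨⟨fun A B => Subtype.ext (Finsupp.ext fun ij => ?_)⟩, ?_⟩
      · obtain ⟨k, j⟩ := ij
        by_cases hkj : k = (1 : Equiv.Perm (Fin r)) j
        · have ha := hcol A.1 A.2.1 j
          have hb := hcol B.1 B.2.1 j
          rw [A.2.2.2] at ha
          rw [B.2.2.2] at hb
          rw [hkj]
          exact_mod_cast ha.symm.trans hb
        · rw [hA0 A.1 A.2.1 k j hkj, hA0 B.1 B.2.1 k j hkj]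
      · refine ⟨⟨Finsupp.equivFunOnFinite.symm fun ij => if ij.1 = ij.2 then p ij.1 else 0, ?_, ?_, ?_⟩⟩
        · intro ij hij
          rw [Finsupp.mem_support_iff] at hij
          have : ij.1 = ij.2 := by
            by_contra h
            exact hij (by simp [h])
          exact Finset.mem_image.2 ⟨ij.2, Finset.mem_univ _, Prod.ext this.symm rfl⟩
        · funext i
          simp [rowSum]
        · funext i
          simp [colSum]
    · rw [Nat.card_eq_zero.2 (Or.inl _)]
      · simp
      · refine ⟨fun A => hσ (Equiv.ext fun j => ?_)⟩
        have h3 := hcol A.1 A.2.1 j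
        have h4 := hrow A.1 A.2.1 j
        rw [A.2.2.2] at h3
        rw [A.2.2.1] at h4
        have h5 := h4.trans h3.symm
        have h6 : ((p (σ j) : ℕ) : ℤ) = p j := h5
        exact hp (by exact_mod_cast h6)
  rw [Finset.sum_congr rfl fun σ _ => h1 σ]
  simp

theorem det_revVandermonde_X (ι : Fin r → Fin r ⊕ Fin r) :
    (revVandermonde fun i => (MvPowerSeries.X (ι i) : MvPowerSeries (Fin r ⊕ Fin r) ℤ)).det =
      ∑ σ : Equiv.Perm (Fin r), (Equiv.Perm.sign σ : ℤ) •
        MvPowerSeries.monomial (∑ i, Finsupp.single (ι i) (σ i).rev.1) 1 := by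
  rw [← Matrix.det_transpose, Matrix.det_apply']
  refine Finset.sum_congr rfl fun σ _ => ?_
  rw [zsmul_eq_mul]
  congr 1
  have h1 : ∀ F : Finset (Fin r), ∏ i ∈ F, (MvPowerSeries.X (ι i) : MvPowerSeries (Fin r ⊕ Fin r) ℤ) ^
      (σ i).rev.1 = MvPowerSeries.monomial (∑ i ∈ F, Finsupp.single (ι i) (σ i).rev.1) 1 := by
    classical
    intro F
    induction F using Finset.induction_on with
    | empty => rw [Finset.prod_empty, Finset.sum_empty]; exact MvPowerSeries.monomial_zero_one.symm
    | insert a F ha ih =>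
      rw [Finset.prod_insert ha, Finset.sum_insert ha, ih, MvPowerSeries.X_pow_eq,
        MvPowerSeries.monomial_mul_monomial, one_mul]
  exact h1 Finset.univ

theorem tableCount_eq_zero {α β : Fin r → ℤ} (h : ¬ ((∀ i, 0 ≤ α i) ∧ ∀ i, 0 ≤ β i)) :
    tableCount α β = 0 := by
  refine Nat.card_eq_zero.2 (Or.inl ⟨fun A => h ⟨fun i => ?_, fun i => ?_⟩⟩)
  · rw [← A.2.1]
    exact Finset.sum_nonneg fun _ _ => by positivity
  · rw [← A.2.2]
    exact Finset.sum_nonneg fun _ _ => by positivity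

/-- The coefficient of x^p y^p in Cauchy's determinant identity: expanding the two Vandermonde
determinants shifts the exponents by permuted staircases. -/
theorem sum_sign_tableCount {p : Fin r → ℕ} (hp : Function.Injective p) :
    ∑ σ : Equiv.Perm (Fin r), ∑ τ : Equiv.Perm (Fin r),
      (Equiv.Perm.sign σ : ℤ) * (Equiv.Perm.sign τ : ℤ) *
        tableCount (fun i => (p i : ℤ) - (σ i).rev.1) (fun i => (p i : ℤ) - (τ i).rev.1) = 1 := by
  classical
  have : IsDomain (MvPowerSeries (Fin r ⊕ Fin r) ℤ) := NoZeroDivisors.to_isDomain _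
  rw [← coeff_det_geomSeries hp, ← cauchy_det (R := MvPowerSeries (Fin r ⊕ Fin r) ℤ)
    (fun i : Fin r => MvPowerSeries.X (Sum.inl i)) (fun i : Fin r => MvPowerSeries.X (Sum.inr i))
    (fun i j h => ?_) (fun i j => geomSeries (i, j)) geomSeries_mul,
    det_revVandermonde_X, det_revVandermonde_X, Finset.sum_mul_sum, Finset.mul_sum, map_sum]
  · refine Finset.sum_congr rfl fun σ _ => ?_
    rw [Finset.mul_sum, map_sum]
    refine Finset.sum_congr rfl fun τ _ => ?_
    rw [smul_mul_smul_comm, MvPowerSeries.monomial_mul_monomial, one_mul, mul_smul_comm, map_zsmul,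
      smul_eq_mul, mul_comm (∏ i, ∏ j, geomSeries (i, j)), MvPowerSeries.coeff_monomial_mul, one_mul]
    congr 1
    set e : Fin r ⊕ Fin r →₀ ℕ := ∑ i, Finsupp.single (Sum.inl i) (σ i).rev.1 +
      ∑ i, Finsupp.single (Sum.inr i) (τ i).rev.1 with he
    have hel : ∀ i, e (Sum.inl i) = (σ i).rev.1 := fun i => by
      simp [he, Finsupp.single_apply, -Fin.val_rev]
    have her : ∀ i, e (Sum.inr i) = (τ i).rev.1 := fun i => by
      simp [he, Finsupp.single_apply, -Fin.val_rev]
    split_ifs with hle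
    · rw [coeff_prod_geomSeries_univ]
      congr 2
      · funext i
        have := hle (Sum.inl i)
        rw [hel] at this
        rw [Finsupp.tsub_apply, hel, Nat.cast_sub this]
        rfl
      · funext i
        have := hle (Sum.inr i)
        rw [her] at this
        rw [Finsupp.tsub_apply, her, Nat.cast_sub this]
        rfl
    -- If a shift exceeds the exponent, the monomial does not contribute; correspondingly, a
    -- prescribed sum is negative and there are no tables.
    · rw [tableCount_eq_zero, Nat.cast_zero]
      rintro ⟨h1, h2⟩
      refine hle fun x => ?_
      rcases x with i | i
      · rw [hel]
        have := h1 i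
        change (σ i).rev.1 ≤ p i
        omega
      · rw [her]
        have := h2 i
        change (τ i).rev.1 ≤ p i
        omega
  · exact Sum.inr_injective (MvPowerSeries.X_inj.1 h)

end

end GLRep

namespace GLRep

/-! ### Twisting by powers of the determinant -/

section Twist

variable {n : ℕ} {V : Type*} [AddCommGroup V] [Module ℂ V]

/-- The twist of a representation by a power of the determinant. -/
noncomputable def detTwist (N : ℕ) (ρ : Representation ℂ (GL (Fin n) ℂ) V) :
    Representation ℂ (GL (Fin n) ℂ) V where
  toFun g := g.val.det ^ N • ρ g
  map_one' := by simp
  map_mul' g h := by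
    rw [Units.val_mul, Matrix.det_mul, mul_pow, map_mul, smul_mul_smul_comm]

theorem detTwist_apply (N : ℕ) (ρ : Representation ℂ (GL (Fin n) ℂ) V) (g : GL (Fin n) ℂ) (v : V) :
    detTwist N ρ g v = g.val.det ^ N • ρ g v := rfl

theorem isRegular_det_pow (N : ℕ) : IsRegular fun g : GL (Fin n) ℂ => g.val.det ^ N := by
  refine ⟨(Matrix.det (Matrix.of fun i j => MvPolynomial.X (i, j))) ^ N, 0, fun g => ?_⟩
  have hm : (MvPolynomial.eval fun ij => g.val ij.1 ij.2).mapMatrix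
      (Matrix.of fun i j => MvPolynomial.X (i, j)) = g.val := by
    ext i j
    simp
  rw [map_pow, RingHom.map_det, hm, pow_zero, mul_one]

theorem IsAlgebraic.detTwist {ρ : Representation ℂ (GL (Fin n) ℂ) V} (hρ : IsAlgebraic ρ) (N : ℕ) :
    IsAlgebraic (detTwist N ρ) := by
  intro v φ
  convert (isRegular_det_pow N).mul (hρ v φ) using 2 with g
  rw [detTwist_apply, map_smul, smul_eq_mul]

theorem isIrreducible_detTwist {ρ : Representation ℂ (GL (Fin n) ℂ) V} (h : ρ.IsIrreducible)
    (N : ℕ) : (detTwist N ρ).IsIrreducible := by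
  have hne : ∀ g : GL (Fin n) ℂ, g.val.det ^ N ≠ 0 :=
    fun g => pow_ne_zero _ (Matrix.isUnits_det_units g).ne_zero
  refine { toNontrivial := ?_, eq_bot_or_eq_top := fun S => ?_ }
  · refine ⟨⊥, ⊤, fun hbt => ?_⟩
    have := h.toNontrivial
    refine bot_ne_top (α := Subrepresentation ρ) (Subrepresentation.toSubmodule_injective ?_)
    exact congrArg (Subrepresentation.toSubmodule (ρ := GLRep.detTwist N ρ)) hbt
  · let T : Subrepresentation ρ :=
      { toSubmodule := S.toSubmodule
        apply_mem_toSubmodule := fun g v hv => by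
          have := S.apply_mem_toSubmodule g hv
          rw [detTwist_apply] at this
          exact (Submodule.smul_mem_iff _ (hne g)).1 this }
    rcases h.eq_bot_or_eq_top T with hT | hT
    · left
      exact Subrepresentation.toSubmodule_injective
        (congrArg (Subrepresentation.toSubmodule (ρ := ρ)) hT)
    · right
      exact Subrepresentation.toSubmodule_injective
        (congrArg (Subrepresentation.toSubmodule (ρ := ρ)) hT)

theorem det_of_isUpper {b : GL (Fin n) ℂ} (hb : ∀ i j, j < i → b.val i j = 0) :
    b.val.det = ∏ i, b.val i i :=
  Matrix.det_of_isUpperTriangular fun _ _ hij => hb _ _ hij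

theorem prod_diag_zpow_add (N : ℕ) (κ : Fin n → ℤ) {b : GL (Fin n) ℂ}
    (hb : ∀ i j, j < i → b.val i j = 0) :
    ∏ i, b.val i i ^ (κ i + N) = b.val.det ^ N * ∏ i, b.val i i ^ κ i := by
  have hdet := det_of_isUpper hb
  have hne : ∀ i, b.val i i ≠ 0 := fun i => by
    have : b.val.det ≠ 0 := (Matrix.isUnits_det_units b).ne_zero
    rw [hdet] at this
    exact Finset.prod_ne_zero_iff.1 this i (Finset.mem_univ i)
  rw [hdet, ← Finset.prod_pow, ← Finset.prod_mul_distrib]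
  refine Finset.prod_congr rfl fun i _ => ?_
  rw [zpow_add₀ (hne i), zpow_natCast, mul_comm]

/-- The twist of a highest weight representation by a power of the determinant. -/
noncomputable def HighestWeightIrrep.detTwist {κ : Fin n → ℤ} (R : HighestWeightIrrep κ) (N : ℕ) :
    HighestWeightIrrep fun i => κ i + N where
  carrier := R.carrier
  rep := GLRep.detTwist N R.rep
  finiteDimensional := R.finiteDimensional
  isAlgebraic := R.isAlgebraic.detTwist N
  isIrreducible := isIrreducible_detTwist R.isIrreducible N
  exists_highestWeightVector := by
    obtain ⟨v, hv0, hv⟩ := R.exists_highestWeightVector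
    refine ⟨v, hv0, fun b hb => ?_⟩
    rw [detTwist_apply, hv b hb, smul_smul, prod_diag_zpow_add N κ hb]

theorem weightSpace_detTwist (N : ℕ) (ρ : Representation ℂ (GL (Fin n) ℂ) V) (κ : Fin n → ℤ) :
    weightSpace (detTwist N ρ) (fun i => κ i + N) = weightSpace ρ κ := by
  ext x
  refine forall₂_congr fun b hb => ?_
  have hne : b.val.det ^ N ≠ 0 := pow_ne_zero _ (Matrix.isUnits_det_units b).ne_zero
  have h1 : diagChar (fun i => κ i + N) b = b.val.det ^ N * diagChar κ b :=
    prod_diag_zpow_add N κ (diagonalSet_subset n hb)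
  rw [detTwist_apply, h1, mul_smul]
  exact smul_right_injective _ hne |>.eq_iff

/-- In a decomposition of `R` the highest weight count leaves only `ν`, once, so every model has the
dimensions of the chosen one. -/
theorem HighestWeightIrrep.finrank_semiInv_eq {ν : DominantWeight n} (R : HighestWeightIrrep ν.1)
    (S : Set (GL (Fin n) ℂ)) (χ : GL (Fin n) ℂ → ℂ) :
    Module.finrank ℂ (semiInv R.rep S χ) = Module.finrank ℂ (semiInv (irrep ν).rep S χ) := by
  obtain ⟨s, hs⟩ := R.isAlgebraic.exists_decomposition
  have hsing : s = {ν} := by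
    ext ν'
    rw [← sum_map_finrank_hwSpace, ← hs, R.finrank_hwSpace, Multiset.count_singleton]
    exact if_congr Subtype.ext_iff.symm rfl rfl
  rw [hs, hsing]
  simp

/-- The shift of a dominant weight by a multiple of `(1,…,1)`. -/
def DominantWeight.shift (ν : DominantWeight n) (N : ℕ) : DominantWeight n :=
  ⟨fun i => ν.1 i + N, fun _ _ h => add_le_add_left (ν.2 h) _⟩

theorem DominantWeight.shift_injective (N : ℕ) :
    Function.Injective fun ν : DominantWeight n => ν.shift N := by
  intro ν μ h
  refine Subtype.ext (funext fun i => ?_)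
  have := congrFun (congrArg Subtype.val h) i
  exact add_right_cancel this

theorem weightDim_shift (ν : DominantWeight n) (N : ℕ) (α : Fin n → ℤ) :
    weightDim (ν.shift N) (fun i => α i + N) = weightDim ν α := by
  rw [weightDim, ← HighestWeightIrrep.finrank_semiInv_eq (ν := ν.shift N) ((irrep ν).detTwist N)]
  exact congrArg (fun S : Submodule ℂ (irrep ν).carrier => Module.finrank ℂ S)
    (weightSpace_detTwist N (irrep ν).rep α)

end Twist

/-! ### The Weyl character formula -/

section Weyl

variable {r : ℕ}

/-- The weight `(r-1,…,1,0)`. -/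
def staircase (r : ℕ) (i : Fin r) : ℤ := (i.rev.1 : ℤ)

theorem staircase_strictAnti : StrictAnti (staircase r) := by
  intro i j h
  have := Fin.rev_lt_rev.2 h
  simp only [staircase]
  exact_mod_cast this

/-- The coefficient at `γ` of the product of the Vandermonde determinant with the Laurent series
whose coefficients are `f`. -/
def altSum (f : (Fin r → ℤ) → ℤ) (γ : Fin r → ℤ) : ℤ :=
  ∑ σ : Equiv.Perm (Fin r), (Equiv.Perm.sign σ : ℤ) * f (γ - staircase r ∘ σ)

/-- The coefficient at `γ` of the alternant with exponents `p`. -/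
def altCoeff (p γ : Fin r → ℤ) : ℤ :=
  ∑ σ : Equiv.Perm (Fin r), (Equiv.Perm.sign σ : ℤ) * if γ = p ∘ σ then 1 else 0

theorem altSum_comp_perm {f : (Fin r → ℤ) → ℤ} (hf : ∀ (σ : Equiv.Perm (Fin r)) α, f (α ∘ σ) = f α)
    (γ : Fin r → ℤ) (τ : Equiv.Perm (Fin r)) :
    altSum f (γ ∘ τ) = Equiv.Perm.sign τ * altSum f γ := by
  rw [altSum, altSum, Finset.mul_sum, ← Equiv.sum_comp (Equiv.mulRight τ)]
  refine Finset.sum_congr rfl fun σ _ => ?_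
  have : γ ∘ τ - staircase r ∘ (Equiv.mulRight τ σ) = (γ - staircase r ∘ σ) ∘ τ := rfl
  rw [this, hf, Equiv.coe_mulRight, Equiv.Perm.sign_mul, Units.val_mul]
  ring

theorem altCoeff_comp_perm (p γ : Fin r → ℤ) (τ : Equiv.Perm (Fin r)) :
    altCoeff p (γ ∘ τ) = Equiv.Perm.sign τ * altCoeff p γ := by
  rw [altCoeff, altCoeff, Finset.mul_sum, ← Equiv.sum_comp (Equiv.mulRight τ)]
  refine Finset.sum_congr rfl fun σ _ => ?_
  have : (γ ∘ τ = p ∘ (Equiv.mulRight τ σ)) ↔ γ = p ∘ σ := by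
    change γ ∘ τ = (p ∘ σ) ∘ τ ↔ _
    exact τ.surjective.injective_comp_right.eq_iff
  rw [if_congr this rfl rfl, Equiv.coe_mulRight, Equiv.Perm.sign_mul, Units.val_mul]
  ring

theorem altSum_eq_zero {f : (Fin r → ℤ) → ℤ} (hf : ∀ (σ : Equiv.Perm (Fin r)) α, f (α ∘ σ) = f α)
    {γ : Fin r → ℤ} (hγ : ¬ Function.Injective γ) : altSum f γ = 0 := by
  simp only [Function.Injective, not_forall] at hγ
  obtain ⟨i, j, h, hij⟩ := hγ
  have h1 : γ ∘ Equiv.swap i j = γ := by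
    funext k
    simp only [Function.comp_apply, Equiv.swap_apply_def]
    split_ifs with h2 h3
    · rw [h2, h]
    · rw [h3, h]
    · rfl
  have h2 := altSum_comp_perm hf γ (Equiv.swap i j)
  rw [h1, Equiv.Perm.sign_swap hij] at h2
  simp at h2
  omega

theorem altCoeff_eq_zero {p γ : Fin r → ℤ} (hp : Function.Injective p)
    (hγ : ¬ Function.Injective γ) : altCoeff p γ = 0 := by
  refine Finset.sum_eq_zero fun σ _ => ?_
  rw [if_neg, mul_zero]
  rintro rfl
  exact hγ (hp.comp σ.injective)

theorem strictAnti_add_staircase (ν : DominantWeight r) : StrictAnti (ν.1 + staircase r) :=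
  fun _ _ h => add_lt_add_of_le_of_lt (ν.2 h.le) (staircase_strictAnti h)

theorem perm_eq_one_of_strictAnti {p q : Fin r → ℤ} (hp : StrictAnti p) (hq : StrictAnti q)
    {σ : Equiv.Perm (Fin r)} (h : q = p ∘ σ) : σ = 1 := by
  have hmono : StrictMono σ := fun i j hij => by
    have := hq hij
    rw [h] at this
    exact hp.lt_iff_gt.1 this
  have := Subsingleton.elim (hmono.orderIsoOfSurjective σ σ.surjective) (OrderIso.refl (Fin r))
  exact Equiv.ext fun i => DFunLike.congr_fun this i

theorem altCoeff_staircase [DecidableEq (DominantWeight r)] (ν μ : DominantWeight r) :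
    altCoeff (ν.1 + staircase r) (μ.1 + staircase r) = if ν = μ then 1 else 0 := by
  rw [altCoeff, Finset.sum_eq_single 1]
  · rw [Equiv.Perm.sign_one, Units.val_one, one_mul]
    refine if_congr ⟨fun h => ?_, fun h => ?_⟩ rfl rfl
    · exact Subtype.ext (add_right_cancel h).symm
    · rw [h]; rfl
  · intro σ _ hσ
    rw [if_neg, mul_zero]
    exact fun h => hσ (perm_eq_one_of_strictAnti (strictAnti_add_staircase ν)
      (strictAnti_add_staircase μ) h)
  · simp

/-- Sort the entries downwards; distinct integers drop by at least 1 at each step, so the sequence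
stays decreasing after subtraction of the staircase. -/
theorem exists_perm_strictAnti {γ : Fin r → ℤ} (hγ : Function.Injective γ) :
    ∃ (τ : Equiv.Perm (Fin r)) (μ : DominantWeight r), γ ∘ τ = μ.1 + staircase r := by
  let τ := Tuple.sort fun i => -γ i
  have h1 : Antitone (γ ∘ τ) := fun i j h => by
    have := Tuple.monotone_sort (fun i => -γ i) h
    simpa using this
  have h2 : StrictAnti (γ ∘ τ) := h1.strictAnti_of_injective (hγ.comp τ.injective)
  refine ⟨τ, ⟨γ ∘ τ - staircase r, ?_⟩, (sub_add_cancel _ _).symm⟩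
  have h3 : ∀ (d : ℕ) (i j : Fin r), i.1 + d = j.1 → (γ ∘ τ) j + d ≤ (γ ∘ τ) i := by
    intro d
    induction d with
    | zero => intro i j h; rw [Fin.ext (show i.1 = j.1 from h)]; simp
    | succ d ih =>
      intro i j h
      have hlt : i.1 + d < r := by have := j.2; omega
      have h4 := ih i ⟨i.1 + d, hlt⟩ rfl
      have h5 : (γ ∘ τ) j < (γ ∘ τ) ⟨i.1 + d, hlt⟩ := h2 (Fin.lt_def.2 (by simp only; omega))
      push_cast
      omega
  intro i j hij
  have h4 := h3 (j.1 - i.1) i j (by have := Fin.le_def.1 hij; omega)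
  have hij' := Fin.le_def.1 hij
  simp only [Pi.sub_apply, staircase, Fin.val_rev]
  have := j.2
  omega

theorem weightDim_comp_perm (ν : DominantWeight r) (σ : Equiv.Perm (Fin r)) (α : Fin r → ℤ) :
    weightDim ν (α ∘ σ) = weightDim ν α := finrank_weightSpace_perm _ σ α

theorem heightPairing_add (α β : Fin r → ℤ) :
    heightPairing (α + β) = heightPairing α + heightPairing β := by
  simp [heightPairing, mul_add, Finset.sum_add_distrib]

/-- The height is the pairing with the staircase δ, and permuting δ keeps its norm, so twice the
height of δ - δ∘σ is the squared norm of that difference. -/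
theorem heightPairing_staircase_perm_lt {σ : Equiv.Perm (Fin r)} (hσ : σ ≠ 1) :
    0 < heightPairing (staircase r - staircase r ∘ σ) := by
  have h1 : ∑ i, staircase r (σ i) * staircase r (σ i) = ∑ i, staircase r i * staircase r i :=
    Equiv.sum_comp σ fun i => staircase r i * staircase r i
  have h2 : 2 * heightPairing (staircase r - staircase r ∘ σ) =
      ∑ i, (staircase r i - staircase r (σ i)) ^ 2 := by
    have : ∑ i, (staircase r i - staircase r (σ i)) ^ 2 =
        ∑ i, (2 * (staircase r i * (staircase r i - staircase r (σ i))) +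
          (staircase r (σ i) * staircase r (σ i) - staircase r i * staircase r i)) :=
      Finset.sum_congr rfl fun i _ => by ring
    rw [this, Finset.sum_add_distrib, Finset.sum_sub_distrib, h1, sub_self, add_zero,
      ← Finset.mul_sum]
    rfl
  have h3 : 0 < ∑ i, (staircase r i - staircase r (σ i)) ^ 2 := by
    refine Finset.sum_pos' (fun i _ => sq_nonneg _) ?_
    by_contra! hcon
    refine hσ (Equiv.ext fun i => ?_)
    have := pow_eq_zero_iff two_ne_zero |>.1 (le_antisymm (hcon i (Finset.mem_univ i)) (sq_nonneg _))
    exact (staircase_strictAnti.injective (sub_eq_zero.1 this)).symm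
  omega

/-- For `σ ≠ 1` the weight in question is higher than `ν`, hence does not occur; the remaining term
is the one-dimensional highest weight space. -/
theorem altSum_weightDim_self (ν : DominantWeight r) :
    altSum (fun α => weightDim ν α) (ν.1 + staircase r) = 1 := by
  rw [altSum, Finset.sum_eq_single 1]
  · have : ν.1 + staircase r - staircase r ∘ (1 : Equiv.Perm (Fin r)) = ν.1 :=
      add_sub_cancel_right _ _
    rw [this, Equiv.Perm.sign_one, weightDim, (irrep ν).finrank_weightSpace_self]
    simp
  · intro σ _ hσ
    have h0 : weightDim ν (ν.1 + staircase r - staircase r ∘ σ) = 0 := by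
      rw [weightDim, Submodule.finrank_eq_zero]
      by_contra h
      have h1 := (irrep ν).maximal_weight.1 _ h
      rw [add_sub_assoc, heightPairing_add] at h1
      have := heightPairing_staircase_perm_lt hσ
      omega
    rw [h0]
    simp
  · simp

/-- Antisymmetrising Cauchy's identity in both arguments at μ + δ gives a sum of squares of integers
over all `κ`, and Cauchy's determinant evaluates it to 1. The term of `μ` alone is 1, so the others
vanish. -/
theorem altSum_weightDim_eq_zero_of_nonneg {ν μ : DominantWeight r} (hν : ∀ i, 0 ≤ ν.1 i)
    (hμ : ∀ i, 0 ≤ μ.1 i) (hne : ν ≠ μ) :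
    altSum (fun α => weightDim ν α) (μ.1 + staircase r) = 0 := by
  classical
  set p : Fin r → ℕ := fun i => (μ.1 i + staircase r i).toNat with hp
  have hpc : ∀ i, (p i : ℤ) = μ.1 i + staircase r i := fun i =>
    Int.toNat_of_nonneg (add_nonneg (hμ i) (Int.natCast_nonneg _))
  have hinj : Function.Injective p := fun i j h => by
    refine (strictAnti_add_staircase μ).injective ?_
    have : (p i : ℤ) = p j := by rw [h]
    rwa [hpc, hpc] at this
  have hα : ∀ σ : Equiv.Perm (Fin r), (fun i => (p i : ℤ) - (σ i).rev.1) =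
      μ.1 + staircase r - staircase r ∘ σ := fun σ => funext fun i => by rw [hpc]; rfl
  have hT : ∀ σ : Equiv.Perm (Fin r), ∃ K : Finset (DominantWeight r),
      (∀ κ ∈ K, ∀ i, 0 ≤ κ.1 i) ∧ (∀ κ : DominantWeight r, (∀ i, 0 ≤ κ.1 i) →
        weightDim κ (μ.1 + staircase r - staircase r ∘ σ) ≠ 0 → κ ∈ K) ∧
      ∀ β, tableCount (μ.1 + staircase r - staircase r ∘ σ) β =
        ∑ κ ∈ K, weightDim κ (μ.1 + staircase r - staircase r ∘ σ) * weightDim κ β :=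
    fun σ => tableCount_eq_sum _
  choose K hK0 hK1 hK2 using hT
  -- A finite index set common to all permutations; the added terms have weight multiplicity zero.
  set L := Finset.univ.biUnion K with hL
  have hL0 : ∀ κ ∈ L, ∀ i, 0 ≤ κ.1 i := fun κ hκ => by
    obtain ⟨σ, -, h⟩ := Finset.mem_biUnion.1 hκ
    exact hK0 σ κ h
  have hL2 : ∀ (σ : Equiv.Perm (Fin r)) β, tableCount (μ.1 + staircase r - staircase r ∘ σ) β =
      ∑ κ ∈ L, weightDim κ (μ.1 + staircase r - staircase r ∘ σ) * weightDim κ β := by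
    intro σ β
    rw [hK2 σ]
    refine Finset.sum_subset (Finset.subset_biUnion_of_mem K (Finset.mem_univ σ)) fun κ hκ hκ' => ?_
    have : weightDim κ (μ.1 + staircase r - staircase r ∘ σ) = 0 := by
      by_contra h
      exact hκ' (hK1 σ κ (hL0 κ hκ) h)
    rw [this, zero_mul]
  have hsum : ∑ κ ∈ L, altSum (fun α => weightDim κ α) (μ.1 + staircase r) ^ 2 = 1 := by
    rw [← sum_sign_tableCount hinj]
    simp only [hα, hL2]
    have hsq : ∀ κ : DominantWeight r, altSum (fun α => weightDim κ α) (μ.1 + staircase r) ^ 2 =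
        ∑ σ : Equiv.Perm (Fin r), ∑ τ : Equiv.Perm (Fin r),
          (Equiv.Perm.sign σ : ℤ) * (Equiv.Perm.sign τ : ℤ) *
            (weightDim κ (μ.1 + staircase r - staircase r ∘ σ) *
              weightDim κ (μ.1 + staircase r - staircase r ∘ τ)) := by
      intro κ
      rw [pow_two, altSum, Finset.sum_mul_sum]
      exact Finset.sum_congr rfl fun σ _ => Finset.sum_congr rfl fun τ _ => by ring
    rw [Finset.sum_congr rfl fun κ _ => hsq κ, Finset.sum_comm]
    refine Finset.sum_congr rfl fun σ _ => ?_
    rw [Finset.sum_comm]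
    refine Finset.sum_congr rfl fun τ _ => ?_
    rw [Nat.cast_sum, Finset.mul_sum]
    exact Finset.sum_congr rfl fun κ _ => by rw [Nat.cast_mul]
  have hmem : ∀ κ : DominantWeight r, (∀ i, 0 ≤ κ.1 i) →
      altSum (fun α => weightDim κ α) (μ.1 + staircase r) ≠ 0 → κ ∈ L := by
    intro κ hκ h
    obtain ⟨σ, -, hσ⟩ := Finset.exists_ne_zero_of_sum_ne_zero h
    refine Finset.mem_biUnion.2 ⟨σ, Finset.mem_univ σ, hK1 σ κ hκ ?_⟩
    have h0 : ((weightDim κ (μ.1 + staircase r - staircase r ∘ σ) : ℕ) : ℤ) ≠ 0 :=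
      right_ne_zero_of_mul hσ
    exact_mod_cast h0
  by_contra hcon
  have hμL : μ ∈ L := hmem μ hμ (by rw [altSum_weightDim_self]; exact one_ne_zero)
  have hνL : ν ∈ L := hmem ν hν hcon
  -- The squares of `ν` and `μ` together are at most 1, while that of `μ` is already 1.
  have h1 : ∑ κ ∈ ({ν, μ} : Finset _), altSum (fun α => weightDim κ α) (μ.1 + staircase r) ^ 2 ≤ 1 := by
    rw [← hsum]
    refine Finset.sum_le_sum_of_subset_of_nonneg ?_ fun _ _ _ => sq_nonneg _
    intro κ hκ
    rcases Finset.mem_insert.1 hκ with rfl | hκ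
    · exact hνL
    · rwa [Finset.mem_singleton.1 hκ]
  rw [Finset.sum_pair hne, altSum_weightDim_self] at h1
  have := pow_pos (abs_pos.2 hcon) 2
  rw [sq_abs] at this
  omega

/-- Twisting by a power of the determinant shifts both weights alike, which reduces the claim to
nonnegative entries. -/
theorem altSum_weightDim_staircase [DecidableEq (DominantWeight r)] (ν μ : DominantWeight r) :
    altSum (fun α => weightDim ν α) (μ.1 + staircase r) = if ν = μ then 1 else 0 := by
  split_ifs with h
  · rw [h, altSum_weightDim_self]
  · set N : ℕ := ∑ i, ((ν.1 i).natAbs + (μ.1 i).natAbs) with hN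
    have hle : ∀ i, (ν.1 i).natAbs + (μ.1 i).natAbs ≤ N := fun i =>
      Finset.single_le_sum (f := fun i => (ν.1 i).natAbs + (μ.1 i).natAbs) (fun _ _ => Nat.zero_le _)
        (Finset.mem_univ i)
    have h1 : ∀ i, 0 ≤ (ν.shift N).1 i := fun i => by
      have := hle i
      simp only [DominantWeight.shift]
      omega
    have h2 : ∀ i, 0 ≤ (μ.shift N).1 i := fun i => by
      have := hle i
      simp only [DominantWeight.shift]
      omega
    rw [← altSum_weightDim_eq_zero_of_nonneg h1 h2 fun h3 => h (DominantWeight.shift_injective N h3)]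
    refine Finset.sum_congr rfl fun σ _ => ?_
    beta_reduce
    rw [← weightDim_shift ν N]
    congr 4
    funext i
    simp only [DominantWeight.shift, Pi.add_apply, Pi.sub_apply]
    ring

/-- The Weyl character formula. -/
theorem altSum_weightDim (ν : DominantWeight r) (γ : Fin r → ℤ) :
    altSum (fun α => weightDim ν α) γ = altCoeff (ν.1 + staircase r) γ := by
  classical
  have hinv : ∀ (σ : Equiv.Perm (Fin r)) (α : Fin r → ℤ),
      ((weightDim ν (α ∘ σ) : ℕ) : ℤ) = weightDim ν α := fun σ α => by rw [weightDim_comp_perm]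
  -- Both sides are alternating in `γ`: they vanish if two entries agree, and otherwise sorting
  -- reduces to μ + δ with μ dominant.
  by_cases hγ : Function.Injective γ
  · obtain ⟨τ, μ, h⟩ := exists_perm_strictAnti hγ
    have h1 := altSum_comp_perm (f := fun α => weightDim ν α) hinv γ τ
    have h2 := altCoeff_comp_perm (ν.1 + staircase r) γ τ
    rw [h, altSum_weightDim_staircase] at h1
    rw [h, altCoeff_staircase, h1] at h2
    exact mul_left_cancel₀ (Units.ne_zero _) h2
  · rw [altSum_eq_zero (f := fun α => weightDim ν α) hinv hγ, altCoeff_eq_zero (strictAnti_add_staircase ν).injective hγ]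

end Weyl

end GLRep

namespace GLRep

/-! ### Duals and tensor products of algebraic representations -/

section Tensor

variable {n : ℕ} {V W : Type*} [AddCommGroup V] [Module ℂ V] [AddCommGroup W] [Module ℂ W]

theorem isRegular_det {M : GL (Fin n) ℂ → Matrix (Fin n) (Fin n) ℂ}
    (hM : ∀ i j, IsRegular fun g => M g i j) : IsRegular fun g => (M g).det := by
  simp only [Matrix.det_apply']
  exact IsRegular.sum _ fun σ _ => (IsRegular.const _).mul (IsRegular.prod _ fun i _ => hM _ _)

theorem isRegular_inv_entry (i j : Fin n) :
    IsRegular fun g : GL (Fin n) ℂ => (g⁻¹).val i j := by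
  have h : ∀ g : GL (Fin n) ℂ, (g⁻¹).val i j =
      (g.val.det)⁻¹ ^ 1 * (g.val.updateRow j (Pi.single i 1)).det := by
    intro g
    rw [Matrix.coe_units_inv, Matrix.inv_def, Matrix.smul_apply, Matrix.adjugate_apply,
      Ring.inverse_eq_inv', pow_one, smul_eq_mul]
  simp only [h]
  refine (IsRegular.invDet 1).mul (isRegular_det fun k l => ?_)
  by_cases hk : k = j
  · subst hk
    simp only [Matrix.updateRow_self]
    exact IsRegular.const _
  · simp only [Matrix.updateRow_ne hk]
    exact IsRegular.entry k l

theorem IsRegular.comp_inv {f : GL (Fin n) ℂ → ℂ} (hf : IsRegular f) :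
    IsRegular fun g => f g⁻¹ := by
  obtain ⟨p, m, hp⟩ := hf
  have h : ∀ g : GL (Fin n) ℂ, ((g⁻¹).val.det)⁻¹ = g.val.det := by
    intro g
    rw [Matrix.coe_units_inv, Matrix.det_nonsing_inv, Ring.inverse_eq_inv', inv_inv]
  simp only [hp, h]
  refine IsRegular.mul ?_ (isRegular_det_pow m)
  clear hp
  induction p using MvPolynomial.induction_on with
  | C a => simpa using IsRegular.const a
  | add p q hp hq => simpa using hp.add hq
  | mul_X p ij hp => simpa using hp.mul (isRegular_inv_entry ij.1 ij.2)

variable {ρ : Representation ℂ (GL (Fin n) ℂ) V} {σ : Representation ℂ (GL (Fin n) ℂ) W}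

theorem IsAlgebraic.dual [FiniteDimensional ℂ V] (hρ : IsAlgebraic ρ) : IsAlgebraic ρ.dual := by
  intro f φ
  obtain ⟨v, rfl⟩ := (Module.evalEquiv ℂ V).surjective φ
  exact (hρ v f).comp_inv

theorem IsAlgebraic.tprod [FiniteDimensional ℂ V] [FiniteDimensional ℂ W] (hρ : IsAlgebraic ρ)
    (hσ : IsAlgebraic σ) : IsAlgebraic (ρ.tprod σ) := by
  intro x φ
  induction x using TensorProduct.induction_on with
  | zero => simpa using IsRegular.const 0
  | add x y hx hy => simpa using hx.add hy
  | tmul v w =>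
    let b := Module.finBasis ℂ V
    let c := Module.finBasis ℂ W
    have h : ∀ g, φ (ρ.tprod σ g (v ⊗ₜ w)) =
        ∑ i, ∑ j, b.coord i (ρ g v) * c.coord j (σ g w) * φ (b i ⊗ₜ c j) := by
      intro g
      change φ (ρ g v ⊗ₜ σ g w) = _
      conv_lhs => rw [← b.sum_repr (ρ g v), ← c.sum_repr (σ g w)]
      rw [TensorProduct.sum_tmul, map_sum]
      refine Finset.sum_congr rfl fun i _ => ?_
      rw [TensorProduct.tmul_sum, map_sum]
      refine Finset.sum_congr rfl fun j _ => ?_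
      rw [TensorProduct.smul_tmul_smul, map_smul, smul_eq_mul]
      rfl
    simp only [h]
    exact IsRegular.sum _ fun i _ => IsRegular.sum _ fun j _ =>
      ((hρ v _).mul (hσ w _)).mul (IsRegular.const _)

theorem finrank_weightSpace_eq_zero [FiniteDimensional ℂ V] {κ : Fin n → ℤ}
    (h : κ ∉ (finite_weights ρ).toFinset) : Module.finrank ℂ (weightSpace ρ κ) = 0 := by
  rw [Set.Finite.mem_toFinset, Set.mem_ofPred_eq, not_not] at h
  rw [h, finrank_bot]

/-- Weight multiplicities in a tensor product with a dual representation. -/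
theorem finrank_weightSpace_dual_tprod [FiniteDimensional ℂ V] [FiniteDimensional ℂ W]
    (hρ : IsAlgebraic ρ) (hσ : IsAlgebraic σ) (κ : Fin n → ℤ) :
    Module.finrank ℂ (weightSpace (ρ.dual.tprod σ) κ) = ∑ α ∈ (finite_weights ρ).toFinset,
      Module.finrank ℂ (weightSpace ρ α) * Module.finrank ℂ (weightSpace σ (κ + α)) := by
  classical
  set Q := ρ.dual.tprod σ with hQ
  have hQa : IsAlgebraic Q := hρ.dual.tprod hσ
  let F : (Fin n → ℤ) →₀ ℂ := ∑ κ ∈ (finite_weights Q).toFinset,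
    Finsupp.single κ (Module.finrank ℂ (weightSpace Q κ) : ℂ)
  let G : (Fin n → ℤ) →₀ ℂ := ∑ α ∈ (finite_weights ρ).toFinset, ∑ β ∈ (finite_weights σ).toFinset,
    Finsupp.single (β - α)
      ((Module.finrank ℂ (weightSpace ρ α) : ℂ) * Module.finrank ℂ (weightSpace σ β))
  -- Both sides are the coefficients of the trace of a torus element, expanded in characters, which
  -- are linearly independent; the dual enters through the trace at the inverse.
  have hFG : F = G := by
    refine linearIndependent_torusChar n ?_
    simp only [F, G, map_sum, Finsupp.linearCombination_single]
    funext t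
    simp only [Finset.sum_apply, Pi.smul_apply, smul_eq_mul]
    rw [← hQa.trace_torus t, hQ, Representation.tprod_apply, LinearMap.trace_tensorProduct',
      Representation.dual_apply, LinearMap.trace_transpose', ← map_inv, hρ.trace_torus,
      hσ.trace_torus, Finset.sum_mul_sum]
    refine Finset.sum_congr rfl fun α _ => Finset.sum_congr rfl fun β _ => ?_
    have h1 : torusChar (β - α) t * torusChar α t = torusChar β t := by
      rw [← torusChar_add, sub_add_cancel]
    have h2 : torusChar α t⁻¹ * torusChar α t = 1 := by
      rw [← map_mul, inv_mul_cancel, map_one]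
    rw [← h1]
    linear_combination (Module.finrank ℂ (weightSpace ρ α) : ℂ) *
      Module.finrank ℂ (weightSpace σ β) * torusChar (β - α) t * h2
  have h1 : F κ = Module.finrank ℂ (weightSpace Q κ) := by
    simp only [F, Finsupp.finsetSum_apply, Finsupp.single_apply, Finset.sum_ite_eq']
    split_ifs with h
    · rfl
    · rw [finrank_weightSpace_eq_zero h, Nat.cast_zero]
  have h2 : G κ = ((∑ α ∈ (finite_weights ρ).toFinset, Module.finrank ℂ (weightSpace ρ α) *
      Module.finrank ℂ (weightSpace σ (κ + α)) : ℕ) : ℂ) := by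
    simp only [G, Finsupp.finsetSum_apply, Finsupp.single_apply, sub_eq_iff_eq_add,
      Finset.sum_ite_eq', Nat.cast_sum, Nat.cast_mul]
    refine Finset.sum_congr rfl fun α _ => ?_
    split_ifs with h
    · rfl
    · rw [finrank_weightSpace_eq_zero h, Nat.cast_zero, mul_zero]
  rw [hFG, h2] at h1
  exact_mod_cast h1.symm

end Tensor

/-! ### The multiplicities -/

section Multiplicity

variable {r : ℕ}

/-- The weights of an irreducible representation. -/
noncomputable def weights (ν : DominantWeight r) : Finset (Fin r → ℤ) :=
  (finite_weights (irrep ν).rep).toFinset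

theorem weightDim_eq_zero {ν : DominantWeight r} {α : Fin r → ℤ} (h : α ∉ weights ν) :
    weightDim ν α = 0 := finrank_weightSpace_eq_zero h

theorem sum_weights_mul_ite (ν : DominantWeight r) (β : Fin r → ℤ) :
    ∑ α ∈ weights ν, (weightDim ν α : ℤ) * (if α = β then 1 else 0) = weightDim ν β := by
  classical
  simp only [mul_ite, mul_one, mul_zero, Finset.sum_ite_eq']
  split_ifs with h
  · rfl
  · rw [weightDim_eq_zero h, Nat.cast_zero]

/-- Convolution of weight multiplicities is commutative, as for the characters of ρ_ν ⊗ ρ_μ. -/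
theorem sum_weights_mul_comm (ν μ : DominantWeight r) (γ : Fin r → ℤ) :
    ∑ α ∈ weights ν, (weightDim ν α : ℤ) * weightDim μ (γ - α) =
      ∑ β ∈ weights μ, (weightDim μ β : ℤ) * weightDim ν (γ - β) := by
  classical
  simp only [← sum_weights_mul_ite μ (γ - _), ← sum_weights_mul_ite ν (γ - _), Finset.mul_sum]
  rw [Finset.sum_comm]
  refine Finset.sum_congr rfl fun β _ => Finset.sum_congr rfl fun α _ => ?_
  have : β = γ - α ↔ α = γ - β := by
    rw [eq_sub_iff_add_eq, eq_sub_iff_add_eq, add_comm]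
  rw [if_congr this rfl rfl]
  ring

/-- By the character formula, the alternating sum at ν + δ isolates the contribution of `ν`;
multiplicities are thus determined by weight multiplicities. -/
theorem altSum_multiset (s : Multiset (DominantWeight r)) (ν : DominantWeight r) :
    altSum (fun κ => ((s.map fun ν' => weightDim ν' κ).sum : ℕ)) (ν.1 + staircase r) = s.count ν := by
  classical
  induction s using Multiset.induction_on with
  | empty => simp [altSum]
  | cons a s ih =>
    have := altSum_weightDim_staircase a ν
    simp only [altSum] at ih this ⊢
    simp only [Multiset.map_cons, Multiset.sum_cons, Nat.cast_add, mul_add,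
      Finset.sum_add_distrib, ih, this, Multiset.count_cons]
    rw [add_comm]
    push_cast
    congr 1
    exact if_congr eq_comm rfl rfl

theorem tensorMultiplicity_eq_altSum (lam mu nu : DominantWeight r) :
    (tensorMultiplicity lam mu nu : ℤ) = altSum (fun κ => (∑ α ∈ weights lam,
      weightDim lam α * weightDim mu (κ + α) : ℕ)) (nu.1 + staircase r) := by
  have hQ : IsAlgebraic ((irrep lam).rep.dual.tprod (irrep mu).rep) :=
    (irrep lam).isAlgebraic.dual.tprod (irrep mu).isAlgebraic
  obtain ⟨s, hs⟩ := hQ.exists_decomposition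
  rw [tensorMultiplicity, (irrep nu).multiplicity_eq hQ, hs, sum_map_finrank_hwSpace,
    ← altSum_multiset]
  congr 1
  funext κ
  congr 1
  exact (hs _ _).symm.trans
    (finrank_weightSpace_dual_tprod (irrep lam).isAlgebraic (irrep mu).isAlgebraic κ)

/-- By the character formula for `mu`, the alternating sum is supported on the permutations of μ +
δ, which pins `α` to one value for each `w`. -/
theorem sum_sign_weightDim_eq (lam mu nu : DominantWeight r) :
    ∑ w : Equiv.Perm (Fin r), (Equiv.Perm.sign w : ℤ) *
      weightDim lam ((mu.1 + staircase r) ∘ w - (nu.1 + staircase r)) =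
    ∑ α ∈ weights lam, (weightDim lam α : ℤ) *
      altSum (fun β => weightDim mu β) (nu.1 + staircase r + α) := by
  simp only [altSum_weightDim, altCoeff, Finset.mul_sum]
  rw [Finset.sum_comm]
  refine Finset.sum_congr rfl fun w _ => ?_
  rw [← sum_weights_mul_ite, Finset.mul_sum]
  refine Finset.sum_congr rfl fun α _ => ?_
  have : α = (mu.1 + staircase r) ∘ w - (nu.1 + staircase r) ↔
      nu.1 + staircase r + α = (mu.1 + staircase r) ∘ w := by
    rw [eq_sub_iff_add_eq, add_comm]
  rw [if_congr this rfl rfl]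
  ring

/-- The Brauer–Klimyk formula, by interchanging the sum over the weights of ρ_λ with the alternating
sum. -/
theorem tensorMultiplicity_eq (lam mu nu : DominantWeight r) :
    (tensorMultiplicity lam mu nu : ℤ) = ∑ w : Equiv.Perm (Fin r), (Equiv.Perm.sign w : ℤ) *
      weightDim lam ((mu.1 + staircase r) ∘ w - (nu.1 + staircase r)) := by
  rw [tensorMultiplicity_eq_altSum, sum_sign_weightDim_eq]
  simp only [altSum, Nat.cast_sum, Nat.cast_mul, Finset.mul_sum]
  rw [Finset.sum_comm]
  refine Finset.sum_congr rfl fun α _ => Finset.sum_congr rfl fun σ _ => ?_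
  rw [sub_add_eq_add_sub]
  ring

/-- The right side is the alternating sum, at μ + δ, of the weight multiplicities of ρ_λ ⊗ ρ_ν. It
is symmetric in λ and ν, which is what allows their roles to be exchanged. -/
theorem sum_sign_weightDim_eq_conv (lam mu nu : DominantWeight r) :
    ∑ w : Equiv.Perm (Fin r), (Equiv.Perm.sign w : ℤ) *
      weightDim lam ((mu.1 + staircase r) ∘ w - (nu.1 + staircase r)) =
    ∑ σ : Equiv.Perm (Fin r), (Equiv.Perm.sign σ : ℤ) * ∑ α ∈ weights lam, (weightDim lam α : ℤ) *
      weightDim nu (mu.1 + staircase r - staircase r ∘ σ - α) := by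
  have h1 : ∑ σ : Equiv.Perm (Fin r), (Equiv.Perm.sign σ : ℤ) * ∑ α ∈ weights lam,
      (weightDim lam α : ℤ) * weightDim nu (mu.1 + staircase r - staircase r ∘ σ - α) =
      ∑ α ∈ weights lam, (weightDim lam α : ℤ) *
        altSum (fun β => weightDim nu β) (mu.1 + staircase r - α) := by
    simp only [altSum, Finset.mul_sum]
    rw [Finset.sum_comm]
    refine Finset.sum_congr rfl fun α _ => Finset.sum_congr rfl fun σ _ => ?_
    rw [sub_right_comm]
    ring
  rw [h1]
  simp only [altSum_weightDim, altCoeff, Finset.mul_sum]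
  -- The character formula for `nu` permutes ν + δ instead of μ + δ; inverting `w` and the symmetry
  -- of weight multiplicities reconcile the two.
  rw [Finset.sum_comm, ← Equiv.sum_comp (Equiv.inv (Equiv.Perm (Fin r)))]
  refine Finset.sum_congr rfl fun w _ => ?_
  have h2 : (mu.1 + staircase r) ∘ (w⁻¹ : Equiv.Perm (Fin r)) - (nu.1 + staircase r) =
      (mu.1 + staircase r - (nu.1 + staircase r) ∘ w) ∘ (w⁻¹ : Equiv.Perm (Fin r)) := by
    funext i
    simp
  rw [Equiv.inv_apply, h2, weightDim_comp_perm, Equiv.Perm.sign_inv, ← sum_weights_mul_ite,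
    Finset.mul_sum]
  refine Finset.sum_congr rfl fun α _ => ?_
  have : α = mu.1 + staircase r - (nu.1 + staircase r) ∘ w ↔
      mu.1 + staircase r - α = (nu.1 + staircase r) ∘ w := by
    rw [eq_sub_iff_add_eq, sub_eq_iff_eq_add, add_comm, eq_comm]
  rw [if_congr this rfl rfl]
  ring

/-- The multiplicity of `ρ_ν` in `ρ_λ^∨ ⊗ ρ_μ` in terms of the weights of `ρ_ν`. -/
theorem tensorMultiplicity_eq_sum_weightDim (lam mu nu : DominantWeight r) :
    (tensorMultiplicity lam mu nu : ℤ) = ∑ w : Equiv.Perm (Fin r), (Equiv.Perm.sign w : ℤ) *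
      weightDim nu ((mu.1 + staircase r) ∘ w - (lam.1 + staircase r)) := by
  rw [tensorMultiplicity_eq, sum_sign_weightDim_eq_conv, sum_sign_weightDim_eq_conv]
  simp only [sum_weights_mul_comm lam nu]

end Multiplicity

/-! ### Expansion of the determinant and the main theorem -/

/-- Reversing the order of rows and columns turns both strict sequences into the weight plus
staircase plus 1; the ones cancel in the differences, and the Leibniz formula remains. -/
theorem det_intBinom (r n : ℕ) (lam mu : DominantWeight r) :
    (Matrix.of fun i j : Fin r =>
        intBinom (n + strictSeq mu.1 i - strictSeq lam.1 j - 1)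
          (strictSeq mu.1 i - strictSeq lam.1 j)).det =
      ∑ w : Equiv.Perm (Fin r), (Equiv.Perm.sign w : ℤ) * ∏ i, intBinom
        (n + ((mu.1 + staircase r) ∘ w - (lam.1 + staircase r)) i - 1)
        (((mu.1 + staircase r) ∘ w - (lam.1 + staircase r)) i) := by
  rw [← Matrix.det_submatrix_equiv_self Fin.revPerm, Matrix.det_apply']
  refine Finset.sum_congr rfl fun w _ => ?_
  congr 1
  refine Finset.prod_congr rfl fun i _ => ?_
  have h : strictSeq mu.1 (w i).rev - strictSeq lam.1 i.rev =
      ((mu.1 + staircase r) ∘ w - (lam.1 + staircase r)) i := by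
    simp only [strictSeq, staircase, Fin.rev_rev, Pi.sub_apply, Function.comp_apply,
      Pi.add_apply]
    push_cast
    ring
  simp only [Matrix.submatrix_apply, Matrix.of_apply, Fin.revPerm_apply, add_sub_assoc]
  rw [← h]

end GLRep

theorem mainTheorem3 (r n : ℕ) (hrn : r < n) (lam mu : GLRep.DominantWeight r)
    (hlam : lam ∈ GLRep.boxWeights r n) (hmu : mu ∈ GLRep.boxWeights r n) :
    {nu : GLRep.DominantWeight r | GLRep.truncatedMultiplicity lam mu nu ≠ 0}.Finite ∧
    (Matrix.of fun i j : Fin r =>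
        GLRep.intBinom (n + GLRep.strictSeq mu.1 i - GLRep.strictSeq lam.1 j - 1)
          (GLRep.strictSeq mu.1 i - GLRep.strictSeq lam.1 j)).det
      = ((∑ᶠ nu : GLRep.DominantWeight r,
          GLRep.truncatedMultiplicity lam mu nu * GLRep.dimR n nu.1 : ℕ) : ℤ) := by
  classical
  let α : Equiv.Perm (Fin r) → Fin r → ℤ := fun w =>
    (mu.1 + GLRep.staircase r) ∘ w - (lam.1 + GLRep.staircase r)
  choose K hK0 hK1 hK2 using fun w => GLRep.prod_intBinom_eq_sum hrn.le (by omega : 0 < n) (α w)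
  -- One finite set of weights serving all terms of the determinant; enlarging `K w` adds only terms
  -- with zero weight multiplicity.
  set L := Finset.univ.biUnion K with hL
  have hL0 : ∀ κ ∈ L, ∀ i, 0 ≤ κ.1 i := fun κ hκ => by
    obtain ⟨σ, -, h⟩ := Finset.mem_biUnion.1 hκ
    exact hK0 σ κ h
  have hL2 : ∀ w, ∏ i, GLRep.intBinom (n + α w i - 1) (α w i) =
      ∑ κ ∈ L, (GLRep.weightDim κ (α w) : ℤ) * GLRep.dimR n κ.1 := by
    intro w
    rw [hK2 w]
    refine Finset.sum_subset (Finset.subset_biUnion_of_mem K (Finset.mem_univ w)) fun κ hκ hκ' => ?_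
    have : GLRep.weightDim κ (α w) = 0 := by
      by_contra h
      exact hκ' (hK1 w κ (hL0 κ hκ) h)
    rw [this, Nat.cast_zero, zero_mul]
  -- A nonzero multiplicity makes some term of the signed sum of weight multiplicities of ρ_ν
  -- nonzero, so `nu` is in the corresponding `K w`. This gives finiteness.
  have hsub : ∀ nu, GLRep.truncatedMultiplicity lam mu nu ≠ 0 → nu ∈ L := by
    intro nu h
    rw [GLRep.truncatedMultiplicity, ite_ne_right_iff] at h
    obtain ⟨h0, h⟩ := h
    have h' : (GLRep.tensorMultiplicity lam mu nu : ℤ) ≠ 0 := Nat.cast_ne_zero.2 h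
    rw [GLRep.tensorMultiplicity_eq_sum_weightDim] at h'
    obtain ⟨w, -, hw⟩ := Finset.exists_ne_zero_of_sum_ne_zero h'
    exact Finset.mem_biUnion.2 ⟨w, Finset.mem_univ w,
      hK1 w nu h0 (Nat.cast_ne_zero.1 (right_ne_zero_of_mul hw))⟩
  refine ⟨L.finite_toSet.subset hsub, ?_⟩
  rw [finsum_eq_sum_of_support_subset (s := L) _ fun nu h => hsub nu (left_ne_zero_of_mul h),
    GLRep.det_intBinom, Nat.cast_sum]
  -- Weights in `L` have nonnegative entries, so the truncated multiplicity is the full one; it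
  -- remains to exchange the sums over `nu` and `w`.
  have h1 : ∀ nu ∈ L, ((GLRep.truncatedMultiplicity lam mu nu * GLRep.dimR n nu.1 : ℕ) : ℤ) =
      ∑ w : Equiv.Perm (Fin r), (Equiv.Perm.sign w : ℤ) *
        ((GLRep.weightDim nu (α w) : ℤ) * GLRep.dimR n nu.1) := by
    intro nu hnu
    rw [GLRep.truncatedMultiplicity, if_pos (hL0 nu hnu), Nat.cast_mul,
      GLRep.tensorMultiplicity_eq_sum_weightDim, Finset.sum_mul]
    exact Finset.sum_congr rfl fun w _ => mul_assoc _ _ _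
  rw [Finset.sum_congr rfl h1, Finset.sum_comm]
  refine Finset.sum_congr rfl fun w _ => ?_
  rw [← Finset.mul_sum, ← hL2 w]
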